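/- Let $k$ be a field of characteristic zero containing a primitive sixth root of unity $\zeta$ (for $k=\mathbb C$, $\zeta=e^{-2\pi i/6}$). Let $S_3=\{e,s,t,t^2,st,st^2\}$ with $s=(12)$, $t=(123)$, and let $\mathbb Z_6=\{u^0,\dots,u^5\}$. They form a matched pair: $u$ acts on the set $S_3$ from the right by the permutation $\triangleleft u=(st,st^2)(t,t^2)$, and $S_3$ acts on the set $\mathbb Z_6$ from the left, where $s\triangleright u^j=u^{-j}$ and $t\,\triangleright$ fixes $u^0,u^2,u^4$ and sends $u^5\mapsto u^3\mapsto u\mapsto u^5$. Let $A=k(S_3)\blacktriangleright\!\!\triangleleft k\mathbb Z_6$ be the bicrossproduct Hopf algebra with basis $\delta_a\otimes v$ ($a\in S_3$, $v\in\mathbb Z_6$) and $$(\delta_a\otimes v)(\delta_b\otimes w)=\delta_{a\triangleleft v,\,b}\;\delta_a\otimes vw,\quad \Delta(\delta_a\otimes v)=\sum_{bc=a}(\delta_b\otimes (c\triangleright v))\otimes(\delta_c\otimes v),\quad \varepsilon(\delta_a\otimes v)=\delta_{a,e}.$$ Write $va$ ($v\in\mathbb Z_6$, $a\in S_3$) for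 the functional on $A$ dual to $\delta_a\otimes v$, and let $\Pi(x)=x-x(1)\varepsilon$. A differential calculus on $A$ is an $A$-bimodule $\Omega^1$ with a linear map $d:A\to\Omega^1$ obeying the Leibniz rule and such that the elements $a\,db$ span $\Omega^1$. It is bicovariant if $\Omega^1$ is an $A$-bicomodule with coactions that are bimodule maps and $d$ is a bicomodule map, and irreducible if it is nonzero and has no proper nonzero bicovariant quotient. Its dimension is that of its space $\Lambda^1$ of left-invariant 1-forms. Its quantum tangent space $L\subset A^*$ is the space of functionals $x$ with $x(1)=0$ which vanish on all $a$ with $\varepsilon(a)=0$ and $\sum S(a_{(1)})\,da_{(2)}=0$. Put $H^0=\ker(d:A\to\Omega^1)$. Consider the calculi with quantum tangent space $\Pi(\mathcal M)$, where $\mathcal M$ is the span of the following vectors. * (i) $\sum_{j=0}^5(-1)^ju^j$. * (ii) $\sum_{j=0}^5\zeta^{cj}u^j$ for $c=1,2,4,5$. * (iii), (iv), (v) with $q=1,\ \zeta^4,\ \zeta^2$ respectively: $t^2+qu^2t^2+q^2u^4t^2$, $\ t+q^2u^2t+qu^4t$, $\ ut^2+qu^3t^2+q^2u^5t^2$, $\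 u^5t+q^2ut+qu^3t$. * (vi), (vii) with $q=1,\ -1$ respectively: $s+qu^3s$, $\ u^2s+qu^5s$, $\ us+qu^4s$, $\ st+qu^5st^2$, $\ u^2st+qust^2$, $\ u^4st+qu^3st^2$, $\ st^2+qust$, $\ u^3st+qu^2st^2$, $\ u^5st+qu^4st^2$. **Proposition.** $A$ is isomorphic as a bialgebra (hence as a Hopf algebra) to $D^*(S_3)$, the bicrossproduct of $k(S_3)$ and $kS_3$ for the matched pair in which $S_3$ acts on $S_3$ from the left by conjugation and from the right trivially. Each of (i)–(vii) exists as a bicovariant calculus on $A$, is unique up to isomorphism, is irreducible, and they have dimensions $1,4,4,4,4,9,9$ respectively. Every irreducible bicovariant calculus on $A$ is one of (i)–(vii), for exactly one number of the list. Among them, exactly the two 9-dimensional calculi (vi) and (vii) have $H^0=k\cdot 1$. -/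

import Mathlib

open scoped TensorProduct

universe u v w

/-! ### Matched pairs of groups -/

/-- A matched pair of groups: a left action `▷` of `M` on the set `G` and a right action `◁` of `G`
on the set `M` that satisfy the matching conditions, i.e. the data of a factorization `X = G M`
with `s u = (s ▷ u) (s ◁ u)`.  Here `lact s u` is `s ▷ u` and `ract s u` is `s ◁ u`. -/
structure MatchedPair (G M : Type*) [Group G] [Group M] where
  lact : M → G → G
  ract : M → G → M
  ract_one : ∀ s, ract s 1 = s
  one_lact : ∀ u, lact 1 u = u
  lact_one : ∀ s, lact s 1 = 1
  one_ract : ∀ u, ract 1 u = 1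
  ract_mul : ∀ s u v, ract s (u * v) = ract (ract s u) v
  mul_lact : ∀ s t u, lact (s * t) u = lact s (lact t u)
  lact_mul : ∀ s u v, lact s (u * v) = lact s u * lact (ract s u) v
  mul_ract : ∀ s t u, ract (s * t) u = ract s (lact t u) * ract t u

namespace MatchedPair

variable {G M : Type*} [Group G] [Group M] (P : MatchedPair G M)

theorem lact_inv_lact (s : M) (u : G) : P.lact s⁻¹ (P.lact s u) = u := by
  rw [← P.mul_lact, inv_mul_cancel, P.one_lact]

theorem ract_ract_inv (s : M) (u : G) : P.ract (P.ract s u) u⁻¹ = s := by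
  rw [← P.ract_mul, mul_inv_cancel, P.ract_one]

theorem inv_ract_lact (s : M) (u : G) : P.ract s⁻¹ (P.lact s u) = (P.ract s u)⁻¹ := by
  rw [eq_inv_iff_mul_eq_one, ← P.mul_ract, inv_mul_cancel, P.one_ract]

theorem ract_inv_lact (s : M) (u : G) : P.ract s (P.lact s⁻¹ u) = (P.ract s⁻¹ u)⁻¹ := by
  rw [eq_inv_iff_mul_eq_one, ← P.mul_ract, mul_inv_cancel, P.one_ract]

theorem inv_ract_inv (s : M) (u : G) : P.ract (P.ract s u)⁻¹ (P.lact s u)⁻¹ = s⁻¹ := by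
  rw [← P.inv_ract_lact, P.ract_ract_inv]

theorem ract_eq_one_iff (s : M) (u : G) : P.ract s u = 1 ↔ s = 1 := by
  constructor
  · intro h
    rw [← P.ract_ract_inv s u, h, P.one_ract]
  · rintro rfl
    exact P.one_ract u

/-- The conjugation action of `G` on itself, with the other action trivial. -/
def conj (G : Type*) [Group G] : MatchedPair G G where
  lact s u := s * u * s⁻¹
  ract s _ := s
  ract_one _ := rfl
  one_lact _ := by simp
  lact_one _ := by simp
  one_ract _ := rfl
  ract_mul _ _ _ := rfl
  mul_lact _ _ _ := by group
  lact_mul _ _ _ := by group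
  mul_ract _ _ _ := rfl

end MatchedPair

/-! ### The bicrossproduct Hopf algebra -/

/-- The vector space with basis `δ_s ⊗ u`, `s ∈ M`, `u ∈ G`, underlying the bicrossproduct
Hopf algebra of functions on `M` with the group algebra of `G`. -/
def Bicrossproduct (k : Type*) [Field k] {G M : Type*} [Group G] [Group M]
    (_P : MatchedPair G M) : Type _ := M × G →₀ k

namespace Bicrossproduct

section
variable {k : Type*} [Field k] {G M : Type*} [Group G] [Group M] {P : MatchedPair G M}

noncomputable instance : AddCommGroup (Bicrossproduct k P) :=
  inferInstanceAs (AddCommGroup (M × G →₀ k))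
noncomputable instance : Module k (Bicrossproduct k P) :=
  inferInstanceAs (Module k (M × G →₀ k))

variable (k P) in
/-- The basis `δ_s ⊗ u`, indexed by the pairs `(s, u)`. -/
noncomputable def basis : Module.Basis (M × G) k (Bicrossproduct k P) :=
  Module.Basis.ofRepr (LinearEquiv.refl k (M × G →₀ k))

variable (k P) in
/-- The basis element `δ_s ⊗ u`. -/
noncomputable def δ (s : M) (u : G) : Bicrossproduct k P := basis k P (s, u)

/-- The linear map with prescribed values on the elements `δ_s ⊗ u`. -/
noncomputable def lin {V : Type*} [AddCommGroup V] [Module k V] (f : M → G → V) :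
    Bicrossproduct k P →ₗ[k] V :=
  (basis k P).constr k fun p => f p.1 p.2

@[simp] theorem lin_δ {V : Type*} [AddCommGroup V] [Module k V] (f : M → G → V) (s : M) (u : G) :
    lin f (δ k P s u) = f s u := by
  simp [lin, δ]

theorem hom_ext {V : Type*} [AddCommGroup V] [Module k V] {f g : Bicrossproduct k P →ₗ[k] V}
    (h : ∀ s u, f (δ k P s u) = g (δ k P s u)) : f = g :=
  (basis k P).ext fun p => h p.1 p.2

/-- `1 = ∑ s, δ_s ⊗ e` -/
noncomputable instance [Fintype M] : One (Bicrossproduct k P) := ⟨∑ s : M, δ k P s 1⟩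

theorem one_def [Fintype M] : (1 : Bicrossproduct k P) = ∑ s : M, δ k P s 1 := rfl

variable [DecidableEq M]

/-- `(δ_s ⊗ u) (δ_t ⊗ v) = δ_{s ◁ u, t} (δ_s ⊗ u v)` -/
noncomputable def mulHom :
    Bicrossproduct k P →ₗ[k] Bicrossproduct k P →ₗ[k] Bicrossproduct k P :=
  lin fun s u => lin fun t v => if P.ract s u = t then δ k P s (u * v) else 0

noncomputable instance : Mul (Bicrossproduct k P) := ⟨fun a b => mulHom a b⟩

theorem mul_def (a b : Bicrossproduct k P) : a * b = mulHom a b := rfl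

theorem δ_mul_δ (s t : M) (u v : G) :
    δ k P s u * δ k P t v = if P.ract s u = t then δ k P s (u * v) else 0 := by
  simp [mul_def, mulHom]

protected theorem mul_assoc' (a b c : Bicrossproduct k P) : a * b * c = a * (b * c) := by
  have : (mulHom.compr₂ mulHom : Bicrossproduct k P →ₗ[k] Bicrossproduct k P →ₗ[k] _) =
      LinearMap.lcomp k (Bicrossproduct k P →ₗ[k] Bicrossproduct k P) mulHom ∘ₗ
        LinearMap.llcomp k (Bicrossproduct k P) (Bicrossproduct k P) (Bicrossproduct k P) ∘ₗ
          mulHom := by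
    refine hom_ext fun s u => hom_ext fun t v => hom_ext fun r w => ?_
    simp only [LinearMap.compr₂_apply, LinearMap.comp_apply, LinearMap.lcomp_apply,
      LinearMap.llcomp_apply, ← mul_def, δ_mul_δ]
    have z0 : ∀ a : Bicrossproduct k P, a * 0 = 0 := fun a => map_zero (mulHom a)
    have z1 : ∀ a : Bicrossproduct k P, 0 * a = 0 := fun a => by simp [mul_def]
    by_cases h : P.ract s u = t
    · subst h
      by_cases h' : P.ract (P.ract s u) v = r
      · subst h'
        simp [δ_mul_δ, P.ract_mul, mul_assoc]
      · simp [δ_mul_δ, P.ract_mul, h', z0]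
    · by_cases h' : P.ract t v = r
      · simp [δ_mul_δ, h, h', z1]
      · simp [h, h', z0, z1]
  exact congrArg (fun f => f a b c) this

variable [Fintype M]

protected theorem one_mul' (a : Bicrossproduct k P) : 1 * a = a := by
  have : mulHom (1 : Bicrossproduct k P) = LinearMap.id := by
    refine hom_ext fun t v => ?_
    simp only [one_def, map_sum, LinearMap.sum_apply]
    simp [← mul_def, δ_mul_δ, P.ract_one]
  exact congrArg (fun f => f a) this

protected theorem mul_one' (a : Bicrossproduct k P) : a * 1 = a := by
  have : mulHom.flip (1 : Bicrossproduct k P) = LinearMap.id := by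
    refine hom_ext fun t v => ?_
    simp only [one_def, map_sum]
    simp [← mul_def, δ_mul_δ]
  exact congrArg (fun f => f a) this

noncomputable instance : Ring (Bicrossproduct k P) :=
  { (inferInstance : AddCommGroup (Bicrossproduct k P)) with
    mul := (· * ·)
    one := 1
    mul_assoc := Bicrossproduct.mul_assoc'
    one_mul := Bicrossproduct.one_mul'
    mul_one := Bicrossproduct.mul_one'
    left_distrib := fun a b c => map_add (mulHom a) b c
    right_distrib := fun a b c => by simp [mul_def]
    zero_mul := fun a => by simp [mul_def]
    mul_zero := fun a => by simp [mul_def] }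

noncomputable instance : Algebra k (Bicrossproduct k P) :=
  Algebra.ofModule (fun r a b => by simp [mul_def]) (fun r a b => by simp [mul_def])

/-- `Δ (δ_s ⊗ u) = ∑_{a b = s} (δ_a ⊗ (b ▷ u)) ⊗ (δ_b ⊗ u)` -/
noncomputable def comulHom :
    Bicrossproduct k P →ₗ[k] Bicrossproduct k P ⊗[k] Bicrossproduct k P :=
  lin fun s u => ∑ a : M, δ k P a (P.lact (a⁻¹ * s) u) ⊗ₜ[k] δ k P (a⁻¹ * s) u

/-- `ε (δ_s ⊗ u) = δ_{s, e}` -/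
noncomputable def counitHom : Bicrossproduct k P →ₗ[k] k :=
  lin fun s _ => if s = 1 then 1 else 0

/-- `S (δ_s ⊗ u) = δ_{(s ◁ u)⁻¹} ⊗ (s ▷ u)⁻¹` -/
noncomputable def antipodeHom : Bicrossproduct k P →ₗ[k] Bicrossproduct k P :=
  lin fun s u => δ k P (P.ract s u)⁻¹ (P.lact s u)⁻¹

theorem comulHom_δ (s : M) (u : G) : comulHom (δ k P s u) =
    ∑ a : M, δ k P a (P.lact (a⁻¹ * s) u) ⊗ₜ[k] δ k P (a⁻¹ * s) u := by
  simp [comulHom]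

theorem counitHom_δ (s : M) (u : G) : counitHom (δ k P s u) = if s = 1 then 1 else 0 := by
  simp [counitHom]

theorem antipodeHom_δ (s : M) (u : G) :
    antipodeHom (δ k P s u) = δ k P (P.ract s u)⁻¹ (P.lact s u)⁻¹ := by
  simp [antipodeHom]

noncomputable instance : Coalgebra k (Bicrossproduct k P) where
  comul := comulHom
  counit := counitHom
  coassoc := by
    refine hom_ext fun s u => ?_
    simp only [LinearMap.comp_apply, comulHom_δ, map_sum, LinearMap.rTensor_tmul,
      LinearMap.lTensor_tmul, TensorProduct.sum_tmul, TensorProduct.tmul_sum,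
      LinearEquiv.coe_coe, TensorProduct.assoc_tmul]
    rw [Finset.sum_comm]
    refine Finset.sum_congr rfl fun a _ => ?_
    refine Fintype.sum_equiv (Equiv.mulLeft a⁻¹) _ _ fun b => ?_
    simp [mul_assoc, ← P.mul_lact]
  rTensor_counit_comp_comul := by
    refine hom_ext fun s u => ?_
    simp only [LinearMap.comp_apply, comulHom_δ, map_sum, LinearMap.rTensor_tmul, counitHom_δ]
    rw [Finset.sum_eq_single 1] <;> simp +contextual
  lTensor_counit_comp_comul := by
    refine hom_ext fun s u => ?_
    simp only [LinearMap.comp_apply, comulHom_δ, map_sum, LinearMap.lTensor_tmul, counitHom_δ]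
    rw [Finset.sum_eq_single s]
    · simp [P.one_lact]
    · intro b _ hb
      rw [if_neg, TensorProduct.tmul_zero]
      rw [inv_mul_eq_one]
      exact hb
    · simp

theorem counit_δ (s : M) (u : G) :
    Coalgebra.counit (R := k) (δ k P s u) = if s = 1 then 1 else 0 := counitHom_δ s u

theorem comul_δ (s : M) (u : G) : Coalgebra.comul (R := k) (δ k P s u) =
    ∑ a : M, δ k P a (P.lact (a⁻¹ * s) u) ⊗ₜ[k] δ k P (a⁻¹ * s) u := comulHom_δ s u

theorem counit_mul' (a b : Bicrossproduct k P) : Coalgebra.counit (R := k) (a * b) =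
    Coalgebra.counit (R := k) a * Coalgebra.counit (R := k) b := by
  have : mulHom.compr₂ (Coalgebra.counit (R := k) (A := Bicrossproduct k P)) =
      (LinearMap.mul k k).compl₁₂ (Coalgebra.counit (R := k) (A := Bicrossproduct k P))
        (Coalgebra.counit (R := k) (A := Bicrossproduct k P)) := by
    refine hom_ext fun s u => hom_ext fun t v => ?_
    simp only [LinearMap.compr₂_apply, LinearMap.compl₁₂_apply, ← mul_def, δ_mul_δ, counit_δ,
      LinearMap.mul_apply']
    by_cases hs : s = 1
    · subst hs
      by_cases ht : t = 1
      · simp [ht, P.one_ract, counit_δ]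
      · simp [ht, Ne.symm ht, P.one_ract]
    · by_cases h : P.ract s u = t <;> simp [h, hs, counit_δ]
  exact congrArg (fun f => f a b) this

theorem comul_mul' (a b : Bicrossproduct k P) : Coalgebra.comul (R := k) (a * b) =
    Coalgebra.comul (R := k) a * Coalgebra.comul (R := k) b := by
  have : mulHom.compr₂ (Coalgebra.comul (R := k) (A := Bicrossproduct k P)) =
      (LinearMap.mul k (Bicrossproduct k P ⊗[k] Bicrossproduct k P)).compl₁₂
        (Coalgebra.comul (R := k) (A := Bicrossproduct k P))
        (Coalgebra.comul (R := k) (A := Bicrossproduct k P)) := by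
    refine hom_ext fun s u => hom_ext fun t v => ?_
    simp only [LinearMap.compr₂_apply, LinearMap.compl₁₂_apply, ← mul_def, δ_mul_δ, comul_δ,
      LinearMap.mul_apply', Finset.sum_mul_sum, Algebra.TensorProduct.tmul_mul_tmul]
    have key : ∀ a : M, P.ract a (P.lact (a⁻¹ * s) u) * P.ract (a⁻¹ * s) u = P.ract s u := by
      intro a
      rw [← P.mul_ract]
      simp
    by_cases h : P.ract s u = t
    · subst h
      rw [if_pos rfl, comul_δ]
      refine Finset.sum_congr rfl fun a _ => ?_
      rw [Finset.sum_eq_single (P.ract a (P.lact (a⁻¹ * s) u))]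
      · have h2 : (P.ract a (P.lact (a⁻¹ * s) u))⁻¹ * P.ract s u = P.ract (a⁻¹ * s) u := by
          rw [← key a]
          group
        rw [h2, if_pos rfl, if_pos rfl, P.lact_mul]
      · intro b _ hb
        rw [if_neg (Ne.symm hb), TensorProduct.zero_tmul]
      · simp
    · rw [if_neg h, map_zero]
      symm
      refine Finset.sum_eq_zero fun a _ => Finset.sum_eq_zero fun c _ => ?_
      by_cases h1 : P.ract a (P.lact (a⁻¹ * s) u) = c
      · rw [if_neg (c := P.ract (a⁻¹ * s) u = c⁻¹ * t), TensorProduct.tmul_zero]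
        intro h2
        apply h
        rw [← key a, h1, h2]
        group
      · rw [if_neg h1, TensorProduct.zero_tmul]
  exact congrArg (fun f => f a b) this

noncomputable instance : Bialgebra k (Bicrossproduct k P) :=
  Bialgebra.mk' k (Bicrossproduct k P)
    (by
      rw [one_def, map_sum]
      simp [counit_δ])
    (fun {a b} => counit_mul' a b)
    (by
      rw [Algebra.TensorProduct.one_def, one_def, map_sum]
      simp only [comul_δ, P.lact_one, TensorProduct.sum_tmul, TensorProduct.tmul_sum]
      rw [Finset.sum_comm, eq_comm, Finset.sum_comm]
      refine Finset.sum_congr rfl fun a _ => ?_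
      exact (Fintype.sum_equiv (Equiv.mulLeft a⁻¹) _ _ fun b => rfl).symm)
    (fun {a b} => comul_mul' a b)

noncomputable instance : HopfAlgebra k (Bicrossproduct k P) where
  antipode := antipodeHom
  mul_antipode_rTensor_comul := by
    refine hom_ext fun s u => ?_
    simp only [LinearMap.comp_apply, comul_δ, map_sum, LinearMap.rTensor_tmul, antipodeHom_δ,
      LinearMap.mul'_apply, δ_mul_δ, counit_δ, P.inv_ract_inv, Algebra.linearMap_apply]
    by_cases h : s = 1
    · subst h
      simp only [mul_one, if_pos, ← P.mul_lact, mul_inv_cancel, P.one_lact, inv_mul_cancel,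
        P.ract_inv_lact, inv_inv, map_one, one_def]
      refine Fintype.sum_equiv
        ((Equiv.inv M).trans ⟨fun x => P.ract x u, fun x => P.ract x u⁻¹, fun x => by
          simp [P.ract_ract_inv], fun x => by
          simpa using P.ract_ract_inv x u⁻¹⟩) _ _ fun a => rfl
    · simp [h]
  mul_antipode_lTensor_comul := by
    refine hom_ext fun s u => ?_
    simp only [LinearMap.comp_apply, comul_δ, map_sum, LinearMap.lTensor_tmul, antipodeHom_δ,
      LinearMap.mul'_apply, δ_mul_δ, counit_δ, Algebra.linearMap_apply, mul_inv_cancel,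
      eq_inv_iff_mul_eq_one, ← P.mul_ract, mul_inv_cancel_left, P.ract_eq_one_iff]
    by_cases h : s = 1
    · simp [h, one_def]
    · simp [h]

end

end Bicrossproduct

/-! ### Differential calculi on a Hopf algebra -/

/-- A (first order) differential calculus over the `k`-algebra `A`: an `A`-`A`-bimodule `Form` of
1-forms and a linear map `d : A → Form` that obeys the Leibniz rule and such that the elements
`a (d b)` span `Form`. The right action of `a` on `w` is `MulOpposite.op a • w`. -/
structure DifferentialCalculus (k : Type u) (A : Type v) [Field k] [Ring A] [Algebra k A] where
  Form : Type w
  [instAddCommGroup : AddCommGroup Form]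
  [instModule : Module k Form]
  [instLeft : Module A Form]
  [instRight : Module Aᵐᵒᵖ Form]
  [instLeftTower : IsScalarTower k A Form]
  [instRightTower : IsScalarTower k Aᵐᵒᵖ Form]
  [instBimodule : SMulCommClass A Aᵐᵒᵖ Form]
  d : A →ₗ[k] Form
  leibniz : ∀ a b : A, d (a * b) = a • d b + MulOpposite.op b • d a
  span_d : Submodule.span A (Set.range d) = ⊤

attribute [instance] DifferentialCalculus.instAddCommGroup DifferentialCalculus.instModule
  DifferentialCalculus.instLeft DifferentialCalculus.instRight DifferentialCalculus.instLeftTower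
  DifferentialCalculus.instRightTower DifferentialCalculus.instBimodule

namespace DifferentialCalculus

variable {k A : Type*} [Field k] [Ring A] [Algebra k A]

/-- The left action `a ↦ (w ↦ a w)` on 1-forms. -/
noncomputable def leftMul (C : DifferentialCalculus k A) : A →ₗ[k] C.Form →ₗ[k] C.Form :=
  (Algebra.lsmul k k C.Form : A →ₐ[k] Module.End k C.Form).toLinearMap

/-- The right action `a ↦ (w ↦ w a)` on 1-forms. -/
noncomputable def rightMul (C : DifferentialCalculus k A) : A →ₗ[k] C.Form →ₗ[k] C.Form :=
  (Algebra.lsmul k k C.Form : Aᵐᵒᵖ →ₐ[k] Module.End k C.Form).toLinearMap ∘ₗ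
    (MulOpposite.opLinearEquiv k : A ≃ₗ[k] Aᵐᵒᵖ).toLinearMap

/-- The zeroth noncommutative de Rham cohomology: the kernel of `d` in degree zero. -/
def H0 (C : DifferentialCalculus k A) : Submodule k A := LinearMap.ker C.d

/-- A morphism of differential calculi over `A`: a bimodule map that intertwines the maps `d`.
It is automatically surjective and, for bicovariant calculi, a map of bicomodules. -/
structure Hom (C C' : DifferentialCalculus k A) where
  toFun : C.Form →ₗ[k] C'.Form
  map_left : ∀ (a : A) (w : C.Form), toFun (a • w) = a • toFun w
  map_right : ∀ (a : A) (w : C.Form),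
    toFun (MulOpposite.op a • w) = MulOpposite.op a • toFun w
  map_d : ∀ a : A, toFun (C.d a) = C'.d a

end DifferentialCalculus

/-- A bicovariant differential calculus over a Hopf algebra `A`: the 1-forms are an
`A`-`A`-bicomodule (coactions `coactL`, `coactR`), the coactions are bimodule maps, where `A` acts
on `A ⊗ Form` and `Form ⊗ A` through its coproduct, and `d` is a map of bicomodules. -/
structure BicovariantCalculus (k : Type u) (A : Type v) [Field k] [Ring A] [HopfAlgebra k A]
    extends DifferentialCalculus.{u, v, w} k A where
  coactL : Form →ₗ[k] A ⊗[k] Form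
  coactR : Form →ₗ[k] Form ⊗[k] A
  coactL_coassoc : ∀ w, (TensorProduct.assoc k A A Form)
    ((Coalgebra.comul (R := k) (A := A)).rTensor Form (coactL w)) = coactL.lTensor A (coactL w)
  coactL_counit : ∀ w, (TensorProduct.lid k Form)
    ((Coalgebra.counit (R := k) (A := A)).rTensor Form (coactL w)) = w
  coactR_coassoc : ∀ w, (TensorProduct.assoc k Form A A) (coactR.rTensor A (coactR w)) =
    (Coalgebra.comul (R := k) (A := A)).lTensor Form (coactR w)
  coactR_counit : ∀ w, (TensorProduct.rid k Form)
    ((Coalgebra.counit (R := k) (A := A)).lTensor Form (coactR w)) = w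
  coact_comm : ∀ w, (TensorProduct.assoc k A Form A) (coactL.rTensor A (coactR w)) =
    coactR.lTensor A (coactL w)
  coactL_left : ∀ (a : A) (w : Form), coactL (a • w) =
    TensorProduct.map₂ (LinearMap.mul k A) toDifferentialCalculus.leftMul
      (Coalgebra.comul (R := k) a) (coactL w)
  coactL_right : ∀ (a : A) (w : Form), coactL (MulOpposite.op a • w) =
    TensorProduct.map₂ (LinearMap.mul k A).flip toDifferentialCalculus.rightMul
      (Coalgebra.comul (R := k) a) (coactL w)
  coactR_left : ∀ (a : A) (w : Form), coactR (a • w) =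
    TensorProduct.map₂ toDifferentialCalculus.leftMul (LinearMap.mul k A)
      (Coalgebra.comul (R := k) a) (coactR w)
  coactR_right : ∀ (a : A) (w : Form), coactR (MulOpposite.op a • w) =
    TensorProduct.map₂ toDifferentialCalculus.rightMul (LinearMap.mul k A).flip
      (Coalgebra.comul (R := k) a) (coactR w)
  coactL_d : ∀ a : A, coactL (d a) = d.lTensor A (Coalgebra.comul (R := k) a)
  coactR_d : ∀ a : A, coactR (d a) = d.rTensor A (Coalgebra.comul (R := k) a)

namespace BicovariantCalculus

variable {k A : Type*} [Field k] [Ring A] [HopfAlgebra k A]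

/-- Isomorphic calculi. -/
def Isomorphic (C C' : BicovariantCalculus k A) : Prop :=
  ∃ f : C.toDifferentialCalculus.Hom C'.toDifferentialCalculus, Function.Bijective f.toFun

/-- A bicovariant calculus is irreducible (or coirreducible) if it is nonzero and has no proper
quotients: every morphism onto a nonzero bicovariant calculus is an isomorphism. -/
def Irreducible {k : Type u} {A : Type v} [Field k] [Ring A] [HopfAlgebra k A]
    (C : BicovariantCalculus.{u, v, w} k A) : Prop :=
  Nontrivial C.Form ∧ ∀ (C' : BicovariantCalculus.{u, v, w} k A)
    (f : C.toDifferentialCalculus.Hom C'.toDifferentialCalculus),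
    Nontrivial C'.Form → Function.Bijective f.toFun

/-- The space of (left-)invariant 1-forms. -/
def invariantForms (C : BicovariantCalculus k A) : Submodule k C.Form where
  carrier := {w | C.coactL w = 1 ⊗ₜ[k] w}
  add_mem' {x y} hx hy := by
    simp only [Set.mem_ofPred_eq] at *
    rw [map_add, hx, hy, TensorProduct.tmul_add]
  zero_mem' := by simp
  smul_mem' r x hx := by
    simp only [Set.mem_ofPred_eq] at *
    rw [map_smul, hx, TensorProduct.tmul_smul]

/-- The dimension of a calculus is the dimension of its space of invariant 1-forms. -/
noncomputable def dim (C : BicovariantCalculus k A) : ℕ := Module.finrank k C.invariantForms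

/-- The invariant 1-form `∑ S(a₁) d a₂` associated to `a`. -/
noncomputable def maurerCartan (C : BicovariantCalculus k A) : A →ₗ[k] C.Form :=
  TensorProduct.lift (C.leftMul.compl₁₂ (HopfAlgebra.antipode k) C.d) ∘ₗ
    Coalgebra.comul (R := k) (A := A)

/-- The quantum tangent space of a calculus: the functionals on `A` in the augmentation ideal of
the dual Hopf algebra (that is, vanishing at `1`) which factor through the quotient map
`a ↦ ∑ S(a₁) d a₂` from the augmentation ideal of `A` to the invariant 1-forms. -/
noncomputable def quantumTangentSpace (C : BicovariantCalculus k A) :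
    Submodule k (Module.Dual k A) where
  carrier := {x | x 1 = 0 ∧ ∀ a : A,
    Coalgebra.counit (R := k) a = 0 → C.maurerCartan a = 0 → x a = 0}
  add_mem' {x y} hx hy := ⟨by rw [LinearMap.add_apply, hx.1, hy.1, add_zero],
    fun a h h' => by rw [LinearMap.add_apply, hx.2 a h h', hy.2 a h h', add_zero]⟩
  zero_mem' := ⟨rfl, fun _ _ _ => rfl⟩
  smul_mem' r x hx := ⟨by rw [LinearMap.smul_apply, hx.1, smul_zero],
    fun a h h' => by rw [LinearMap.smul_apply, hx.2 a h h', smul_zero]⟩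

end BicovariantCalculus

/-! ### The bicrossproduct of functions on `S₃` and the group algebra of `ℤ₆` -/

/-- The symmetric group `S₃ = {e, t, t², s, s t, s t²}` on three letters; `DihedralGroup.r i` is
`t ^ i` and `DihedralGroup.sr i` is `s * t ^ i`. -/
abbrev S3 : Type := DihedralGroup 3

/-- The cyclic group of order six. -/
abbrev Z6 : Type := Multiplicative (ZMod 6)

namespace S3Z6

/-- The element `s = (1 2)`. -/
def s : S3 := DihedralGroup.sr 0
/-- The element `t = (1 2 3)`. -/
def t : S3 := DihedralGroup.r 1
/-- The generator of the cyclic group of order six. -/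
def u : Z6 := Multiplicative.ofAdd 1

/-- The permutation of three letters given by an element of `S3`. -/
def permOf : S3 → Equiv.Perm (Fin 3)
  | .r i => finRotate 3 ^ i.val
  | .sr i => Equiv.swap 0 1 * finRotate 3 ^ i.val

/-- The group `S3` is the symmetric group on three letters, with `s` a transposition and `t` a
three-cycle. -/
theorem exists_mulEquiv_perm : ∃ f : S3 ≃* Equiv.Perm (Fin 3),
    f s = Equiv.swap 0 1 ∧ f t = finRotate 3 := by
  refine ⟨MulEquiv.mk (Equiv.ofBijective permOf (by decide)) (by decide), ?_, ?_⟩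
  · change permOf s = _
    decide
  · change permOf t = _
    decide

/-- The right action `◁` of `ℤ₆` on `S₃`: the generator `u` exchanges `t` with `t²` and
`s t` with `s t²`. -/
def ract : S3 → Z6 → S3
  | .r i, j => .r ((-1) ^ j.toAdd.val * i)
  | .sr i, j => .sr ((-1) ^ j.toAdd.val * i)

/-- The left action `▷` of `S₃` on `ℤ₆`: `t` fixes the even powers of `u` and permutes the odd
ones cyclically by `u⁵ ↦ u³ ↦ u ↦ u⁵`, and `s` is the inversion. -/
def lact : S3 → Z6 → Z6
  | .r i, j => if j.toAdd.val % 2 = 0 then j else .ofAdd (j.toAdd - 2 * (i.val : ZMod 6))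
  | .sr i, j => if j.toAdd.val % 2 = 0 then j⁻¹ else .ofAdd (2 * (i.val : ZMod 6) - j.toAdd)

set_option maxRecDepth 100000 in
/-- The matched pair of actions of `S₃` and `ℤ₆`. -/
def pair : MatchedPair Z6 S3 where
  lact := lact
  ract := ract
  ract_one := by decide
  one_lact := by decide
  lact_one := by decide
  one_ract := by decide
  ract_mul := by decide
  mul_lact := by decide
  lact_mul := by decide
  mul_ract := by decide

variable {k : Type*} [Field k]

/-- The element `v m` of the vector space `kX` spanned by the group `X = ℤ₆ S₃`, identified with
the element `m ⊗ δ_v` of the dual Hopf algebra of the bicrossproduct; these form the basis dual to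
the basis `δ_m ⊗ v`. -/
noncomputable def elt (v : Z6) (m : S3) : Module.Dual k (Bicrossproduct k pair) :=
  (Bicrossproduct.basis k pair).coord (m, v)

/-- The projection `x ↦ x - x(1) ε` of the dual Hopf algebra to its augmentation ideal. -/
noncomputable def proj :
    Module.Dual k (Bicrossproduct k pair) →ₗ[k] Module.Dual k (Bicrossproduct k pair) :=
  LinearMap.id - (LinearMap.applyₗ (1 : Bicrossproduct k pair)).smulRight
    (Coalgebra.counit (R := k) (A := Bicrossproduct k pair))

/-- The basis for the conjugacy class of `e` and the sign character of `ℤ₆`. -/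
noncomputable def basisSign : Fin 1 → Module.Dual k (Bicrossproduct k pair) :=
  ![elt 1 1 - elt u 1 + elt (u ^ 2) 1 - elt (u ^ 3) 1 + elt (u ^ 4) 1 - elt (u ^ 5) 1]

/-- The basis for the conjugacy class of `e` and the four characters of `ℤ₆` of order 3 or 6;
here `q` is a primitive sixth root of unity. -/
noncomputable def basisChar (q : k) : Fin 4 → Module.Dual k (Bicrossproduct k pair) :=
  ![elt 1 1 + q • elt u 1 + q ^ 2 • elt (u ^ 2) 1
      - elt (u ^ 3) 1 - q • elt (u ^ 4) 1 - q ^ 2 • elt (u ^ 5) 1,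
    elt 1 1 + q ^ 2 • elt u 1 - q • elt (u ^ 2) 1
      + elt (u ^ 3) 1 + q ^ 2 • elt (u ^ 4) 1 - q • elt (u ^ 5) 1,
    elt 1 1 - q • elt u 1 + q ^ 2 • elt (u ^ 2) 1
      + elt (u ^ 3) 1 - q • elt (u ^ 4) 1 + q ^ 2 • elt (u ^ 5) 1,
    elt 1 1 - q ^ 2 • elt u 1 - q • elt (u ^ 2) 1
      - elt (u ^ 3) 1 + q ^ 2 • elt (u ^ 4) 1 + q • elt (u ^ 5) 1]

/-- The basis for the conjugacy class of `t`; here `q` is a cube root of unity. -/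
noncomputable def basisT (q : k) : Fin 4 → Module.Dual k (Bicrossproduct k pair) :=
  ![elt 1 (t ^ 2) + q • elt (u ^ 2) (t ^ 2) + q ^ 2 • elt (u ^ 4) (t ^ 2),
    elt 1 t + q ^ 2 • elt (u ^ 2) t + q • elt (u ^ 4) t,
    elt u (t ^ 2) + q • elt (u ^ 3) (t ^ 2) + q ^ 2 • elt (u ^ 5) (t ^ 2),
    elt (u ^ 5) t + q ^ 2 • elt u t + q • elt (u ^ 3) t]

/-- The basis for the conjugacy class of `s`; here `q` is `1` or `-1`. -/
noncomputable def basisS (q : k) : Fin 9 → Module.Dual k (Bicrossproduct k pair) :=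
  ![elt 1 s + q • elt (u ^ 3) s,
    elt (u ^ 2) s + q • elt (u ^ 5) s,
    elt u s + q • elt (u ^ 4) s,
    elt 1 (s * t) + q • elt (u ^ 5) (s * t ^ 2),
    elt (u ^ 2) (s * t) + q • elt u (s * t ^ 2),
    elt (u ^ 4) (s * t) + q • elt (u ^ 3) (s * t ^ 2),
    elt 1 (s * t ^ 2) + q • elt u (s * t),
    elt (u ^ 3) (s * t) + q • elt (u ^ 2) (s * t ^ 2),
    elt (u ^ 5) (s * t) + q • elt (u ^ 4) (s * t ^ 2)]

/-- The seven subspaces of `kX` which define the listed calculi, in the order (i), ..., (vii). The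
parameter `ζ` is a primitive sixth root of unity, in the complex case `exp (-2πi/6)`, so that
`ζ ^ 4 = exp (2πi/3)` and `ζ ^ 2 = exp (-2πi/3)`. -/
noncomputable def subspace (ζ : k) :
    Fin 7 → Submodule k (Module.Dual k (Bicrossproduct k pair)) :=
  ![Submodule.span k (Set.range basisSign),
    Submodule.span k (Set.range (basisChar ζ)),
    Submodule.span k (Set.range (basisT 1)),
    Submodule.span k (Set.range (basisT (ζ ^ 4))),
    Submodule.span k (Set.range (basisT (ζ ^ 2))),
    Submodule.span k (Set.range (basisS 1)),
    Submodule.span k (Set.range (basisS (-1)))]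

/-- `C` is the `n`-th calculus of the list (numbered from zero): its quantum tangent space is the
image of the `n`-th subspace in the augmentation ideal of the dual Hopf algebra. -/
def IsListedCalculus (ζ : k) (n : Fin 7)
    (C : BicovariantCalculus k (Bicrossproduct k pair)) : Prop :=
  C.quantumTangentSpace = (subspace ζ n).map proj

end S3Z6

/-! A bicovariant calculus on a finite-dimensional Hopf algebra `A` is determined by its quantum
tangent space `L`. With ω(b) = Σ S(b₁) db₂ one has Σ a db = Σ ab₁ ω(b₂), the invariant forms are the
values of ω, and Σ a db vanishes exactly when Σ ab₁ x(b₂) = 0 for all x in `L` (`mulD_eq_zero_iff`).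
So morphisms correspond to reversed inclusions of tangent spaces, the dimension is that of `L`, and
H⁰ is the common kernel of the maps b ↦ Σ b₁ x(b₂). The right action and right coaction on invariant
forms force the conditions of `IsTangentSpace`; conversely, A ⊗ A modulo the relations of such an
`L` is a bicovariant calculus (`IsTangentSpace.bicovariantCalculus`). Adding the counit to `L` turns
these conditions into plain invariance in A* under translation and the adjoint action.

For the algebra at hand A* is the space of functions on S₃ × ℤ₆, and invariance means closure under
cutting to the cells of a bigrading, under `shift` and under `conjMap`. The map `twist` commutes
with these symmetries and on each cell is a composite of two of them, so invariant subspaces are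
twist-invariant. Away from the unit of S₃ the cells are exactly the twist orbits, of length 3 over
the rotations and 2 over the reflections, and the symmetries move any cell of a type to any other.
Hence the minimal invariant subspaces there are the twist eigenspaces (`FunStable.block_le`): three
for the cube roots of unity and two for the square roots. Over the unit there is a single cell,
whose functions split into characters of ℤ₆. There `t` mixes the character r with −r unless r² = 1,
and `s` exchanges r with r⁻¹, so the nontrivial characters fall into {−1} and {ζ, ζ², ζ⁴, ζ⁵}; the
trivial character is the counit. This gives the seven subspaces, which are distinct modulo the
counit.

A tangent space without reflections kills the differential of the sum of the δ over the rotations,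
so H⁰ is too large; the two nine-dimensional ones contain vectors built on `s` and `s * t`, which
generate S₃, and these leave only scalars.

The isomorphism with D*(S₃) is explicit: a Fourier transform over the rotation subgroup gives the
images of the δ, and a diagonal element of reflections twisted by a cubic character gives the image
of `u`. The defining relations yield a bialgebra map, the images generate, and the dimensions agree.
-/

namespace HopfAlgebra

/-! ### Convolution, the adjoint coaction and the canonical map. -/

variable {k : Type*} {A : Type*} [Field k] [Ring A] [HopfAlgebra k A]
variable {V W : Type*} [AddCommGroup V] [Module k V] [AddCommGroup W] [Module k W]

/-- The convolution `b ↦ ∑ ρ(b₁) X(b₂)`. -/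
noncomputable def conv (ρ : A →ₗ[k] Module.End k V) (X : A →ₗ[k] V) : A →ₗ[k] V :=
  TensorProduct.lift (ρ.compl₂ X) ∘ₗ Coalgebra.comul (R := k)

theorem conv_eq_sum (ρ : A →ₗ[k] Module.End k V) (X : A →ₗ[k] V) {b : A} {ι : Type*}
    (r : Coalgebra.Repr k b ι) :
    conv ρ X b = ∑ i ∈ r.index, ρ (r.left i) (X (r.right i)) := by
  simp [conv, ← r.eq]

/-- The product map `a ⊗ b ↦ ρ(a) X(b)` after coproducts of the two factors. -/
theorem lift_lTensor_comul (σ τ : A →ₗ[k] Module.End k V) (X : A →ₗ[k] V) :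
    conv σ (conv τ X) =
      TensorProduct.lift ((TensorProduct.lift
        ((LinearMap.mul k (Module.End k V)).compl₁₂ σ τ)).compl₂ X) ∘ₗ
        (Coalgebra.comul (R := k) (A := A)).rTensor A ∘ₗ Coalgebra.comul (R := k) := by
  have h : TensorProduct.lift (σ.compl₂ (conv τ X)) =
      (TensorProduct.lift ((TensorProduct.lift
        ((LinearMap.mul k (Module.End k V)).compl₁₂ σ τ)).compl₂ X) ∘ₗ
        (TensorProduct.assoc k A A A).symm.toLinearMap) ∘ₗ
        (Coalgebra.comul (R := k) (A := A)).lTensor A := by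
    ext x y
    simp only [conv, TensorProduct.AlgebraTensorModule.curry_apply, LinearMap.restrictScalars_self,
      TensorProduct.curry_apply, TensorProduct.lift.tmul, LinearMap.compl₂_apply,
      LinearMap.comp_apply, LinearMap.lTensor_tmul, LinearEquiv.coe_coe]
    generalize Coalgebra.comul (R := k) y = t
    induction t with
    | zero => simp
    | tmul p q => simp
    | add p q hp hq => simp [TensorProduct.tmul_add, hp, hq]
  ext b
  rw [conv, h]
  simp only [LinearMap.comp_apply, LinearEquiv.coe_coe, Coalgebra.coassoc_symm_apply]

theorem lift_counit_smul (X : A →ₗ[k] V) (b : A) :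
    TensorProduct.lift ((LinearMap.lsmul k V ∘ₗ Coalgebra.counit (R := k) (A := A)).compl₂ X)
      (Coalgebra.comul (R := k) b) = X b := by
  obtain ⟨r⟩ : Nonempty (Coalgebra.Repr k b (A × A)) := ⟨Coalgebra.Repr.arbitrary k b⟩
  rw [← r.eq]
  conv_rhs => rw [← Coalgebra.sum_counit_smul r]
  simp

/-- Convolution is associative and ρ is an algebra map, so ρ ∘ S is a convolution inverse of ρ: the
factor S(b₁)b₂ collapses to ε. -/
theorem conv_antipode_conv (ρ : A →ₐ[k] Module.End k V) (X : A →ₗ[k] V) :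
    conv (ρ.toLinearMap ∘ₗ antipode k) (conv ρ.toLinearMap X) = X := by
  rw [lift_lTensor_comul]
  ext b
  rw [← lift_counit_smul X b, LinearMap.comp_apply, LinearMap.comp_apply]
  generalize Coalgebra.comul (R := k) b = t
  induction t with
  | zero => simp
  | add p q hp hq => simp only [map_add, hp, hq]
  | tmul p q =>
    simp only [LinearMap.rTensor_tmul, TensorProduct.lift.tmul, LinearMap.compl₂_apply,
      LinearMap.comp_apply, LinearMap.lsmul_apply]
    have := congrArg ρ (mul_antipode_rTensor_comul_apply (R := k) p)
    rw [AlgHom.commutes] at this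
    have h2 := congrArg (fun f : Module.End k V => f (X q)) this
    simp only [Module.algebraMap_end_apply] at h2
    rw [← h2]
    generalize Coalgebra.comul (R := k) p = t
    induction t with
    | zero => simp
    | add p q hp hq => simp only [map_add, hp, hq, LinearMap.add_apply]
    | tmul p q => simp

theorem conv_conv_antipode (ρ : A →ₐ[k] Module.End k V) (X : A →ₗ[k] V) :
    conv ρ.toLinearMap (conv (ρ.toLinearMap ∘ₗ antipode k) X) = X := by
  rw [lift_lTensor_comul]
  ext b
  rw [← lift_counit_smul X b, LinearMap.comp_apply, LinearMap.comp_apply]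
  generalize Coalgebra.comul (R := k) b = t
  induction t with
  | zero => simp
  | add p q hp hq => simp only [map_add, hp, hq]
  | tmul p q =>
    simp only [LinearMap.rTensor_tmul, TensorProduct.lift.tmul, LinearMap.compl₂_apply,
      LinearMap.comp_apply, LinearMap.lsmul_apply]
    have := congrArg ρ (mul_antipode_lTensor_comul_apply (R := k) p)
    rw [AlgHom.commutes] at this
    have h2 := congrArg (fun f : Module.End k V => f (X q)) this
    simp only [Module.algebraMap_end_apply] at h2
    rw [← h2]
    generalize Coalgebra.comul (R := k) p = t
    induction t with
    | zero => simp
    | add p q hp hq => simp only [map_add, hp, hq, LinearMap.add_apply]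
    | tmul p q => simp

/-- Identities that involve the antipode are proved below by convolving both sides with ρ, after
which S has disappeared. -/
theorem conv_injective (ρ : A →ₐ[k] Module.End k V) :
    Function.Injective (conv ρ.toLinearMap : (A →ₗ[k] V) → A →ₗ[k] V) := fun X Y h => by
  rw [← conv_antipode_conv ρ X, h, conv_antipode_conv]

/-- The tensor product of two representations. -/
noncomputable def tensorRep (f : A →ₐ[k] Module.End k V) (g : A →ₐ[k] Module.End k W) :
    A →ₐ[k] Module.End k (V ⊗[k] W) :=
  Module.endTensorEndAlgHom.comp
    ((Algebra.TensorProduct.map f g).comp (Bialgebra.comulAlgHom k A))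

theorem tensorRep_apply (f : A →ₐ[k] Module.End k V) (g : A →ₐ[k] Module.End k W) (a : A)
    (w : V ⊗[k] W) : tensorRep f g a w =
      TensorProduct.map₂ f.toLinearMap g.toLinearMap (Coalgebra.comul (R := k) a) w := by
  simp only [tensorRep, AlgHom.comp_apply, Bialgebra.comulAlgHom_apply]
  generalize Coalgebra.comul (R := k) a = t
  induction t with
  | zero => simp
  | add p q hp hq => simp only [map_add, LinearMap.add_apply, hp, hq]
  | tmul p q =>
    induction w with
    | zero => simp
    | add p q hp hq => simp only [map_add, hp, hq]
    | tmul x y => simp [Module.endTensorEndAlgHom_apply]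

theorem tensorRep_tmul (f : A →ₐ[k] Module.End k V) (g : A →ₐ[k] Module.End k W) (a : A)
    (v : V) (w : W) : tensorRep f g a (v ⊗ₜ w) =
      TensorProduct.map (f.toLinearMap.flip v) (g.toLinearMap.flip w)
        (Coalgebra.comul (R := k) a) := by
  rw [tensorRep_apply]
  generalize Coalgebra.comul (R := k) a = t
  induction t with
  | zero => simp
  | add p q hp hq => simp only [map_add, LinearMap.add_apply, hp, hq]
  | tmul p q => simp

/-- By coassociativity both sides are Σ f(b₁)v ⊗ g(b₂)X(b₃). With f the left multiplication of A and
v = 1 this is the left coaction of Σ b₁X(b₂) for X with invariant values. -/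
theorem conv_tensorRep (f : A →ₐ[k] Module.End k V) (g : A →ₐ[k] Module.End k W) (v : V)
    (X : A →ₗ[k] W) : conv (tensorRep f g).toLinearMap (TensorProduct.mk k V W v ∘ₗ X) =
      TensorProduct.map (f.toLinearMap.flip v) (conv g.toLinearMap X) ∘ₗ
        Coalgebra.comul (R := k) := by
  have h1 : TensorProduct.map (f.toLinearMap.flip v) (conv g.toLinearMap X) =
      TensorProduct.map (f.toLinearMap.flip v) (TensorProduct.lift (g.toLinearMap.compl₂ X)) ∘ₗ
        (Coalgebra.comul (R := k) (A := A)).lTensor A := by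
    ext x y
    simp [conv]
  rw [h1]
  ext b
  simp only [LinearMap.comp_apply, ← Coalgebra.coassoc_apply, conv]
  generalize Coalgebra.comul (R := k) b = t
  induction t with
  | zero => simp
  | add p q hp hq => simp only [map_add, hp, hq]
  | tmul p q =>
    simp only [TensorProduct.lift.tmul, LinearMap.compl₂_apply, LinearMap.comp_apply,
      TensorProduct.mk_apply, AlgHom.toLinearMap_apply, tensorRep_tmul, LinearMap.rTensor_tmul]
    generalize Coalgebra.comul (R := k) p = t
    induction t with
    | zero => simp
    | add p q hp hq => simp only [map_add, hp, hq, TensorProduct.add_tmul]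
    | tmul p q => simp

/-- `a ↦ (x ⊗ y ↦ x ⊗ a y)`. -/
noncomputable def lmulRight (k A : Type*) [Field k] [Ring A] [HopfAlgebra k A] :
    A →ₐ[k] Module.End k (A ⊗[k] A) :=
  (Algebra.lmul k (A ⊗[k] A)).comp Algebra.TensorProduct.includeRight

@[simp] theorem lmulRight_tmul (a x y : A) : lmulRight k A a (x ⊗ₜ y) = x ⊗ₜ (a * y) := by
  simp [lmulRight]

/-- The right adjoint coaction `b ↦ ∑ b₂ ⊗ S(b₁) b₃`. -/
noncomputable def adCoact (k A : Type*) [Field k] [Ring A] [HopfAlgebra k A] :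
    A →ₗ[k] A ⊗[k] A :=
  conv ((lmulRight k A).toLinearMap ∘ₗ antipode k) (Coalgebra.comul (R := k))

/-- The product b₁S(b₂) cancels. This characterises the adjoint coaction without the antipode, and
it is the form in which it is used. -/
theorem conv_adCoact : conv (lmulRight k A).toLinearMap (adCoact k A) = Coalgebra.comul (R := k) :=
  conv_conv_antipode _ _

/-- The map `b ↦ ∑ b₁ x(b₂)`. -/
noncomputable def dualAct (x : Module.Dual k A) : A →ₗ[k] A :=
  (TensorProduct.rid k A).toLinearMap ∘ₗ x.lTensor A ∘ₗ Coalgebra.comul (R := k)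

theorem dualAct_eq_sum (x : Module.Dual k A) {b : A} {ι : Type*} (r : Coalgebra.Repr k b ι) :
    dualAct x b = ∑ i ∈ r.index, x (r.right i) • r.left i := by
  simp [dualAct, ← r.eq]

/-- The map `a ⊗ b ↦ ∑ a b₁ x(b₂)`. -/
noncomputable def contract (x : Module.Dual k A) : A ⊗[k] A →ₗ[k] A :=
  LinearMap.mul' k A ∘ₗ (dualAct x).lTensor A

@[simp] theorem contract_tmul (x : Module.Dual k A) (a b : A) :
    contract x (a ⊗ₜ b) = a * dualAct x b := by
  simp [contract]

theorem counit_dualAct (x : Module.Dual k A) (b : A) :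
    Coalgebra.counit (R := k) (dualAct x b) = x b := by
  obtain ⟨r⟩ : Nonempty (Coalgebra.Repr k b (A × A)) := ⟨Coalgebra.Repr.arbitrary k b⟩
  rw [dualAct_eq_sum x r]
  conv_rhs => rw [← Coalgebra.sum_counit_smul r]
  simp [mul_comm]

/-- The canonical map `a ⊗ b ↦ ∑ a b₁ ⊗ b₂`. -/
noncomputable def canon (k A : Type*) [Field k] [Ring A] [HopfAlgebra k A] :
    A ⊗[k] A →ₗ[k] A ⊗[k] A :=
  TensorProduct.lift ((LinearMap.mul k (A ⊗[k] A)).compl₁₂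
    (Algebra.TensorProduct.includeLeft (R := k) (S := k) (A := A) (B := A)).toLinearMap
      (Coalgebra.comul (R := k)))

theorem canon_tmul (a b : A) :
    canon k A (a ⊗ₜ b) = (a ⊗ₜ[k] (1 : A)) * Coalgebra.comul (R := k) b := by
  simp [canon]

/-- `canon` brings a ⊗ b to its left-trivialized form Σ ab₁ ⊗ b₂, where x only meets the second leg.
-/
theorem contract_eq (x : Module.Dual k A) (n : A ⊗[k] A) :
    contract x n = TensorProduct.rid k A (x.lTensor A (canon k A n)) := by
  induction n with
  | zero => simp
  | add p q hp hq => simp only [map_add, hp, hq]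
  | tmul a b =>
    simp only [contract_tmul, canon_tmul, dualAct, LinearMap.comp_apply]
    generalize Coalgebra.comul (R := k) b = t
    induction t with
    | zero => simp
    | add p q hp hq => simp_all [mul_add]
    | tmul p q => simp

/-- The right multiplication `(a ⊗ b) c = a ⊗ b c - a b ⊗ c` on `A ⊗ A`, in which `a ⊗ b` stands
for the 1-form `a (d b)`. -/
noncomputable def rightMulDiff (k : Type*) {A : Type*} [Field k] [Ring A] [HopfAlgebra k A] :
    A →ₗ[k] Module.End k (A ⊗[k] A) :=
  (LinearMap.lTensorHom A ∘ₗ (LinearMap.mul k A).flip) -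
    (LinearMap.lcomp k (A ⊗[k] A) (LinearMap.mul' k A) ∘ₗ (TensorProduct.mk k A A).flip)

@[simp] theorem rightMulDiff_tmul (a b c : A) :
    rightMulDiff k c (a ⊗ₜ b) = a ⊗ₜ (b * c) - (a * b) ⊗ₜ c := by
  simp [rightMulDiff]

end HopfAlgebra

theorem TensorProduct.eq_zero_of_forall_dual {k V W : Type*} [Field k] [AddCommGroup V]
    [Module k V] [AddCommGroup W] [Module k W] (t : V ⊗[k] W)
    (h : ∀ g : Module.Dual k W, g.lTensor V t = 0) : t = 0 := by
  let b := Module.Basis.ofVectorSpace k V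
  let c := Module.Basis.ofVectorSpace k W
  refine (b.tensorProduct c).ext_elem fun ⟨i, j⟩ => ?_
  have h1 : ∀ t : V ⊗[k] W, (b.tensorProduct c).repr t (i, j) =
      b.coord i (TensorProduct.rid k V ((c.coord j).lTensor V t)) := by
    intro t
    induction t with
    | zero => simp
    | add p q hp hq => simp only [map_add, Finsupp.add_apply, hp, hq]
    | tmul x y => simp [Module.Basis.tensorProduct_repr_tmul_apply]
  rw [h1, h]
  simp

open HopfAlgebra

theorem Coalgebra.sum_counit_right_smul {k A : Type*} [Field k] [AddCommGroup A] [Module k A]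
    [Coalgebra k A] {a : A} {ι : Type*} (r : Coalgebra.Repr k a ι) :
    ∑ i ∈ r.index, Coalgebra.counit (R := k) (r.right i) • r.left i = a := by
  have h := Coalgebra.lTensor_counit_comul (R := k) a
  rw [← r.eq] at h
  have h2 := congrArg (_root_.TensorProduct.rid k A) h
  simpa only [map_sum, LinearMap.lTensor_tmul, _root_.TensorProduct.rid_tmul, one_smul]
    using h2

/-! ### Calculi as quotients of A ⊗ A. -/

namespace DifferentialCalculus

variable {k A : Type*} [Field k] [Ring A] [HopfAlgebra k A] (C : DifferentialCalculus k A)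

@[simp] theorem leftMul_apply (a : A) (w : C.Form) : C.leftMul a w = a • w := rfl

@[simp] theorem rightMul_apply (a : A) (w : C.Form) :
    C.rightMul a w = MulOpposite.op a • w := rfl

/-- The map `a ⊗ b ↦ a (d b)`. -/
noncomputable def mulD : A ⊗[k] A →ₗ[k] C.Form := TensorProduct.lift (C.leftMul.compl₂ C.d)

@[simp] theorem mulD_tmul (a b : A) : C.mulD (a ⊗ₜ b) = a • C.d b := rfl

theorem d_one : C.d 1 = 0 := by
  have := C.leibniz 1 1
  simpa using this

theorem mulD_lmul (a : A) (n : A ⊗[k] A) :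
    C.mulD ((LinearMap.mulLeft k a).rTensor A n) = a • C.mulD n := by
  induction n with
  | zero => simp
  | add p q hp hq => simp only [map_add, hp, hq, smul_add]
  | tmul p q => simp [mul_smul]

theorem mulD_rightMulDiff (c : A) (n : A ⊗[k] A) :
    C.mulD (rightMulDiff k c n) = MulOpposite.op c • C.mulD n := by
  induction n with
  | zero => simp
  | add p q hp hq => simp only [map_add, hp, hq, smul_add]
  | tmul p q =>
    simp only [rightMulDiff_tmul, map_sub, mulD_tmul, C.leibniz, smul_add, mul_smul]
    rw [add_sub_cancel_left, smul_comm]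

theorem mulD_surjective : Function.Surjective C.mulD := by
  rw [← LinearMap.range_eq_top]
  let R : Submodule A C.Form :=
    { LinearMap.range C.mulD with
      smul_mem' := by
        rintro a _ ⟨n, rfl⟩
        exact ⟨_, C.mulD_lmul a n⟩ }
  have hR : R = ⊤ := by
    rw [eq_top_iff, ← C.span_d, Submodule.span_le]
    rintro _ ⟨a, rfl⟩
    exact ⟨1 ⊗ₜ a, by simp⟩
  rw [eq_top_iff]
  intro w _
  have : w ∈ R := hR ▸ Submodule.mem_top
  exact this

variable {C} {C' : DifferentialCalculus k A}

theorem Hom.mulD (f : C.Hom C') (n : A ⊗[k] A) : f.toFun (C.mulD n) = C'.mulD n := by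
  induction n with
  | zero => simp
  | add p q hp hq => simp only [map_add, hp, hq]
  | tmul p q => simp [f.map_left, f.map_d]

theorem Hom.surjective (f : C.Hom C') : Function.Surjective f.toFun := fun w => by
  obtain ⟨n, rfl⟩ := C'.mulD_surjective w
  exact ⟨_, f.mulD n⟩

/-- Each calculus is A ⊗ A modulo the kernel of `mulD`, and both actions of A lift to A ⊗ A, so it
is enough to compare kernels. -/
theorem exists_hom (h : LinearMap.ker C.mulD ≤ LinearMap.ker C'.mulD) : Nonempty (C.Hom C') := by
  let f : C.Form →ₗ[k] C'.Form := (LinearMap.ker C.mulD).liftQ C'.mulD h ∘ₗ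
    (C.mulD.quotKerEquivOfSurjective C.mulD_surjective).symm.toLinearMap
  have hf : ∀ n, f (C.mulD n) = C'.mulD n := fun n => by
    have : (C.mulD.quotKerEquivOfSurjective C.mulD_surjective).symm (C.mulD n) =
        (LinearMap.ker C.mulD).mkQ n := by
      rw [LinearEquiv.symm_apply_eq]
      rfl
    simp [f, this]
  refine ⟨⟨f, fun a w => ?_, fun a w => ?_, fun a => ?_⟩⟩
  · obtain ⟨n, rfl⟩ := C.mulD_surjective w
    rw [← mulD_lmul, hf, hf, mulD_lmul]
  · obtain ⟨n, rfl⟩ := C.mulD_surjective w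
    rw [← mulD_rightMulDiff, hf, hf, mulD_rightMulDiff]
  · simpa using hf (1 ⊗ₜ a)

end DifferentialCalculus

/-! ### Invariant forms and the quantum tangent space. -/

namespace BicovariantCalculus

variable {k A : Type*} [Field k] [Ring A] [HopfAlgebra k A] (C C' : BicovariantCalculus k A)

open DifferentialCalculus

theorem maurerCartan_eq : C.maurerCartan =
    conv ((Algebra.lsmul k k C.Form : A →ₐ[k] Module.End k C.Form).toLinearMap ∘ₗ antipode k)
      C.d := by
  rw [maurerCartan, conv]
  congr 1

/-- This is db = Σ b₁ω(b₂), the inverse of the formula for ω; it carries statements about d over to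
ω and back. -/
theorem conv_maurerCartan :
    conv (Algebra.lsmul k k C.Form : A →ₐ[k] Module.End k C.Form).toLinearMap C.maurerCartan =
      C.d := by
  rw [maurerCartan_eq, conv_conv_antipode]

theorem maurerCartan_one : C.maurerCartan 1 = 0 := by
  simp [maurerCartan, Algebra.TensorProduct.one_def, C.d_one]

theorem coactL_smul (a : A) (w : C.Form) : C.coactL (a • w) =
    tensorRep (Algebra.lmul k A) (Algebra.lsmul k k C.Form) a (C.coactL w) := by
  rw [C.coactL_left, tensorRep_apply]
  rfl

theorem coactR_smul (a : A) (w : C.Form) : C.coactR (a • w) =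
    tensorRep (Algebra.lsmul k k C.Form) (Algebra.lmul k A) a (C.coactR w) := by
  rw [C.coactR_left, tensorRep_apply]
  rfl

/-- Convolved with the action, both sides become b ↦ Σ b₁ ⊗ db₂: one because the coaction is a
module map and d is colinear, the other by coassociativity. -/
theorem coactL_comp_maurerCartan :
    C.coactL ∘ₗ C.maurerCartan = TensorProduct.mk k A C.Form 1 ∘ₗ C.maurerCartan := by
  apply conv_injective (tensorRep (Algebra.lmul k A) (Algebra.lsmul k k C.Form))
  rw [conv_tensorRep, conv_maurerCartan]
  have h1 : conv (tensorRep (Algebra.lmul k A) (Algebra.lsmul k k C.Form)).toLinearMap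
      (C.coactL ∘ₗ C.maurerCartan) = C.coactL ∘ₗ C.d := by
    rw [← C.conv_maurerCartan, conv, conv, ← LinearMap.comp_assoc]
    congr 1
    ext x y
    simp [coactL_smul]
  rw [h1]
  ext b
  rw [LinearMap.comp_apply, C.coactL_d]
  simp only [LinearMap.comp_apply, LinearMap.lTensor]
  congr 2
  ext x
  simp

theorem coactL_maurerCartan (b : A) : C.coactL (C.maurerCartan b) = 1 ⊗ₜ C.maurerCartan b :=
  congrArg (fun f => f b) C.coactL_comp_maurerCartan

/-- Convolved with the action, the left side is the right coaction of db. On the right side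
`conv_adCoact` removes the antipode and leaves Σ b₁ω(b₂) ⊗ b₃ = Σ db₁ ⊗ b₂. -/
theorem coactR_comp_maurerCartan :
    C.coactR ∘ₗ C.maurerCartan = C.maurerCartan.rTensor A ∘ₗ adCoact k A := by
  apply conv_injective (tensorRep (Algebra.lsmul k k C.Form) (Algebra.lmul k A))
  have h1 : conv (tensorRep (Algebra.lsmul k k C.Form) (Algebra.lmul k A)).toLinearMap
      (C.coactR ∘ₗ C.maurerCartan) = C.coactR ∘ₗ C.d := by
    rw [← C.conv_maurerCartan, conv, conv, ← LinearMap.comp_assoc]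
    congr 1
    ext x y
    simp [coactR_smul]
  let Ψ : A ⊗[k] (A ⊗[k] A) →ₗ[k] C.Form ⊗[k] A :=
    (TensorProduct.lift (C.leftMul.compl₂ C.maurerCartan)).rTensor A ∘ₗ
      (TensorProduct.assoc k A A A).symm.toLinearMap
  have h2 : conv (tensorRep (Algebra.lsmul k k C.Form) (Algebra.lmul k A)).toLinearMap
      (C.maurerCartan.rTensor A ∘ₗ adCoact k A) =
      Ψ ∘ₗ (conv (lmulRight k A).toLinearMap (adCoact k A)).lTensor A ∘ₗ
        Coalgebra.comul (R := k) := by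
    have h3 : Ψ ∘ₗ (conv (lmulRight k A).toLinearMap (adCoact k A)).lTensor A ∘ₗ
        Coalgebra.comul (R := k) = Ψ ∘ₗ (TensorProduct.lift ((lmulRight k A).toLinearMap.compl₂
          (adCoact k A))).lTensor A ∘ₗ (TensorProduct.assoc k A A A).toLinearMap ∘ₗ
          (Coalgebra.comul (R := k) (A := A)).rTensor A ∘ₗ Coalgebra.comul (R := k) := by
      ext b
      simp only [conv, LinearMap.lTensor_comp, LinearMap.comp_apply, LinearEquiv.coe_coe,
        Coalgebra.coassoc_apply]
    rw [h3, conv, ← LinearMap.comp_assoc, ← LinearMap.comp_assoc, ← LinearMap.comp_assoc]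
    congr 1
    refine TensorProduct.ext' fun x y => ?_
    simp only [TensorProduct.lift.tmul, LinearMap.compl₂_apply, LinearMap.comp_apply,
      LinearMap.rTensor_tmul, AlgHom.toLinearMap_apply, LinearEquiv.coe_coe, tensorRep_apply]
    generalize Coalgebra.comul (R := k) x = r
    induction r with
    | zero => simp
    | add p q hp hq => simp only [map_add, LinearMap.add_apply, hp, hq, TensorProduct.add_tmul]
    | tmul p q =>
      simp only [TensorProduct.assoc_tmul, LinearMap.lTensor_tmul, TensorProduct.lift.tmul,
        LinearMap.compl₂_apply, AlgHom.toLinearMap_apply]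
      generalize adCoact k A y = t
      induction t with
      | zero => simp
      | add p q hp hq => simp only [map_add, hp, hq, TensorProduct.tmul_add]
      | tmul z z' => simp [Ψ]
  rw [h1, h2, conv_adCoact]
  ext b
  rw [LinearMap.comp_apply, C.coactR_d, ← C.conv_maurerCartan]
  simp only [Ψ, LinearMap.comp_apply, LinearEquiv.coe_coe, Coalgebra.coassoc_symm_apply, conv,
    LinearMap.rTensor_comp]
  rfl

theorem coactR_maurerCartan (b : A) :
    C.coactR (C.maurerCartan b) = C.maurerCartan.rTensor A (adCoact k A b) :=
  congrArg (fun f => f b) C.coactR_comp_maurerCartan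

/-- `ω(b) e = ∑ e₁ ω(b e₂) - ε(b) d e` -/
theorem op_smul_maurerCartan (b : A) {e : A} {ι : Type*} (r : Coalgebra.Repr k e ι) :
    MulOpposite.op e • C.maurerCartan b =
      ∑ i ∈ r.index, r.left i • C.maurerCartan (b * r.right i) -
        Coalgebra.counit (R := k) b • C.d e := by
  let X : A →ₗ[k] C.Form := C.rightMul e ∘ₗ C.maurerCartan
  let Y : A →ₗ[k] C.Form :=
    ∑ i ∈ r.index, C.leftMul (r.left i) ∘ₗ C.maurerCartan ∘ₗ LinearMap.mulRight k (r.right i)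
      - (Coalgebra.counit (R := k) (A := A)).smulRight (C.d e)
  have hXY : X = Y := by
    apply conv_injective (Algebra.lsmul k k C.Form : A →ₐ[k] Module.End k C.Form)
    ext b
    obtain ⟨q⟩ : Nonempty (Coalgebra.Repr k b (A × A)) := ⟨Coalgebra.Repr.arbitrary k b⟩
    -- Leibniz for d(be), with d expanded through ω at be and at b, is the claim convolved in b.
    have e1 := C.leibniz b e
    rw [← C.conv_maurerCartan, conv_eq_sum _ _ (q.mul r), conv_eq_sum _ _ q] at e1
    have e2 := Coalgebra.sum_counit_right_smul q
    rw [conv_eq_sum _ _ q, conv_eq_sum _ _ q]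
    simp only [X, Y, LinearMap.sub_apply, LinearMap.sum_apply, LinearMap.comp_apply,
      rightMul_apply, leftMul_apply, AlgHom.toLinearMap_apply, Algebra.lsmul_coe,
      LinearMap.mulRight_apply, LinearMap.smulRight_apply, smul_sub, Finset.sum_sub_distrib,
      Finset.smul_sum, smul_smul]
    simp only [Coalgebra.Repr.mul_left, Coalgebra.Repr.mul_right, Coalgebra.Repr.mul_index,
      Finset.sum_product, AlgHom.toLinearMap_apply, Algebra.lsmul_coe] at e1
    have e3 : ∑ i ∈ q.index, q.left i • Coalgebra.counit (R := k) (q.right i) • C.d e =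
        b • C.d e := by
      conv_rhs => rw [← e2]
      rw [Finset.sum_smul]
      refine Finset.sum_congr rfl fun i _ => ?_
      rw [smul_assoc, smul_comm]
    rw [e3, eq_sub_iff_add_eq, e1, C.conv_maurerCartan, add_comm, Finset.smul_sum]
    congr 1
    exact Finset.sum_congr rfl fun i _ => smul_comm _ _ _
  have := congrArg (fun f => f b) hXY
  simpa [X, Y] using this

theorem exists_eq_maurerCartan_comp {x : Module.Dual k A} (hx : x ∈ C.quantumTangentSpace) :
    ∃ g : Module.Dual k C.Form, g ∘ₗ C.maurerCartan = x := by
  have : x ∈ LinearMap.range C.maurerCartan.dualMap := by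
    rw [LinearMap.range_dualMap_eq_dualAnnihilator_ker, Submodule.mem_dualAnnihilator]
    intro a ha
    -- Both ω and x vanish at 1, so a may be moved into the augmentation ideal by subtracting ε(a)1.
    have h := hx.2 (a - Coalgebra.counit (R := k) a • 1) (by simp)
      (by rw [map_sub, map_smul, C.maurerCartan_one, LinearMap.mem_ker.1 ha]; simp)
    simpa [hx.1] using h
  obtain ⟨g, hg⟩ := this
  exact ⟨g, hg⟩

theorem comp_maurerCartan_mem (g : Module.Dual k C.Form) :
    g ∘ₗ C.maurerCartan ∈ C.quantumTangentSpace :=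
  ⟨by simp [C.maurerCartan_one], fun a _ h => by simp [h]⟩

theorem quantumTangentSpace_eq_range :
    C.quantumTangentSpace = LinearMap.range C.maurerCartan.dualMap := by
  ext x
  exact ⟨fun hx => C.exists_eq_maurerCartan_comp hx, fun ⟨g, hg⟩ => hg ▸ C.comp_maurerCartan_mem g⟩

/-- The map `w ↦ ∑ w₋₂ ⊗ S(w₋₁) w₀`. -/
noncomputable def trivialize : C.Form →ₗ[k] A ⊗[k] C.Form :=
  (TensorProduct.lift (C.leftMul ∘ₗ antipode k)).lTensor A ∘ₗ
    (TensorProduct.assoc k A A C.Form).toLinearMap ∘ₗ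
    (Coalgebra.comul (R := k) (A := A)).rTensor C.Form ∘ₗ C.coactL

/-- For invariant w the coaction of cw is Σ c₁ ⊗ c₂w, and Σ c₁ ⊗ S(c₂)c₃w = c ⊗ w. This makes
coefficients in front of invariant forms well defined. -/
theorem trivialize_smul (c : A) {w : C.Form} (hw : C.coactL w = 1 ⊗ₜ w) :
    C.trivialize (c • w) = c ⊗ₜ w := by
  have h1 : TensorProduct.lift (C.leftMul ∘ₗ antipode k) ∘ₗ (C.leftMul.flip w).lTensor A ∘ₗ
      Coalgebra.comul (R := k) = (Coalgebra.counit (R := k) (A := A)).smulRight w := by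
    rw [← conv_antipode_conv (Algebra.lsmul k k C.Form : A →ₐ[k] Module.End k C.Form)
      ((Coalgebra.counit (R := k) (A := A)).smulRight w)]
    have : conv (Algebra.lsmul k k C.Form : A →ₐ[k] Module.End k C.Form).toLinearMap
        ((Coalgebra.counit (R := k) (A := A)).smulRight w) = C.leftMul.flip w := by
      ext b
      obtain ⟨q⟩ : Nonempty (Coalgebra.Repr k b (A × A)) := ⟨Coalgebra.Repr.arbitrary k b⟩
      rw [conv_eq_sum _ _ q]
      conv_rhs => rw [← Coalgebra.sum_counit_right_smul q]
      simp only [AlgHom.toLinearMap_apply, Algebra.lsmul_coe, LinearMap.smulRight_apply,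
        LinearMap.flip_apply, map_sum, leftMul_apply, map_smul]
    rw [this, conv, ← LinearMap.comp_assoc]
    congr 1
    ext x y
    simp
  have h2 : C.coactL (c • w) = (C.leftMul.flip w).lTensor A (Coalgebra.comul (R := k) c) := by
    rw [coactL_smul, hw, tensorRep_tmul, LinearMap.lTensor]
    congr 2
    ext x
    simp
  rw [trivialize, LinearMap.comp_apply, LinearMap.comp_apply, LinearMap.comp_apply, h2]
  have h3 : ∀ t : A ⊗[k] A, (TensorProduct.assoc k A A C.Form).toLinearMap
      ((Coalgebra.comul (R := k) (A := A)).rTensor C.Form ((C.leftMul.flip w).lTensor A t)) =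
      ((C.leftMul.flip w).lTensor A).lTensor A ((TensorProduct.assoc k A A A)
        ((Coalgebra.comul (R := k) (A := A)).rTensor A t)) := by
    intro t
    induction t with
    | zero => simp
    | add p q hp hq => simp only [map_add, hp, hq]
    | tmul x y =>
      simp only [LinearMap.lTensor_tmul, LinearMap.rTensor_tmul, LinearEquiv.coe_coe]
      generalize Coalgebra.comul (R := k) x = r
      induction r with
      | zero => simp
      | add p q hp hq => simp only [map_add, hp, hq, TensorProduct.add_tmul]
      | tmul x y => simp
  rw [h3, Coalgebra.coassoc_apply, ← LinearMap.lTensor_comp_apply, ← LinearMap.lTensor_comp_apply,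
    LinearMap.comp_assoc, h1]
  have h4 := congrArg ((LinearMap.id.smulRight w : k →ₗ[k] C.Form).lTensor A)
    (Coalgebra.lTensor_counit_comul (R := k) c)
  rw [← LinearMap.lTensor_comp_apply, LinearMap.lTensor_tmul] at h4
  have h5 : (LinearMap.id.smulRight w : k →ₗ[k] C.Form) ∘ₗ Coalgebra.counit (R := k) (A := A) =
      (Coalgebra.counit (R := k) (A := A)).smulRight w := rfl
  rw [← h5, h4]
  simp

theorem mulD_eq (n : A ⊗[k] A) :
    C.mulD n = TensorProduct.lift (C.leftMul.compl₂ C.maurerCartan) (canon k A n) := by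
  induction n with
  | zero => simp
  | add p q hp hq => simp only [map_add, hp, hq]
  | tmul a b =>
    rw [mulD_tmul, ← C.conv_maurerCartan, conv, canon_tmul, LinearMap.comp_apply]
    generalize Coalgebra.comul (R := k) b = t
    induction t with
    | zero => simp
    | add p q hp hq => simp only [map_add, hp, hq, mul_add, smul_add]
    | tmul p q => simp [mul_smul]

theorem trivialize_mulD (n : A ⊗[k] A) :
    C.trivialize (C.mulD n) = C.maurerCartan.lTensor A (canon k A n) := by
  rw [mulD_eq]
  generalize canon k A n = t
  induction t with
  | zero => simp
  | add p q hp hq => simp only [map_add, hp, hq]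
  | tmul p q => simp [C.trivialize_smul _ (C.coactL_maurerCartan q)]

/-- The trivialization of Σ a db is Σ ab₁ ⊗ ω(b₂), and the functionals g ∘ ω are exactly the
elements of `C.quantumTangentSpace`. Hence the tangent space determines the kernel of `mulD`, and so
the calculus up to isomorphism. -/
theorem mulD_eq_zero_iff (n : A ⊗[k] A) :
    C.mulD n = 0 ↔ ∀ x ∈ C.quantumTangentSpace, contract x n = 0 := by
  constructor
  · intro h x hx
    obtain ⟨g, rfl⟩ := C.exists_eq_maurerCartan_comp hx
    rw [contract_eq, LinearMap.lTensor_comp_apply, ← trivialize_mulD, h]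
    simp
  · intro h
    have : C.maurerCartan.lTensor A (canon k A n) = 0 := by
      refine TensorProduct.eq_zero_of_forall_dual _ fun g => ?_
      have := h _ (C.comp_maurerCartan_mem g)
      rw [contract_eq, LinearMap.lTensor_comp_apply] at this
      simpa using this
    rw [mulD_eq]
    have h2 : TensorProduct.lift (C.leftMul.compl₂ C.maurerCartan) =
        TensorProduct.lift C.leftMul ∘ₗ C.maurerCartan.lTensor A := by
      ext x y
      simp
    rw [h2, LinearMap.comp_apply, this, map_zero]

theorem mem_H0_iff (a : A) :
    a ∈ C.H0 ↔ ∀ x ∈ C.quantumTangentSpace, dualAct x a = 0 := by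
  have := C.mulD_eq_zero_iff (1 ⊗ₜ a)
  simpa [H0] using this

variable {C C'}

theorem exists_hom_of_le (h : C'.quantumTangentSpace ≤ C.quantumTangentSpace) :
    Nonempty (C.toDifferentialCalculus.Hom C'.toDifferentialCalculus) :=
  exists_hom fun n hn => by
    rw [LinearMap.mem_ker, mulD_eq_zero_iff] at hn ⊢
    exact fun x hx => hn x (h hx)

theorem maurerCartan_hom (f : C.toDifferentialCalculus.Hom C'.toDifferentialCalculus) (a : A) :
    f.toFun (C.maurerCartan a) = C'.maurerCartan a := by
  simp only [maurerCartan, LinearMap.comp_apply]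
  generalize Coalgebra.comul (R := k) a = t
  induction t with
  | zero => simp
  | add p q hp hq => simp only [map_add, hp, hq]
  | tmul p q => simp [f.map_left, f.map_d]

theorem le_of_hom (f : C.toDifferentialCalculus.Hom C'.toDifferentialCalculus) :
    C'.quantumTangentSpace ≤ C.quantumTangentSpace := fun x hx =>
  ⟨hx.1, fun a h h' => hx.2 a h (by rw [← maurerCartan_hom f, h', map_zero])⟩

/-- A morphism commutes with the maps `mulD` out of A ⊗ A, is surjective for that reason, and is
injective when `mulD_eq_zero_iff` gives both of them the same kernel. -/
theorem bijective_iff (f : C.toDifferentialCalculus.Hom C'.toDifferentialCalculus) :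
    Function.Bijective f.toFun ↔ C.quantumTangentSpace = C'.quantumTangentSpace := by
  constructor
  · intro hf
    refine le_antisymm (fun x hx => ⟨hx.1, fun a h h' => hx.2 a h ?_⟩) (le_of_hom f)
    apply hf.1
    rw [maurerCartan_hom f, h', map_zero]
  · intro h
    refine ⟨?_, f.surjective⟩
    rw [injective_iff_map_eq_zero]
    intro w hw
    obtain ⟨n, rfl⟩ := C.mulD_surjective w
    rw [f.mulD, mulD_eq_zero_iff, ← h] at hw
    rwa [mulD_eq_zero_iff]

theorem isomorphic_of_eq (h : C.quantumTangentSpace = C'.quantumTangentSpace) :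
    C.Isomorphic C' := by
  obtain ⟨f⟩ := exists_hom_of_le h.ge
  exact ⟨f, (bijective_iff f).2 h⟩

variable (C)

theorem nontrivial_iff : Nontrivial C.Form ↔ C.quantumTangentSpace ≠ ⊥ := by
  constructor
  · intro _ h
    obtain ⟨w, hw⟩ := exists_ne (0 : C.Form)
    obtain ⟨n, rfl⟩ := C.mulD_surjective w
    apply hw
    rw [mulD_eq_zero_iff, h]
    rintro x rfl
    simp [contract, dualAct]
  · intro h
    obtain ⟨x, hx, hx0⟩ := Submodule.exists_mem_ne_zero_of_ne_bot h
    by_contra hC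
    rw [not_nontrivial_iff_subsingleton] at hC
    apply hx0
    ext a
    -- From da = 0 follows Σ a₁x(a₂) = 0, and the counit of this sum is x(a).
    have := (C.mulD_eq_zero_iff (1 ⊗ₜ a)).1 (Subsingleton.elim _ _) x hx
    rw [contract_tmul, one_mul] at this
    rw [← counit_dualAct, this, map_zero, LinearMap.zero_apply]

/-- An invariant w = Σ a db trivializes both to 1 ⊗ w and to Σ ab₁ ⊗ ω(b₂); the counit on the first
leg then writes w as a value of ω. -/
theorem invariantForms_eq_range : C.invariantForms = LinearMap.range C.maurerCartan := by
  apply le_antisymm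
  · intro w (hw : C.coactL w = 1 ⊗ₜ w)
    obtain ⟨n, hn⟩ := C.mulD_surjective w
    have h1 := C.trivialize_smul 1 hw
    rw [one_smul, ← hn, trivialize_mulD, hn] at h1
    have h2 := congrArg (fun t => TensorProduct.lid k C.Form
      ((Coalgebra.counit (R := k) (A := A)).rTensor C.Form t)) h1
    simp only [LinearMap.rTensor_tmul, Bialgebra.counit_one, TensorProduct.lid_tmul,
      one_smul] at h2
    rw [← h2]
    generalize canon k A n = t
    induction t with
    | zero => simp
    | add p q hp hq => simpa only [map_add] using add_mem hp hq
    | tmul p q => exact ⟨Coalgebra.counit (R := k) p • q, by simp⟩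
  · rintro _ ⟨b, rfl⟩
    exact C.coactL_maurerCartan b

theorem dim_eq : C.dim = Module.finrank k C.quantumTangentSpace := by
  rw [dim, invariantForms_eq_range, quantumTangentSpace_eq_range]
  exact (LinearMap.finrank_range_dualMap_eq_finrank_range _).symm

end BicovariantCalculus

/-! ### Stability of quantum tangent spaces. -/

namespace HopfAlgebra

variable {k A : Type*} [Field k] [Ring A] [HopfAlgebra k A]

/-- The stability conditions on a quantum tangent space. -/
structure IsTangentSpace (L : Submodule k (Module.Dual k A)) : Prop where
  map_one : ∀ x ∈ L, x 1 = 0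
  mulRight : ∀ x ∈ L, ∀ e : A,
    x ∘ₗ LinearMap.mulRight k e - x e • Coalgebra.counit (R := k) (A := A) ∈ L
  ad : ∀ x ∈ L, ∀ h : Module.Dual k A,
    LinearMap.mul' k k ∘ₗ TensorProduct.map x h ∘ₗ adCoact k A ∈ L

end HopfAlgebra

/-- For ε(b) = 0 one has ω(b)e = Σ e₁ω(be₂), so the kernel of ω in the augmentation ideal is a right
ideal; by `coactR_maurerCartan` it is also stable under the adjoint coaction. The conditions on the
tangent space are the dual statements. -/
theorem BicovariantCalculus.isTangentSpace {k A : Type*} [Field k] [Ring A] [HopfAlgebra k A]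
    (C : BicovariantCalculus k A) : IsTangentSpace C.quantumTangentSpace := by
  refine ⟨fun x hx => hx.1, fun x hx e => ⟨by simp, fun b hb hb' => ?_⟩,
    fun x hx h => ⟨?_, fun b hb hb' => ?_⟩⟩
  · obtain ⟨g, rfl⟩ := C.exists_eq_maurerCartan_comp hx
    obtain ⟨r⟩ : Nonempty (Coalgebra.Repr k e (A × A)) := ⟨Coalgebra.Repr.arbitrary k e⟩
    have h1 := C.op_smul_maurerCartan b r
    rw [hb, hb', smul_zero, zero_smul, sub_zero] at h1
    -- Trivialization turns Σ e₁ω(be₂) = 0 into Σ e₁ ⊗ ω(be₂) = 0, and the counit on the first leg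
    -- leaves ω(be) = 0.
    have h2 := congrArg (fun w => TensorProduct.lid k C.Form
      ((Coalgebra.counit (R := k) (A := A)).rTensor C.Form (C.trivialize w))) h1
    simp only [map_sum, C.trivialize_smul _ (C.coactL_maurerCartan _)] at h2
    simp only [LinearMap.rTensor_tmul, TensorProduct.lid_tmul] at h2
    have h3 : C.maurerCartan (b * e) = 0 := by
      rw [map_zero, map_zero, map_zero] at h2
      rw [h2]
      conv_lhs => rw [← Coalgebra.sum_counit_smul r]
      simp only [Finset.mul_sum, map_sum, mul_smul_comm, map_smul]
    simp [hb, h3]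
  · obtain ⟨g, rfl⟩ := C.exists_eq_maurerCartan_comp hx
    have h1 := C.coactR_maurerCartan 1
    rw [C.maurerCartan_one, map_zero] at h1
    have h2 := congrArg (fun w => LinearMap.mul' k k (TensorProduct.map g h w)) h1
    simpa [LinearMap.rTensor, TensorProduct.map_map] using h2.symm
  · obtain ⟨g, rfl⟩ := C.exists_eq_maurerCartan_comp hx
    have h1 := C.coactR_maurerCartan b
    rw [hb', map_zero] at h1
    have h2 := congrArg (fun w => LinearMap.mul' k k (TensorProduct.map g h w)) h1
    simpa [LinearMap.rTensor, TensorProduct.map_map] using h2.symm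

open HopfAlgebra

/-! ### Coactions along a map of coalgebras. -/

namespace HopfAlgebra

variable {k U A : Type*} [Field k] [AddCommGroup U] [Module k U] [Coalgebra k U]
  [AddCommGroup A] [Module k A] [Coalgebra k A] (m : U →ₗc[k] A)

/-- The left coaction of `A` on `U` along a map of coalgebras `U → A`. -/
noncomputable def leftCoact : U →ₗ[k] A ⊗[k] U := m.toLinearMap.rTensor U ∘ₗ Coalgebra.comul
    (R := k)

/-- The right coaction of `A` on `U` along a map of coalgebras `U → A`. -/
noncomputable def rightCoact : U →ₗ[k] U ⊗[k] A := m.toLinearMap.lTensor U ∘ₗ Coalgebra.comul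
    (R := k)

/-- All bicomodule axioms for these coactions come from coassociativity in U. The case needed is U =
A ⊗ A with the multiplication A ⊗ A → A as the map of coalgebras. -/
theorem leftCoact_coassoc (w : U) :
    TensorProduct.assoc k A A U ((Coalgebra.comul (R := k) (A := A)).rTensor U (leftCoact m w)) =
      (leftCoact m).lTensor A (leftCoact m w) := by
  have h1 : (Coalgebra.comul (R := k) (A := A)).rTensor U ∘ₗ m.toLinearMap.rTensor U =
      (TensorProduct.map m.toLinearMap m.toLinearMap).rTensor U ∘ₗ
        (Coalgebra.comul (R := k) (A := U)).rTensor U := by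
    rw [← LinearMap.rTensor_comp, ← LinearMap.rTensor_comp, m.map_comp_comul]
  have h2 : (leftCoact m).lTensor A ∘ₗ m.toLinearMap.rTensor U =
      TensorProduct.map m.toLinearMap (m.toLinearMap.rTensor U) ∘ₗ
        (Coalgebra.comul (R := k) (A := U)).lTensor U := by
    ext x y
    simp [leftCoact]
  have h3 : ∀ t : (U ⊗[k] U) ⊗[k] U, TensorProduct.assoc k A A U
      ((TensorProduct.map m.toLinearMap m.toLinearMap).rTensor U t) =
      TensorProduct.map m.toLinearMap (m.toLinearMap.rTensor U)
        (TensorProduct.assoc k U U U t) := by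
    intro t
    have : (TensorProduct.assoc k A A U).toLinearMap ∘ₗ
        (TensorProduct.map m.toLinearMap m.toLinearMap).rTensor U =
      TensorProduct.map m.toLinearMap (m.toLinearMap.rTensor U) ∘ₗ
        (TensorProduct.assoc k U U U).toLinearMap := by
      ext x y z
      simp
    exact congrArg (fun f => f t) this
  have e1 := congrArg (fun f => f (Coalgebra.comul (R := k) w)) h1
  have e2 := congrArg (fun f => f (Coalgebra.comul (R := k) w)) h2
  simp only [LinearMap.comp_apply] at e1 e2
  rw [leftCoact, LinearMap.comp_apply, e1, h3, Coalgebra.coassoc_apply]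
  exact e2.symm

theorem rightCoact_coassoc (w : U) :
    TensorProduct.assoc k U A A ((rightCoact m).rTensor A (rightCoact m w)) =
      (Coalgebra.comul (R := k) (A := A)).lTensor U (rightCoact m w) := by
  have h1 : (Coalgebra.comul (R := k) (A := A)).lTensor U ∘ₗ m.toLinearMap.lTensor U =
      (TensorProduct.map m.toLinearMap m.toLinearMap).lTensor U ∘ₗ
        (Coalgebra.comul (R := k) (A := U)).lTensor U := by
    rw [← LinearMap.lTensor_comp, ← LinearMap.lTensor_comp, m.map_comp_comul]
  have h2 : (rightCoact m).rTensor A ∘ₗ m.toLinearMap.lTensor U =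
      TensorProduct.map (m.toLinearMap.lTensor U) m.toLinearMap ∘ₗ
        (Coalgebra.comul (R := k) (A := U)).rTensor U := by
    ext x y
    simp [rightCoact]
  have h3 : ∀ t : (U ⊗[k] U) ⊗[k] U, TensorProduct.assoc k U A A
      (TensorProduct.map (m.toLinearMap.lTensor U) m.toLinearMap t) =
      (TensorProduct.map m.toLinearMap m.toLinearMap).lTensor U
        (TensorProduct.assoc k U U U t) := by
    intro t
    have : (TensorProduct.assoc k U A A).toLinearMap ∘ₗ
        TensorProduct.map (m.toLinearMap.lTensor U) m.toLinearMap =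
      (TensorProduct.map m.toLinearMap m.toLinearMap).lTensor U ∘ₗ
        (TensorProduct.assoc k U U U).toLinearMap := by
      ext x y z
      simp
    exact congrArg (fun f => f t) this
  have e1 := congrArg (fun f => f (Coalgebra.comul (R := k) w)) h1
  have e2 := congrArg (fun f => f (Coalgebra.comul (R := k) w)) h2
  simp only [LinearMap.comp_apply] at e1 e2
  rw [rightCoact, LinearMap.comp_apply, e1, ← Coalgebra.coassoc_apply, ← h3]
  exact congrArg _ e2

theorem leftCoact_rightCoact (w : U) :
    TensorProduct.assoc k A U A ((leftCoact m).rTensor A (rightCoact m w)) =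
      (rightCoact m).lTensor A (leftCoact m w) := by
  have h1 : (leftCoact m).rTensor A ∘ₗ m.toLinearMap.lTensor U =
      TensorProduct.map (m.toLinearMap.rTensor U) m.toLinearMap ∘ₗ
        (Coalgebra.comul (R := k) (A := U)).rTensor U := by
    ext x y
    simp [leftCoact]
  have h2 : (rightCoact m).lTensor A ∘ₗ m.toLinearMap.rTensor U =
      TensorProduct.map m.toLinearMap (m.toLinearMap.lTensor U) ∘ₗ
        (Coalgebra.comul (R := k) (A := U)).lTensor U := by
    ext x y
    simp [rightCoact]
  have h3 : ∀ t : (U ⊗[k] U) ⊗[k] U, TensorProduct.assoc k A U A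
      (TensorProduct.map (m.toLinearMap.rTensor U) m.toLinearMap t) =
      TensorProduct.map m.toLinearMap (m.toLinearMap.lTensor U)
        (TensorProduct.assoc k U U U t) := by
    intro t
    have : (TensorProduct.assoc k A U A).toLinearMap ∘ₗ
        TensorProduct.map (m.toLinearMap.rTensor U) m.toLinearMap =
      TensorProduct.map m.toLinearMap (m.toLinearMap.lTensor U) ∘ₗ
        (TensorProduct.assoc k U U U).toLinearMap := by
      ext x y z
      simp
    exact congrArg (fun f => f t) this
  have e1 := congrArg (fun f => f (Coalgebra.comul (R := k) w)) h1
  have e2 := congrArg (fun f => f (Coalgebra.comul (R := k) w)) h2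
  simp only [LinearMap.comp_apply] at e1 e2
  rw [rightCoact, LinearMap.comp_apply, e1, h3, Coalgebra.coassoc_apply]
  exact e2.symm

theorem leftCoact_counit (w : U) : TensorProduct.lid k U
    ((Coalgebra.counit (R := k) (A := A)).rTensor U (leftCoact m w)) = w := by
  rw [leftCoact, LinearMap.comp_apply, ← LinearMap.rTensor_comp_apply, m.counit_comp,
    Coalgebra.rTensor_counit_comul]
  exact one_smul k w

theorem rightCoact_counit (w : U) : TensorProduct.rid k U
    ((Coalgebra.counit (R := k) (A := A)).lTensor U (rightCoact m w)) = w := by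
  rw [rightCoact, LinearMap.comp_apply, ← LinearMap.lTensor_comp_apply, m.counit_comp,
    Coalgebra.lTensor_counit_comul]
  exact one_smul k w

end HopfAlgebra

/-! ### Bicovariance of the universal forms A ⊗ A. -/

namespace HopfAlgebra

variable {k : Type*} {A : Type*} [Field k] [Ring A] [HopfAlgebra k A]

/-- `a ↦ (x ⊗ y ↦ a x ⊗ y)`. -/
noncomputable def lmulLeft (k A : Type*) [Field k] [Ring A] [HopfAlgebra k A] :
    A →ₐ[k] Module.End k (A ⊗[k] A) :=
  (Algebra.lmul k (A ⊗[k] A)).comp Algebra.TensorProduct.includeLeft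

@[simp] theorem lmulLeft_tmul (a x y : A) : lmulLeft k A a (x ⊗ₜ y) = (a * x) ⊗ₜ y := by
  simp [lmulLeft]

variable (k A) in
/-- The left coaction `a ⊗ b ↦ ∑ a₁ b₁ ⊗ (a₂ ⊗ b₂)`. -/
noncomputable def univCoactL : A ⊗[k] A →ₗ[k] A ⊗[k] (A ⊗[k] A) :=
  leftCoact (Bialgebra.mulCoalgHom k A)

variable (k A) in
/-- The right coaction `a ⊗ b ↦ ∑ (a₁ ⊗ b₁) ⊗ a₂ b₂`. -/
noncomputable def univCoactR : A ⊗[k] A →ₗ[k] (A ⊗[k] A) ⊗[k] A :=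
  rightCoact (Bialgebra.mulCoalgHom k A)

theorem univCoactL_tmul (x y : A) : univCoactL k A (x ⊗ₜ y) =
    (LinearMap.mul' k A).rTensor (A ⊗[k] A) (TensorProduct.tensorTensorTensorComm k A A A A
      (Coalgebra.comul (R := k) x ⊗ₜ Coalgebra.comul (R := k) y)) := rfl

theorem univCoactR_tmul (x y : A) : univCoactR k A (x ⊗ₜ y) =
    (LinearMap.mul' k A).lTensor (A ⊗[k] A) (TensorProduct.tensorTensorTensorComm k A A A A
      (Coalgebra.comul (R := k) x ⊗ₜ Coalgebra.comul (R := k) y)) := rfl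

theorem univCoactL_lmulLeft (a : A) (n : A ⊗[k] A) : univCoactL k A (lmulLeft k A a n) =
    TensorProduct.map₂ (LinearMap.mul k A) (lmulLeft k A).toLinearMap
      (Coalgebra.comul (R := k) a) (univCoactL k A n) := by
  induction n with
  | zero => simp
  | add p q hp hq => simp only [map_add, hp, hq]
  | tmul x y =>
    simp only [lmulLeft_tmul, univCoactL_tmul, Bialgebra.comul_mul]
    generalize Coalgebra.comul (R := k) a = p
    generalize Coalgebra.comul (R := k) x = q
    generalize Coalgebra.comul (R := k) y = r
    induction r with
    | zero => simp
    | add _ _ h h' => simp only [TensorProduct.tmul_add, map_add, h, h']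
    | tmul r r' =>
    induction q with
    | zero => simp
    | add _ _ h h' => simp only [mul_add, TensorProduct.add_tmul, map_add, h, h']
    | tmul q q' =>
    induction p with
    | zero => simp
    | add _ _ h h' => simp only [add_mul, TensorProduct.add_tmul, map_add, LinearMap.add_apply,
        h, h']
    | tmul p p' => simp [mul_assoc]

theorem univCoactR_lmulLeft (a : A) (n : A ⊗[k] A) : univCoactR k A (lmulLeft k A a n) =
    TensorProduct.map₂ (lmulLeft k A).toLinearMap (LinearMap.mul k A)
      (Coalgebra.comul (R := k) a) (univCoactR k A n) := by
  induction n with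
  | zero => simp
  | add p q hp hq => simp only [map_add, hp, hq]
  | tmul x y =>
    simp only [lmulLeft_tmul, univCoactR_tmul, Bialgebra.comul_mul]
    generalize Coalgebra.comul (R := k) a = p
    generalize Coalgebra.comul (R := k) x = q
    generalize Coalgebra.comul (R := k) y = r
    induction r with
    | zero => simp
    | add _ _ h h' => simp only [TensorProduct.tmul_add, map_add, h, h']
    | tmul r r' =>
    induction q with
    | zero => simp
    | add _ _ h h' => simp only [mul_add, TensorProduct.add_tmul, map_add, h, h']
    | tmul q q' =>
    induction p with
    | zero => simp
    | add _ _ h h' => simp only [add_mul, TensorProduct.add_tmul, map_add, LinearMap.add_apply,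
        h, h']
    | tmul p p' => simp [mul_assoc]

/-- The right action is a difference of two operations built from the product alone, and each is
compatible with the coaction because the coproduct is multiplicative. -/
theorem univCoactL_rightMulDiff (c : A) (n : A ⊗[k] A) :
    univCoactL k A (rightMulDiff k c n) =
      TensorProduct.map₂ (LinearMap.mul k A).flip (rightMulDiff k)
        (Coalgebra.comul (R := k) c) (univCoactL k A n) := by
  induction n with
  | zero => simp
  | add p q hp hq => simp only [map_add, hp, hq]
  | tmul x y =>
    simp only [rightMulDiff_tmul, map_sub, univCoactL_tmul, Bialgebra.comul_mul]
    generalize Coalgebra.comul (R := k) c = p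
    generalize Coalgebra.comul (R := k) x = q
    generalize Coalgebra.comul (R := k) y = r
    induction r with
    | zero => simp
    | add _ _ h h' =>
      simp only [TensorProduct.tmul_add, mul_add, add_mul, TensorProduct.add_tmul, map_add, ← h,
        ← h']
      abel
    | tmul r r' =>
    induction q with
    | zero => simp
    | add _ _ h h' =>
      simp only [add_mul, TensorProduct.add_tmul, map_add, ← h, ← h']
      abel
    | tmul q q' =>
    induction p with
    | zero => simp
    | add _ _ h h' =>
      simp only [mul_add, TensorProduct.tmul_add, map_add, LinearMap.add_apply, ← h, ← h']
      abel
    | tmul p p' => simp [mul_assoc, TensorProduct.tmul_sub]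

theorem univCoactR_rightMulDiff (c : A) (n : A ⊗[k] A) :
    univCoactR k A (rightMulDiff k c n) =
      TensorProduct.map₂ (rightMulDiff k) (LinearMap.mul k A).flip
        (Coalgebra.comul (R := k) c) (univCoactR k A n) := by
  induction n with
  | zero => simp
  | add p q hp hq => simp only [map_add, hp, hq]
  | tmul x y =>
    simp only [rightMulDiff_tmul, map_sub, univCoactR_tmul, Bialgebra.comul_mul]
    generalize Coalgebra.comul (R := k) c = p
    generalize Coalgebra.comul (R := k) x = q
    generalize Coalgebra.comul (R := k) y = r
    induction r with
    | zero => simp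
    | add _ _ h h' =>
      simp only [TensorProduct.tmul_add, mul_add, add_mul, TensorProduct.add_tmul, map_add, ← h,
        ← h']
      abel
    | tmul r r' =>
    induction q with
    | zero => simp
    | add _ _ h h' =>
      simp only [add_mul, TensorProduct.add_tmul, map_add, ← h, ← h']
      abel
    | tmul q q' =>
    induction p with
    | zero => simp
    | add _ _ h h' =>
      simp only [mul_add, TensorProduct.tmul_add, map_add, LinearMap.add_apply, ← h, ← h']
      abel
    | tmul p p' => simp [mul_assoc, TensorProduct.sub_tmul]

theorem univCoactL_one_tmul (a : A) : univCoactL k A (1 ⊗ₜ a) =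
    (TensorProduct.mk k A A 1).lTensor A (Coalgebra.comul (R := k) a) := by
  rw [univCoactL_tmul, Bialgebra.comul_one, Algebra.TensorProduct.one_def]
  generalize Coalgebra.comul (R := k) a = p
  induction p with
  | zero => simp
  | add _ _ h h' => simp only [TensorProduct.tmul_add, map_add, h, h']
  | tmul p p' => simp

theorem univCoactR_one_tmul (a : A) : univCoactR k A (1 ⊗ₜ a) =
    (TensorProduct.mk k A A 1).rTensor A (Coalgebra.comul (R := k) a) := by
  rw [univCoactR_tmul, Bialgebra.comul_one, Algebra.TensorProduct.one_def]
  generalize Coalgebra.comul (R := k) a = p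
  induction p with
  | zero => simp
  | add _ _ h h' => simp only [TensorProduct.tmul_add, map_add, h, h']
  | tmul p p' => simp

end HopfAlgebra

/-! ### Pairing universal forms with functionals. -/

namespace HopfAlgebra

variable {k : Type*} {A : Type*} [Field k] [Ring A] [HopfAlgebra k A]

theorem contract_lmulLeft (x : Module.Dual k A) (a : A) (n : A ⊗[k] A) :
    contract x (lmulLeft k A a n) = a * contract x n := by
  induction n with
  | zero => simp
  | add p q hp hq => simp only [map_add, hp, hq, mul_add]
  | tmul p q => simp [mul_assoc]

theorem dualAct_counit (b : A) : dualAct (Coalgebra.counit (R := k)) b = b := by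
  simp [dualAct]

theorem dualAct_sub_smul (x y : Module.Dual k A) (c : k) (b : A) :
    dualAct (x - c • y) b = dualAct x b - c • dualAct y b := by
  obtain ⟨r⟩ : Nonempty (Coalgebra.Repr k b (A × A)) := ⟨Coalgebra.Repr.arbitrary k b⟩
  simp only [dualAct_eq_sum _ r, LinearMap.sub_apply, LinearMap.smul_apply, sub_smul,
    Finset.sum_sub_distrib, Finset.smul_sum, smul_assoc]

/-- Both sides are Σ ab₁c₁ x(b₂c₂) − Σ abc₁ x(c₂). The functional x(·c₂) − x(c₂)ε is the one in the
first stability condition, so null forms are closed under right multiplication. -/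
theorem contract_rightMulDiff (x : Module.Dual k A) {c : A} {ι : Type*}
    (r : Coalgebra.Repr k c ι) (n : A ⊗[k] A) :
    contract x (rightMulDiff k c n) = ∑ i ∈ r.index,
      contract (x ∘ₗ LinearMap.mulRight k (r.right i) -
        x (r.right i) • Coalgebra.counit (R := k) (A := A)) n * r.left i := by
  induction n with
  | zero => simp
  | add p q hp hq => simp only [map_add, hp, hq, add_mul, Finset.sum_add_distrib]
  | tmul a b =>
    obtain ⟨q⟩ : Nonempty (Coalgebra.Repr k b (A × A)) := ⟨Coalgebra.Repr.arbitrary k b⟩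
    simp only [rightMulDiff_tmul, map_sub, contract_tmul, dualAct_sub_smul, dualAct_counit,
      mul_sub, sub_mul, Finset.sum_sub_distrib]
    congr 1
    · rw [dualAct_eq_sum x (q.mul r)]
      simp only [dualAct_eq_sum _ q, Coalgebra.Repr.mul_left, Coalgebra.Repr.mul_right,
        Coalgebra.Repr.mul_index, LinearMap.comp_apply, LinearMap.mulRight_apply]
      simp only [Finset.sum_product,
        Finset.mul_sum, Finset.sum_mul, mul_smul_comm, smul_mul_assoc, mul_assoc]
      exact Finset.sum_comm
    · rw [dualAct_eq_sum x r, Finset.mul_sum]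
      simp [mul_assoc]

theorem comul_dualAct (x : Module.Dual k A) (b : A) :
    Coalgebra.comul (R := k) (dualAct x b) = (dualAct x).lTensor A
      (Coalgebra.comul (R := k) b) := by
  have h : (dualAct x).lTensor A = ((TensorProduct.rid k A).toLinearMap ∘ₗ x.lTensor A).lTensor A ∘ₗ
      (Coalgebra.comul (R := k) (A := A)).lTensor A := by
    rw [← LinearMap.lTensor_comp]
    rfl
  rw [h, LinearMap.comp_apply, ← Coalgebra.coassoc_apply, dualAct, LinearMap.comp_apply,
    LinearMap.comp_apply]
  generalize Coalgebra.comul (R := k) b = t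
  induction t with
  | zero => simp
  | add p q hp hq => simp only [map_add, hp, hq]
  | tmul p q =>
    simp only [LinearMap.lTensor_tmul, LinearEquiv.coe_coe, TensorProduct.rid_tmul, map_smul,
      LinearMap.rTensor_tmul]
    generalize Coalgebra.comul (R := k) p = t
    induction t with
    | zero => simp
    | add p q hp hq => simp only [map_add, hp, hq, TensorProduct.add_tmul, smul_add]
    | tmul p q => simp

/-- Contraction touches only the rightmost legs, so it is left colinear for every x: left covariance
puts no condition on a tangent space. -/
theorem contract_univCoactL (x : Module.Dual k A) (n : A ⊗[k] A) :
    (contract x).lTensor A (univCoactL k A n) = Coalgebra.comul (R := k) (contract x n) := by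
  induction n with
  | zero => simp
  | add p q hp hq => simp only [map_add, hp, hq]
  | tmul a b =>
    rw [contract_tmul, Bialgebra.comul_mul, comul_dualAct, univCoactL_tmul]
    generalize Coalgebra.comul (R := k) a = p
    generalize Coalgebra.comul (R := k) b = q
    induction q with
    | zero => simp
    | add _ _ h h' => simp only [TensorProduct.tmul_add, map_add, h, h', mul_add]
    | tmul q q' =>
    induction p with
    | zero => simp
    | add _ _ h h' => simp only [TensorProduct.add_tmul, map_add, h, h', add_mul]
    | tmul p p' => simp

/-- The functionals `b ↦ ∑ x(b₂) h(S(b₁) b₃)`. -/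
noncomputable def adDual (x h : Module.Dual k A) : Module.Dual k A :=
  LinearMap.mul' k k ∘ₗ TensorProduct.map x h ∘ₗ adCoact k A

theorem sum_adDual_smul {ι : Type*} [Fintype ι] (e : Module.Basis ι k A) (x : Module.Dual k A)
    (b : A) : ∑ i, adDual x (e.coord i) b • e i =
      TensorProduct.lid k A (x.rTensor A (adCoact k A b)) := by
  simp only [adDual, LinearMap.comp_apply]
  generalize adCoact k A b = t
  induction t with
  | zero => simp
  | add p q hp hq => simp only [map_add, add_smul, Finset.sum_add_distrib, hp, hq]
  | tmul p q =>
    simp only [TensorProduct.map_tmul, LinearMap.mul'_apply, Module.Basis.coord_apply, mul_smul,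
      ← Finset.smul_sum, e.sum_repr, LinearMap.rTensor_tmul, TensorProduct.lid_tmul]

/-- Summing over a basis and its dual gives Σ b₁S(b₂)b₄ x(b₃), which collapses to Σ x(b₁)b₂. -/
theorem sum_dualAct_adDual_mul {ι : Type*} [Fintype ι] (e : Module.Basis ι k A)
    (x : Module.Dual k A) (b : A) : ∑ i, dualAct (adDual x (e.coord i)) b * e i =
      TensorProduct.lid k A (x.rTensor A (Coalgebra.comul (R := k) b)) := by
  obtain ⟨r⟩ : Nonempty (Coalgebra.Repr k b (A × A)) := ⟨Coalgebra.Repr.arbitrary k b⟩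
  rw [← conv_adCoact, conv_eq_sum _ _ r]
  simp only [dualAct_eq_sum _ r, Finset.sum_mul, map_sum]
  rw [Finset.sum_comm]
  refine Finset.sum_congr rfl fun j _ => ?_
  have h1 : ∀ a t, TensorProduct.lid k A (x.rTensor A (lmulRight k A a t)) =
      a * TensorProduct.lid k A (x.rTensor A t) := by
    intro a t
    induction t with
    | zero => simp
    | add p q hp hq => simp only [map_add, mul_add, hp, hq]
    | tmul p q => simp
  rw [AlgHom.toLinearMap_apply, h1, ← sum_adDual_smul e, Finset.mul_sum]
  simp

theorem sum_comul_dualAct_adDual {ι : Type*} [Fintype ι] (e : Module.Basis ι k A)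
    (x : Module.Dual k A) (b : A) :
    ∑ i, Coalgebra.comul (R := k) (dualAct (adDual x (e.coord i)) b) * ((1 : A) ⊗ₜ[k] e i) =
      (dualAct x).rTensor A (Coalgebra.comul (R := k) b) := by
  have h : (dualAct x).rTensor A = ((TensorProduct.rid k A).toLinearMap ∘ₗ x.lTensor A).rTensor A ∘ₗ
      (Coalgebra.comul (R := k) (A := A)).rTensor A := by
    rw [← LinearMap.rTensor_comp]
    rfl
  rw [h, LinearMap.comp_apply, ← Coalgebra.coassoc_symm_apply]
  simp only [comul_dualAct]
  generalize Coalgebra.comul (R := k) b = t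
  induction t with
  | zero => simp
  | add p q hp hq => simp only [map_add, add_mul, Finset.sum_add_distrib, hp, hq]
  | tmul p q =>
    simp only [LinearMap.lTensor_tmul, Algebra.TensorProduct.tmul_mul_tmul, mul_one,
      ← TensorProduct.tmul_sum, sum_dualAct_adDual_mul]
    generalize Coalgebra.comul (R := k) q = t
    induction t with
    | zero => simp
    | add _ _ h h' => simp only [map_add, h, h', TensorProduct.tmul_add]
    | tmul _ _ => simp [TensorProduct.smul_tmul]

/-- Contraction by x is not right colinear, but the coaction only brings in contractions by the
adjoint transforms of x. Thus stability under `adDual` yields right covariance; the finite basis is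
where finite dimension is needed. -/
theorem contract_univCoactR {ι : Type*} [Fintype ι] (e : Module.Basis ι k A)
    (x : Module.Dual k A) (n : A ⊗[k] A) : (contract x).rTensor A (univCoactR k A n) =
      ∑ i, Coalgebra.comul (R := k) (contract (adDual x (e.coord i)) n) *
        ((1 : A) ⊗ₜ[k] e i) := by
  induction n with
  | zero => simp
  | add p q hp hq => simp only [map_add, hp, hq, add_mul, Finset.sum_add_distrib]
  | tmul a b =>
    simp only [contract_tmul, Bialgebra.comul_mul, univCoactR_tmul, mul_assoc, ← Finset.mul_sum,
      sum_comul_dualAct_adDual]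
    generalize Coalgebra.comul (R := k) a = p
    generalize Coalgebra.comul (R := k) b = q
    induction q with
    | zero => simp
    | add _ _ h h' => simp only [TensorProduct.tmul_add, map_add, h, h', mul_add]
    | tmul q q' =>
    induction p with
    | zero => simp
    | add _ _ h h' => simp only [TensorProduct.add_tmul, map_add, h, h', add_mul]
    | tmul p p' => simp

/-- The relations `∑ a (d b) = 0` in the calculus with tangent space `L`. -/
noncomputable def nullForms (L : Submodule k (Module.Dual k A)) : Submodule k (A ⊗[k] A) :=
  ⨅ x ∈ L, LinearMap.ker (contract x)

theorem mem_nullForms {L : Submodule k (Module.Dual k A)} {n : A ⊗[k] A} :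
    n ∈ nullForms L ↔ ∀ x ∈ L, contract x n = 0 := by
  simp [nullForms]

/-- Over a field, an element of A ⊗ (A ⊗ A) dies in the quotient once all its slices by functionals
on A are null, and slicing commutes with contraction. -/
theorem mkQ_lTensor_eq_zero {L : Submodule k (Module.Dual k A)} (t : A ⊗[k] (A ⊗[k] A))
    (h : ∀ x ∈ L, (contract x).lTensor A t = 0) : (nullForms L).mkQ.lTensor A t = 0 := by
  rw [← (TensorProduct.comm k _ _).map_eq_zero_iff]
  refine TensorProduct.eq_zero_of_forall_dual _ fun g => ?_
  have h1 : ∀ t : A ⊗[k] (A ⊗[k] A), g.lTensor (A ⊗[k] A ⧸ nullForms L)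
      (TensorProduct.comm k _ _ ((nullForms L).mkQ.lTensor A t)) =
      (nullForms L).mkQ (TensorProduct.lid k _ (g.rTensor (A ⊗[k] A) t)) ⊗ₜ (1 : k) := by
    intro t
    induction t with
    | zero => simp
    | add p q hp hq => simp only [map_add, hp, hq, TensorProduct.add_tmul]
    | tmul p q => simp [TensorProduct.smul_tmul]
  have h2 : ∀ x (t : A ⊗[k] (A ⊗[k] A)), contract x (TensorProduct.lid k _
      (g.rTensor (A ⊗[k] A) t)) =
      TensorProduct.lid k _ (g.rTensor A ((contract x).lTensor A t)) := by
    intro x t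
    induction t with
    | zero => simp
    | add p q hp hq => simp only [map_add, hp, hq]
    | tmul p q => simp
  rw [h1, Submodule.mkQ_apply, (Submodule.Quotient.mk_eq_zero _).2, TensorProduct.zero_tmul]
  rw [mem_nullForms]
  intro x hx
  rw [h2, h x hx, map_zero, map_zero]

theorem mkQ_rTensor_eq_zero {L : Submodule k (Module.Dual k A)} (t : (A ⊗[k] A) ⊗[k] A)
    (h : ∀ x ∈ L, (contract x).rTensor A t = 0) : (nullForms L).mkQ.rTensor A t = 0 := by
  have h1 : ∀ (V : Type _) [AddCommGroup V] [Module k V] (f : A ⊗[k] A →ₗ[k] V)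
      (t : (A ⊗[k] A) ⊗[k] A), f.rTensor A t =
        TensorProduct.comm k _ _ (f.lTensor A (TensorProduct.comm k _ _ t)) := by
    intro V _ _ f t
    induction t with
    | zero => simp
    | add p q hp hq => simp only [map_add, hp, hq]
    | tmul p q => simp
  rw [h1, mkQ_lTensor_eq_zero, map_zero]
  intro x hx
  have h2 := h x hx
  rwa [h1, LinearEquiv.map_eq_zero_iff] at h2

end HopfAlgebra

/-! ### Construction of the calculus with a given tangent space. -/

namespace HopfAlgebra

variable {k : Type u} {A : Type v} [Field k] [Ring A] [HopfAlgebra k A]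
  {L : Submodule k (Module.Dual k A)}

theorem contract_tmul_one (x : Module.Dual k A) (a : A) : contract x (a ⊗ₜ 1) = x 1 • a := by
  simp [dualAct, Algebra.TensorProduct.one_def]

theorem IsTangentSpace.lmulLeft_mem (a : A) {n : A ⊗[k] A} (hn : n ∈ nullForms L) :
    lmulLeft k A a n ∈ nullForms L := by
  rw [mem_nullForms] at hn ⊢
  intro x hx
  rw [contract_lmulLeft, hn x hx, mul_zero]

theorem IsTangentSpace.rightMulDiff_mem (hL : IsTangentSpace L) (c : A) {n : A ⊗[k] A}
    (hn : n ∈ nullForms L) : rightMulDiff k c n ∈ nullForms L := by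
  rw [mem_nullForms] at hn ⊢
  intro x hx
  obtain ⟨r⟩ : Nonempty (Coalgebra.Repr k c (A × A)) := ⟨Coalgebra.Repr.arbitrary k c⟩
  rw [contract_rightMulDiff x r]
  exact Finset.sum_eq_zero fun i _ => by rw [hn _ (hL.mulRight x hx _), zero_mul]

theorem IsTangentSpace.tmul_one_mem (hL : IsTangentSpace L) (a : A) :
    a ⊗ₜ[k] (1 : A) ∈ nullForms L := by
  rw [mem_nullForms]
  intro x hx
  rw [contract_tmul_one, hL.map_one x hx, zero_smul]

/-- The 1-forms of the calculus with tangent space `L`. -/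
def TangentForm (_ : IsTangentSpace L) : Type v := (A ⊗[k] A) ⧸ nullForms L

namespace TangentForm

variable (hL : IsTangentSpace L)

noncomputable instance : AddCommGroup (TangentForm hL) :=
  inferInstanceAs (AddCommGroup ((A ⊗[k] A) ⧸ nullForms L))
noncomputable instance : Module k (TangentForm hL) :=
  inferInstanceAs (Module k ((A ⊗[k] A) ⧸ nullForms L))

/-- The class of `a ⊗ b` is the 1-form `a (d b)`. -/
noncomputable def ofTensor : A ⊗[k] A →ₗ[k] TangentForm hL := (nullForms L).mkQ

theorem ofTensor_surjective : Function.Surjective (ofTensor hL) := (nullForms L).mkQ_surjective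

theorem ofTensor_eq_zero {n : A ⊗[k] A} : ofTensor hL n = 0 ↔ n ∈ nullForms L :=
  Submodule.Quotient.mk_eq_zero _

/-- The maps out of the quotient. -/
noncomputable def lift {V : Type*} [AddCommGroup V] [Module k V] (f : A ⊗[k] A →ₗ[k] V)
    (hf : ∀ n ∈ nullForms L, f n = 0) : TangentForm hL →ₗ[k] V :=
  (nullForms L).liftQ f hf

@[simp] theorem lift_ofTensor {V : Type*} [AddCommGroup V] [Module k V] (f : A ⊗[k] A →ₗ[k] V)
    (hf : ∀ n ∈ nullForms L, f n = 0) (n : A ⊗[k] A) : lift hL f hf (ofTensor hL n) = f n := rfl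

noncomputable instance : SMul A (TangentForm hL) :=
  ⟨fun a => lift hL (ofTensor hL ∘ₗ lmulLeft k A a) fun _ hn =>
    (ofTensor_eq_zero hL).2 (IsTangentSpace.lmulLeft_mem a hn)⟩

noncomputable instance : SMul Aᵐᵒᵖ (TangentForm hL) :=
  ⟨fun c => lift hL (ofTensor hL ∘ₗ rightMulDiff k c.unop) fun _ hn =>
    (ofTensor_eq_zero hL).2 (hL.rightMulDiff_mem c.unop hn)⟩

theorem smul_ofTensor (a : A) (n : A ⊗[k] A) : a • ofTensor hL n = ofTensor hL (lmulLeft k A a n) :=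
    rfl

theorem op_smul_ofTensor (c : Aᵐᵒᵖ) (n : A ⊗[k] A) :
    c • ofTensor hL n = ofTensor hL (rightMulDiff k c.unop n) := rfl

noncomputable instance : Module A (TangentForm hL) where
  one_smul w := by
    obtain ⟨n, rfl⟩ := ofTensor_surjective hL w
    rw [smul_ofTensor, map_one, Module.End.one_apply]
  mul_smul a b w := by
    obtain ⟨n, rfl⟩ := ofTensor_surjective hL w
    rw [smul_ofTensor, smul_ofTensor, smul_ofTensor, map_mul, Module.End.mul_apply]
  smul_zero a := by rw [← map_zero (ofTensor hL), smul_ofTensor, map_zero]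
  zero_smul w := by
    obtain ⟨n, rfl⟩ := ofTensor_surjective hL w
    rw [smul_ofTensor, map_zero, LinearMap.zero_apply, map_zero]
  smul_add a w w' := by
    obtain ⟨n, rfl⟩ := ofTensor_surjective hL w
    obtain ⟨n', rfl⟩ := ofTensor_surjective hL w'
    rw [← map_add, smul_ofTensor, smul_ofTensor, smul_ofTensor, map_add, map_add]
  add_smul a b w := by
    obtain ⟨n, rfl⟩ := ofTensor_surjective hL w
    rw [smul_ofTensor, smul_ofTensor, smul_ofTensor, map_add, LinearMap.add_apply, map_add]

/-- On A ⊗ A itself the unit does not act as the identity; the error ab ⊗ 1 is null because the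
functionals in `L` vanish at 1. -/
theorem rightMulDiff_one (n : A ⊗[k] A) : ofTensor hL (rightMulDiff k 1 n) = ofTensor hL n := by
  induction n with
  | zero => simp
  | add p q hp hq => simp only [map_add, hp, hq]
  | tmul a b =>
    rw [rightMulDiff_tmul, map_sub, (ofTensor_eq_zero hL).2 (hL.tmul_one_mem (a * b)), mul_one,
      sub_zero]

theorem rightMulDiff_mul (a b : A) (n : A ⊗[k] A) :
    rightMulDiff k (a * b) n = rightMulDiff k b (rightMulDiff k a n) := by
  induction n with
  | zero => simp
  | add p q hp hq => simp only [map_add, hp, hq]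
  | tmul x y => simp [mul_assoc]

noncomputable instance : Module Aᵐᵒᵖ (TangentForm hL) where
  one_smul w := by
    obtain ⟨n, rfl⟩ := ofTensor_surjective hL w
    rw [op_smul_ofTensor, MulOpposite.unop_one, rightMulDiff_one]
  mul_smul a b w := by
    obtain ⟨n, rfl⟩ := ofTensor_surjective hL w
    rw [op_smul_ofTensor, op_smul_ofTensor, op_smul_ofTensor, MulOpposite.unop_mul,
      rightMulDiff_mul]
  smul_zero a := by rw [← map_zero (ofTensor hL), op_smul_ofTensor, map_zero]
  zero_smul w := by
    obtain ⟨n, rfl⟩ := ofTensor_surjective hL w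
    rw [op_smul_ofTensor, MulOpposite.unop_zero, map_zero, LinearMap.zero_apply, map_zero]
  smul_add a w w' := by
    obtain ⟨n, rfl⟩ := ofTensor_surjective hL w
    obtain ⟨n', rfl⟩ := ofTensor_surjective hL w'
    rw [← map_add, op_smul_ofTensor, op_smul_ofTensor, op_smul_ofTensor, map_add, map_add]
  add_smul a b w := by
    obtain ⟨n, rfl⟩ := ofTensor_surjective hL w
    rw [op_smul_ofTensor, op_smul_ofTensor, op_smul_ofTensor, MulOpposite.unop_add, map_add,
      LinearMap.add_apply,
      map_add]

noncomputable instance : IsScalarTower k A (TangentForm hL) where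
  smul_assoc r a w := by
    obtain ⟨n, rfl⟩ := ofTensor_surjective hL w
    rw [smul_ofTensor, smul_ofTensor, map_smul, LinearMap.smul_apply, map_smul]

noncomputable instance : IsScalarTower k Aᵐᵒᵖ (TangentForm hL) where
  smul_assoc r a w := by
    obtain ⟨n, rfl⟩ := ofTensor_surjective hL w
    rw [op_smul_ofTensor, op_smul_ofTensor, MulOpposite.unop_smul, map_smul, LinearMap.smul_apply,
      map_smul]

noncomputable instance : SMulCommClass A Aᵐᵒᵖ (TangentForm hL) where
  smul_comm a c w := by
    obtain ⟨n, rfl⟩ := ofTensor_surjective hL w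
    rw [op_smul_ofTensor, smul_ofTensor, smul_ofTensor, op_smul_ofTensor]
    congr 1
    induction n with
    | zero => simp
    | add p q hp hq => simp only [map_add, hp, hq]
    | tmul x y => simp [mul_assoc]

end TangentForm

open TangentForm

/-- The differential calculus with tangent space `L`. -/
noncomputable def IsTangentSpace.differentialCalculus (hL : IsTangentSpace L) :
    DifferentialCalculus.{u, v, v} k A where
  Form := TangentForm hL
  d := ofTensor hL ∘ₗ TensorProduct.mk k A A 1
  leibniz a b := by
    simp only [LinearMap.comp_apply, TensorProduct.mk_apply, smul_ofTensor, op_smul_ofTensor,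
      lmulLeft_tmul,
      MulOpposite.unop_op, rightMulDiff_tmul, ← map_add, one_mul, mul_one, add_sub_cancel]
  span_d := by
    rw [eq_top_iff]
    intro w _
    obtain ⟨n, rfl⟩ := ofTensor_surjective hL w
    induction n with
    | zero => simp
    | add p q hp hq =>
      rw [map_add]
      exact add_mem (hp trivial) (hq trivial)
    | tmul a b =>
      have : ofTensor hL (a ⊗ₜ[k] b) = a • ofTensor hL (1 ⊗ₜ[k] b) := by
        rw [smul_ofTensor, lmulLeft_tmul, mul_one]
      rw [this]
      exact Submodule.smul_mem _ _ (Submodule.subset_span ⟨b, rfl⟩)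

/-- The left action on 1-forms as a linear map. -/
noncomputable def TangentForm.leftMul (hL : IsTangentSpace L) :
    A →ₗ[k] Module.End k (TangentForm hL) :=
  (Algebra.lsmul k k (TangentForm hL) : A →ₐ[k] Module.End k (TangentForm hL)).toLinearMap

/-- The right action on 1-forms as a linear map. -/
noncomputable def TangentForm.rightMul (hL : IsTangentSpace L) :
    A →ₗ[k] Module.End k (TangentForm hL) :=
  (Algebra.lsmul k k (TangentForm hL) : Aᵐᵒᵖ →ₐ[k] Module.End k (TangentForm hL)).toLinearMap ∘ₗ
    (MulOpposite.opLinearEquiv k : A ≃ₗ[k] Aᵐᵒᵖ).toLinearMap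

theorem IsTangentSpace.map₂_leftMul (hL : IsTangentSpace L) {V : Type*} [AddCommGroup V]
    [Module k V] (f : A →ₗ[k] Module.End k V) (s : A ⊗[k] A) (t : V ⊗[k] (A ⊗[k] A)) :
    TensorProduct.map₂ f (leftMul hL) s ((ofTensor hL).lTensor V t) =
      (ofTensor hL).lTensor V (TensorProduct.map₂ f (lmulLeft k A).toLinearMap s t) := by
  induction s with
  | zero => simp
  | add _ _ h h' => simp only [map_add, LinearMap.add_apply, h, h']
  | tmul p q =>
    induction t with
    | zero => simp
    | add _ _ h h' => simp only [map_add, h, h']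
    | tmul x y =>
      simp only [LinearMap.lTensor_tmul, TensorProduct.map₂_apply_tmul, TensorProduct.map_tmul]
      rfl

theorem IsTangentSpace.map₂_rightMul (hL : IsTangentSpace L) {V : Type*} [AddCommGroup V]
    [Module k V] (f : A →ₗ[k] Module.End k V) (s : A ⊗[k] A) (t : V ⊗[k] (A ⊗[k] A)) :
    TensorProduct.map₂ f (rightMul hL) s ((ofTensor hL).lTensor V t) =
      (ofTensor hL).lTensor V (TensorProduct.map₂ f (rightMulDiff k) s t) := by
  induction s with
  | zero => simp
  | add _ _ h h' => simp only [map_add, LinearMap.add_apply, h, h']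
  | tmul p q =>
    induction t with
    | zero => simp
    | add _ _ h h' => simp only [map_add, h, h']
    | tmul x y =>
      simp only [LinearMap.lTensor_tmul, TensorProduct.map₂_apply_tmul, TensorProduct.map_tmul]
      rfl

theorem IsTangentSpace.map₂_leftMul' (hL : IsTangentSpace L) {V : Type*} [AddCommGroup V]
    [Module k V] (f : A →ₗ[k] Module.End k V) (s : A ⊗[k] A) (t : (A ⊗[k] A) ⊗[k] V) :
    TensorProduct.map₂ (leftMul hL) f s ((ofTensor hL).rTensor V t) =
      (ofTensor hL).rTensor V (TensorProduct.map₂ (lmulLeft k A).toLinearMap f s t) := by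
  induction s with
  | zero => simp
  | add _ _ h h' => simp only [map_add, LinearMap.add_apply, h, h']
  | tmul p q =>
    induction t with
    | zero => simp
    | add _ _ h h' => simp only [map_add, h, h']
    | tmul x y =>
      simp only [LinearMap.rTensor_tmul, TensorProduct.map₂_apply_tmul, TensorProduct.map_tmul]
      rfl

theorem IsTangentSpace.map₂_rightMul' (hL : IsTangentSpace L) {V : Type*} [AddCommGroup V]
    [Module k V] (f : A →ₗ[k] Module.End k V) (s : A ⊗[k] A) (t : (A ⊗[k] A) ⊗[k] V) :
    TensorProduct.map₂ (rightMul hL) f s ((ofTensor hL).rTensor V t) =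
      (ofTensor hL).rTensor V (TensorProduct.map₂ (rightMulDiff k) f s t) := by
  induction s with
  | zero => simp
  | add _ _ h h' => simp only [map_add, LinearMap.add_apply, h, h']
  | tmul p q =>
    induction t with
    | zero => simp
    | add _ _ h h' => simp only [map_add, h, h']
    | tmul x y =>
      simp only [LinearMap.rTensor_tmul, TensorProduct.map₂_apply_tmul, TensorProduct.map_tmul]
      rfl

theorem IsTangentSpace.univCoactL_mem (n : A ⊗[k] A) (hn : n ∈ nullForms L) :
    (nullForms L).mkQ.lTensor A (univCoactL k A n) = 0 := by
  refine mkQ_lTensor_eq_zero _ fun x hx => ?_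
  rw [contract_univCoactL, mem_nullForms.1 hn x hx, map_zero]

theorem IsTangentSpace.univCoactR_mem [FiniteDimensional k A] (hL : IsTangentSpace L)
    (n : A ⊗[k] A) (hn : n ∈ nullForms L) :
    (nullForms L).mkQ.rTensor A (univCoactR k A n) = 0 := by
  refine mkQ_rTensor_eq_zero _ fun x hx => ?_
  rw [contract_univCoactR (Module.finBasis k A)]
  refine Finset.sum_eq_zero fun i _ => ?_
  rw [mem_nullForms.1 hn (adDual x _) (hL.ad x hx _), map_zero, zero_mul]

namespace TangentForm

variable (hL : IsTangentSpace L)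

/-- The left coaction on 1-forms. -/
noncomputable def coactL : TangentForm hL →ₗ[k] A ⊗[k] TangentForm hL :=
  lift hL ((ofTensor hL).lTensor A ∘ₗ univCoactL k A) IsTangentSpace.univCoactL_mem

/-- The right coaction on 1-forms. -/
noncomputable def coactR [FiniteDimensional k A] : TangentForm hL →ₗ[k] TangentForm hL ⊗[k] A :=
  lift hL ((ofTensor hL).rTensor A ∘ₗ univCoactR k A) hL.univCoactR_mem

theorem coactL_ofTensor (n : A ⊗[k] A) :
    coactL hL (ofTensor hL n) = (ofTensor hL).lTensor A (univCoactL k A n) := rfl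

theorem coactR_ofTensor [FiniteDimensional k A] (n : A ⊗[k] A) :
    coactR hL (ofTensor hL n) = (ofTensor hL).rTensor A (univCoactR k A n) := rfl

theorem coactL_comp_ofTensor :
    coactL hL ∘ₗ ofTensor hL = (ofTensor hL).lTensor A ∘ₗ univCoactL k A := rfl

theorem coactR_comp_ofTensor [FiniteDimensional k A] :
    coactR hL ∘ₗ ofTensor hL = (ofTensor hL).rTensor A ∘ₗ univCoactR k A := rfl

theorem coactL_coassoc (w : TangentForm hL) : (TensorProduct.assoc k A A (TangentForm hL))
    ((Coalgebra.comul (R := k) (A := A)).rTensor (TangentForm hL) (coactL hL w)) =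
      (coactL hL).lTensor A (coactL hL w) := by
  obtain ⟨n, rfl⟩ := ofTensor_surjective hL w
  have h1 : ∀ t : A ⊗[k] (A ⊗[k] A), (TensorProduct.assoc k A A (TangentForm hL))
      ((Coalgebra.comul (R := k) (A := A)).rTensor (TangentForm hL)
        ((ofTensor hL).lTensor A t)) = ((ofTensor hL).lTensor A).lTensor A
        (TensorProduct.assoc k A A (A ⊗[k] A)
          ((Coalgebra.comul (R := k) (A := A)).rTensor _ t)) := by
    intro t
    induction t with
    | zero => simp
    | add _ _ h h' => simp only [map_add, h, h']
    | tmul x y =>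
      simp only [LinearMap.lTensor_tmul, LinearMap.rTensor_tmul]
      generalize Coalgebra.comul (R := k) x = r
      induction r with
      | zero => simp
      | add _ _ h h' => simp only [map_add, h, h', TensorProduct.add_tmul]
      | tmul x y => simp
  rw [coactL_ofTensor, ← LinearMap.lTensor_comp_apply, coactL_comp_ofTensor, h1, univCoactL,
    leftCoact_coassoc, LinearMap.lTensor_comp_apply]

theorem coactR_coassoc [FiniteDimensional k A] (w : TangentForm hL) :
    (TensorProduct.assoc k (TangentForm hL) A A)
    ((coactR hL).rTensor A (coactR hL w)) =
      (Coalgebra.comul (R := k) (A := A)).lTensor (TangentForm hL) (coactR hL w) := by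
  obtain ⟨n, rfl⟩ := ofTensor_surjective hL w
  have h1 : ∀ t : ((A ⊗[k] A) ⊗[k] A) ⊗[k] A, (TensorProduct.assoc k (TangentForm hL) A A)
      (((ofTensor hL).rTensor A).rTensor A t) = (ofTensor hL).rTensor (A ⊗[k] A)
        (TensorProduct.assoc k (A ⊗[k] A) A A t) := by
    intro t
    have : (TensorProduct.assoc k (TangentForm hL) A A).toLinearMap ∘ₗ
        ((ofTensor hL).rTensor A).rTensor A = (ofTensor hL).rTensor (A ⊗[k] A) ∘ₗ
          (TensorProduct.assoc k (A ⊗[k] A) A A).toLinearMap := by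
      refine TensorProduct.ext (TensorProduct.ext' fun x y => ?_)
      ext z
      simp
    exact congrArg (fun f => f t) this
  have h2 : ∀ t : (A ⊗[k] A) ⊗[k] A, (ofTensor hL).rTensor (A ⊗[k] A)
      ((Coalgebra.comul (R := k) (A := A)).lTensor (A ⊗[k] A) t) =
      (Coalgebra.comul (R := k) (A := A)).lTensor (TangentForm hL)
        ((ofTensor hL).rTensor A t) := by
    intro t
    induction t with
    | zero => simp
    | add _ _ h h' => simp only [map_add, h, h']
    | tmul x y => simp
  rw [coactR_ofTensor, ← LinearMap.rTensor_comp_apply, coactR_comp_ofTensor,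
    LinearMap.rTensor_comp_apply, h1, univCoactR, rightCoact_coassoc, h2]

theorem coact_comm [FiniteDimensional k A] (w : TangentForm hL) :
    (TensorProduct.assoc k A (TangentForm hL) A)
    ((coactL hL).rTensor A (coactR hL w)) = (coactR hL).lTensor A (coactL hL w) := by
  obtain ⟨n, rfl⟩ := ofTensor_surjective hL w
  have h1 : ∀ t : (A ⊗[k] (A ⊗[k] A)) ⊗[k] A, (TensorProduct.assoc k A (TangentForm hL) A)
      (((ofTensor hL).lTensor A).rTensor A t) = ((ofTensor hL).rTensor A).lTensor A
        (TensorProduct.assoc k A (A ⊗[k] A) A t) := by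
    intro t
    have : (TensorProduct.assoc k A (TangentForm hL) A).toLinearMap ∘ₗ
        ((ofTensor hL).lTensor A).rTensor A = ((ofTensor hL).rTensor A).lTensor A ∘ₗ
          (TensorProduct.assoc k A (A ⊗[k] A) A).toLinearMap := by
      refine TensorProduct.ext (TensorProduct.ext' fun x y => ?_)
      ext z
      simp
    exact congrArg (fun f => f t) this
  rw [coactR_ofTensor, coactL_ofTensor, ← LinearMap.rTensor_comp_apply,
    ← LinearMap.lTensor_comp_apply, coactL_comp_ofTensor, coactR_comp_ofTensor,
    LinearMap.rTensor_comp_apply, h1, univCoactL, univCoactR, leftCoact_rightCoact,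
    LinearMap.lTensor_comp_apply]

theorem coactL_counit (w : TangentForm hL) : (TensorProduct.lid k (TangentForm hL))
    ((Coalgebra.counit (R := k) (A := A)).rTensor (TangentForm hL) (coactL hL w)) = w := by
  obtain ⟨n, rfl⟩ := ofTensor_surjective hL w
  have h1 : ∀ t : A ⊗[k] (A ⊗[k] A), (TensorProduct.lid k (TangentForm hL))
      ((Coalgebra.counit (R := k) (A := A)).rTensor (TangentForm hL)
        ((ofTensor hL).lTensor A t)) = ofTensor hL (TensorProduct.lid k (A ⊗[k] A)
        ((Coalgebra.counit (R := k) (A := A)).rTensor _ t)) := by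
    intro t
    induction t with
    | zero => simp
    | add _ _ h h' => simp only [map_add, h, h']
    | tmul x y => simp
  rw [coactL_ofTensor, h1, univCoactL, leftCoact_counit]

theorem coactR_counit [FiniteDimensional k A] (w : TangentForm hL) :
    (TensorProduct.rid k (TangentForm hL))
    ((Coalgebra.counit (R := k) (A := A)).lTensor (TangentForm hL) (coactR hL w)) = w := by
  obtain ⟨n, rfl⟩ := ofTensor_surjective hL w
  have h1 : ∀ t : (A ⊗[k] A) ⊗[k] A, (TensorProduct.rid k (TangentForm hL))
      ((Coalgebra.counit (R := k) (A := A)).lTensor (TangentForm hL)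
        ((ofTensor hL).rTensor A t)) = ofTensor hL (TensorProduct.rid k (A ⊗[k] A)
        ((Coalgebra.counit (R := k) (A := A)).lTensor _ t)) := by
    intro t
    induction t with
    | zero => simp
    | add _ _ h h' => simp only [map_add, h, h']
    | tmul x y => simp
  rw [coactR_ofTensor, h1, univCoactR, rightCoact_counit]

end TangentForm

/-- The bicovariant calculus with tangent space `L`. -/
noncomputable def IsTangentSpace.bicovariantCalculus [FiniteDimensional k A]
    (hL : IsTangentSpace L) :
    BicovariantCalculus.{u, v, v} k A where
  toDifferentialCalculus := hL.differentialCalculus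
  coactL := coactL hL
  coactR := coactR hL
  coactL_coassoc := coactL_coassoc hL
  coactL_counit := coactL_counit hL
  coactR_coassoc := coactR_coassoc hL
  coactR_counit := coactR_counit hL
  coact_comm := coact_comm hL
  coactL_left a w := by
    obtain ⟨n, rfl⟩ := ofTensor_surjective hL w
    refine (congrArg ((ofTensor hL).lTensor A) (univCoactL_lmulLeft a n)).trans ?_
    exact (hL.map₂_leftMul _ _ _).symm
  coactL_right a w := by
    obtain ⟨n, rfl⟩ := ofTensor_surjective hL w
    refine (congrArg ((ofTensor hL).lTensor A) (univCoactL_rightMulDiff a n)).trans ?_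
    exact (hL.map₂_rightMul _ _ _).symm
  coactR_left a w := by
    obtain ⟨n, rfl⟩ := ofTensor_surjective hL w
    refine (congrArg ((ofTensor hL).rTensor A) (univCoactR_lmulLeft a n)).trans ?_
    exact (hL.map₂_leftMul' _ _ _).symm
  coactR_right a w := by
    obtain ⟨n, rfl⟩ := ofTensor_surjective hL w
    refine (congrArg ((ofTensor hL).rTensor A) (univCoactR_rightMulDiff a n)).trans ?_
    exact (hL.map₂_rightMul' _ _ _).symm
  coactL_d a := by
    refine (congrArg ((ofTensor hL).lTensor A) (univCoactL_one_tmul a)).trans ?_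
    rw [← LinearMap.lTensor_comp_apply]
    rfl
  coactR_d a := by
    refine (congrArg ((ofTensor hL).rTensor A) (univCoactR_one_tmul a)).trans ?_
    rw [← LinearMap.rTensor_comp_apply]
    rfl

theorem IsTangentSpace.mulD_eq_zero_iff [FiniteDimensional k A] (hL : IsTangentSpace L)
    (n : A ⊗[k] A) : hL.bicovariantCalculus.mulD n = 0 ↔ n ∈ nullForms L := by
  have h : hL.bicovariantCalculus.mulD = ofTensor hL := by
    refine TensorProduct.ext' fun a b => ?_
    change ofTensor hL (lmulLeft k A a (1 ⊗ₜ b)) = _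
    rw [lmulLeft_tmul, mul_one]
    rfl
  rw [h]
  exact ofTensor_eq_zero hL

/-- The inverse `b ↦ ∑ S(b₁) ⊗ b₂` of the canonical map on `1 ⊗ b`. -/
noncomputable def canonInv (k A : Type*) [Field k] [Ring A] [HopfAlgebra k A] :
    A →ₗ[k] A ⊗[k] A :=
  (antipode k).rTensor A ∘ₗ Coalgebra.comul (R := k)

/-- The tensor Σ S(b₁) ⊗ b₂ represents ω(b), and Σ S(b₁)b₂ x(b₃) = x(b)1. So x, viewed on invariant
forms, sends ω(b) to x(b). -/
theorem contract_canonInv (x : Module.Dual k A) (b : A) :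
    contract x (canonInv k A b) = x b • 1 := by
  have h := conv_antipode_conv (Algebra.lmul k A) (x.smulRight (1 : A))
  have h2 : conv (Algebra.lmul k A).toLinearMap (x.smulRight (1 : A)) = dualAct x := by
    ext b
    obtain ⟨r⟩ : Nonempty (Coalgebra.Repr k b (A × A)) := ⟨Coalgebra.Repr.arbitrary k b⟩
    rw [conv_eq_sum _ _ r, dualAct_eq_sum _ r]
    simp
  rw [h2] at h
  have h3 := congrArg (fun f => f b) h
  simp only [LinearMap.smulRight_apply] at h3
  rw [← h3, conv, canonInv]
  simp only [LinearMap.comp_apply]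
  generalize Coalgebra.comul (R := k) b = t
  induction t with
  | zero => simp
  | add p q hp hq => simp only [map_add, hp, hq]
  | tmul p q => simp

theorem _root_.BicovariantCalculus.mulD_canonInv (C : BicovariantCalculus k A) (b : A) :
    C.mulD (canonInv k A b) = C.maurerCartan b := by
  rw [BicovariantCalculus.maurerCartan, canonInv]
  simp only [LinearMap.comp_apply]
  generalize Coalgebra.comul (R := k) b = t
  induction t with
  | zero => simp
  | add p q hp hq => simp only [map_add, hp, hq]
  | tmul p q => simp

theorem IsTangentSpace.maurerCartan_eq_zero_iff [FiniteDimensional k A]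
    (hL : IsTangentSpace L) (b : A) :
    hL.bicovariantCalculus.maurerCartan b = 0 ↔ ∀ x ∈ L, x b = 0 := by
  rw [← BicovariantCalculus.mulD_canonInv, hL.mulD_eq_zero_iff, mem_nullForms]
  refine forall₂_congr fun x _ => ?_
  rw [contract_canonInv]
  constructor
  · intro h
    have := congrArg (Coalgebra.counit (R := k)) h
    simpa using this
  · intro h
    rw [h, zero_smul]

/-- The kernel of ω is the common zero set of `L`, so the tangent space is the double annihilator of
`L`, which is `L` again in finite dimension. -/
theorem IsTangentSpace.quantumTangentSpace_eq [FiniteDimensional k A]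
    (hL : IsTangentSpace L) :
    hL.bicovariantCalculus.quantumTangentSpace = L := by
  have h1 : LinearMap.ker hL.bicovariantCalculus.maurerCartan = L.dualCoannihilator := by
    ext b
    rw [LinearMap.mem_ker, hL.maurerCartan_eq_zero_iff, Submodule.mem_dualCoannihilator]
  rw [BicovariantCalculus.quantumTangentSpace_eq_range,
    LinearMap.range_dualMap_eq_dualAnnihilator_ker, h1,
    Subspace.dualCoannihilator_dualAnnihilator_eq]

end HopfAlgebra

/-! ### From tangent spaces to invariant subspaces of the dual. -/

namespace HopfAlgebra

variable {k : Type*} {A : Type*} [Field k] [Ring A] [HopfAlgebra k A]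

/-- Because Σ S(b₁)ε(b₂)b₃ = ε(b)1. The adjoint action only rescales the counit, which can therefore
be split off. -/
theorem adDual_counit (h : Module.Dual k A) :
    adDual (Coalgebra.counit (R := k)) h = h 1 • Coalgebra.counit (R := k) (A := A) := by
  let X : A →ₗ[k] A := (TensorProduct.lid k A).toLinearMap ∘ₗ
    (Coalgebra.counit (R := k) (A := A)).rTensor A ∘ₗ adCoact k A
  have hX : X = (Coalgebra.counit (R := k) (A := A)).smulRight 1 := by
    apply conv_injective (Algebra.lmul k A)
    ext b
    obtain ⟨r⟩ : Nonempty (Coalgebra.Repr k b (A × A)) := ⟨Coalgebra.Repr.arbitrary k b⟩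
    have h1 : ∀ a t, TensorProduct.lid k A
        ((Coalgebra.counit (R := k) (A := A)).rTensor A (lmulRight k A a t)) =
        a * TensorProduct.lid k A ((Coalgebra.counit (R := k) (A := A)).rTensor A t) := by
      intro a t
      induction t with
      | zero => simp
      | add p q hp hq => simp only [map_add, mul_add, hp, hq]
      | tmul p q => simp
    have h2 : conv (Algebra.lmul k A).toLinearMap X b = b := by
      have h3 := congrArg (fun t => TensorProduct.lid k A
        ((Coalgebra.counit (R := k) (A := A)).rTensor A t))
        (congrArg (fun f => f b) (conv_adCoact (k := k) (A := A)))
      simp only [conv_eq_sum _ _ r, map_sum, AlgHom.toLinearMap_apply, h1,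
        Coalgebra.rTensor_counit_comul, TensorProduct.lid_tmul, one_smul] at h3
      rw [conv_eq_sum _ _ r]
      simpa [X] using h3
    rw [h2, conv_eq_sum _ _ r]
    conv_lhs => rw [← Coalgebra.sum_counit_right_smul r]
    simp
  ext b
  have h4 : ∀ t, LinearMap.mul' k k (TensorProduct.map (Coalgebra.counit (R := k)) h t) =
      h (TensorProduct.lid k A ((Coalgebra.counit (R := k) (A := A)).rTensor A t)) := by
    intro t
    induction t with
    | zero => simp
    | add p q hp hq => simp only [map_add, hp, hq]
    | tmul p q => simp
  have h5 := congrArg (fun f => h (f b)) hX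
  simp only [adDual, LinearMap.comp_apply, h4]
  simpa [X, mul_comm] using h5

variable (k A) in
/-- The projection of the dual to the functionals that vanish at `1`. -/
noncomputable def augProj : Module.Dual k A →ₗ[k] Module.Dual k A :=
  LinearMap.id - (LinearMap.applyₗ (1 : A)).smulRight (Coalgebra.counit (R := k) (A := A))

theorem augProj_apply (x : Module.Dual k A) :
    augProj k A x = x - x 1 • Coalgebra.counit (R := k) (A := A) := rfl

theorem augProj_of_map_one {x : Module.Dual k A} (hx : x 1 = 0) : augProj k A x = x := by
  simp [augProj_apply, hx]

theorem augProj_counit : augProj k A (Coalgebra.counit (R := k)) = 0 := by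
  simp [augProj_apply]

theorem augProj_map_one (x : Module.Dual k A) : augProj k A x 1 = 0 := by
  simp [augProj_apply]

/-- Removing the counit component converts plain translation into the corrected translation required
of a tangent space. -/
theorem augProj_mulRight (x : Module.Dual k A) (e : A) :
    augProj k A (x ∘ₗ LinearMap.mulRight k e) =
      augProj k A x ∘ₗ LinearMap.mulRight k e -
        augProj k A x e • Coalgebra.counit (R := k) (A := A) := by
  ext b
  simp [augProj_apply]
  ring

theorem adDual_add (x y h : Module.Dual k A) : adDual (x + y) h = adDual x h + adDual y h := by
  simp [adDual, TensorProduct.map_add_left, LinearMap.add_comp, LinearMap.comp_add]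

theorem adDual_smul (c : k) (x h : Module.Dual k A) : adDual (c • x) h = c • adDual x h := by
  simp [adDual, TensorProduct.map_smul_left, LinearMap.smul_comp, LinearMap.comp_smul]

theorem adDual_add_right (x h h' : Module.Dual k A) :
    adDual x (h + h') = adDual x h + adDual x h' := by
  simp [adDual, TensorProduct.map_add_right, LinearMap.add_comp, LinearMap.comp_add]

theorem adDual_smul_right (c : k) (x h : Module.Dual k A) :
    adDual x (c • h) = c • adDual x h := by
  simp [adDual, TensorProduct.map_smul_right, LinearMap.smul_comp, LinearMap.comp_smul]

theorem adDual_map_one (x h : Module.Dual k A) : adDual x h 1 = x 1 * h 1 := by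
  simp [adDual, adCoact, conv, Algebra.TensorProduct.one_def]

theorem augProj_adDual (x h : Module.Dual k A) :
    augProj k A (adDual x h) = adDual (augProj k A x) h := by
  have hx : x = augProj k A x + x 1 • Coalgebra.counit (R := k) (A := A) := by
    simp [augProj_apply]
  conv_lhs => rw [hx, adDual_add, adDual_smul, adDual_counit, map_add, map_smul, map_smul,
    augProj_counit, smul_zero, smul_zero, add_zero]
  exact augProj_of_map_one (by rw [adDual_map_one, augProj_map_one, zero_mul])

/-- Subspaces of the dual which are stable under right translations and the adjoint action. -/
structure IsStable (W : Submodule k (Module.Dual k A)) : Prop where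
  mulRight : ∀ x ∈ W, ∀ e : A, x ∘ₗ LinearMap.mulRight k e ∈ W
  ad : ∀ x ∈ W, ∀ h : Module.Dual k A, adDual x h ∈ W

theorem IsTangentSpace.isStable_comap {L : Submodule k (Module.Dual k A)}
    (hL : IsTangentSpace L) : IsStable (L.comap (augProj k A)) where
  mulRight x hx e := by
    rw [Submodule.mem_comap, augProj_mulRight]
    exact hL.mulRight _ hx e
  ad x hx h := by
    rw [Submodule.mem_comap, augProj_adDual]
    exact hL.ad _ hx h

theorem IsStable.isTangentSpace_map {W : Submodule k (Module.Dual k A)} (hW : IsStable W) :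
    IsTangentSpace (W.map (augProj k A)) where
  map_one := by
    rintro _ ⟨x, -, rfl⟩
    exact augProj_map_one x
  mulRight := by
    rintro _ ⟨x, hx, rfl⟩ e
    rw [← augProj_mulRight]
    exact ⟨_, hW.mulRight x hx e, rfl⟩
  ad := by
    rintro _ ⟨x, hx, rfl⟩ h
    exact ⟨_, hW.ad x hx h, augProj_adDual x h⟩

end HopfAlgebra

/-! ### The bicrossproduct in coordinates. -/

namespace Bicrossproduct
open HopfAlgebra

variable {k : Type*} [Field k] {G M : Type*} [Group G] [Group M] [Fintype M] [DecidableEq M]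
  {P : MatchedPair G M}

theorem antipode_δ (s : M) (u : G) : antipode k (δ k P s u) = δ k P (P.ract s u)⁻¹ (P.lact s u)⁻¹ :=
  antipodeHom_δ s u

theorem dualAct_δ (x : Module.Dual k (Bicrossproduct k P)) (s : M) (u : G) :
    dualAct x (δ k P s u) = ∑ a : M, x (δ k P (a⁻¹ * s) u) • δ k P a (P.lact (a⁻¹ * s) u) := by
  simp [dualAct, comul_δ]

/-- For each a the product of idempotents is nonzero for a single term of the inner coproduct, b =
a⁻¹sa; the matched pair identities then simplify the group elements. -/
theorem adCoact_δ (s : M) (u : G) : adCoact k (Bicrossproduct k P) (δ k P s u) =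
    ∑ a : M, δ k P (a⁻¹ * s * a) (P.lact a⁻¹ u) ⊗ₜ[k]
      δ k P (P.ract a⁻¹ (P.lact s u)) ((P.lact s u)⁻¹ * u) := by
  rw [adCoact, conv, LinearMap.comp_apply, comul_δ]
  simp only [map_sum, TensorProduct.lift.tmul, LinearMap.compl₂_apply, comul_δ, antipode_δ,
    LinearMap.comp_apply, AlgHom.toLinearMap_apply, lmulRight_tmul, δ_mul_δ]
  refine Finset.sum_congr rfl fun a _ => ?_
  rw [Finset.sum_eq_single (a⁻¹ * s * a)]
  · have h1 : (a⁻¹ * s * a)⁻¹ * (a⁻¹ * s) = a⁻¹ := by group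
    have h2 : P.ract a (P.lact (a⁻¹ * s) u) = (P.ract a⁻¹ (P.lact s u))⁻¹ := by
      rw [P.mul_lact, P.ract_inv_lact]
    have h3 : P.lact a (P.lact (a⁻¹ * s) u) = P.lact s u := by
      rw [← P.mul_lact, mul_inv_cancel_left]
    rw [h1, if_pos, h2, h3, inv_inv]
    rw [h2, h3, inv_inv, ← P.ract_mul, mul_inv_cancel, P.ract_one]
  · intro b _ hb
    rw [if_neg, TensorProduct.tmul_zero]
    rw [P.inv_ract_inv]
    intro h
    apply hb
    rw [eq_inv_mul_iff_mul_eq] at h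
    rw [← h, inv_mul_cancel_right]
  · simp

/-- The functional with prescribed values on the basis. -/
noncomputable def ofFun (k : Type*) [Field k] {G M : Type*} [Group G] [Group M]
    (P : MatchedPair G M) : (M × G → k) ≃ₗ[k] Module.Dual k (Bicrossproduct k P) :=
  (basis k P).constr k

@[simp] theorem ofFun_δ {G M : Type*} [Group G] [Group M] {P : MatchedPair G M} (f : M × G → k)
    (s : M) (u : G) : ofFun k P f (δ k P s u) = f (s, u) := by
  simp [ofFun, δ]

/-- The map `(s, u) ↦ (b s b⁻¹, b ▷ u)` with `b = g ◁ (s ▷ u)⁻¹`. -/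
def conjMap (P : MatchedPair G M) (g : M) (p : M × G) : M × G :=
  (P.ract g (P.lact p.1 p.2)⁻¹ * p.1 * (P.ract g (P.lact p.1 p.2)⁻¹)⁻¹,
    P.lact (P.ract g (P.lact p.1 p.2)⁻¹) p.2)

theorem ofFun_mulRight (f : M × G → k) (a : M) (v : G) :
    ofFun k P f ∘ₗ LinearMap.mulRight k (δ k P a v) =
      ofFun k P fun p => if P.ract p.1 p.2 = a then f (p.1, p.2 * v) else 0 := by
  refine hom_ext fun s u => ?_
  rw [LinearMap.comp_apply, LinearMap.mulRight_apply, δ_mul_δ, ofFun_δ]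
  split_ifs <;> simp

theorem adDual_ofFun [DecidableEq G] (f : M × G → k) (g : M) (v : G) :
    adDual (ofFun k P f) ((basis k P).coord (g, v)) =
      ofFun k P fun p => if (P.lact p.1 p.2)⁻¹ * p.2 = v then f (conjMap P g p) else 0 := by
  refine hom_ext fun s u => ?_
  have h1 : ∀ (s : M) (u : G), (basis k P).coord (g, v) (δ k P s u) =
      if s = g ∧ u = v then 1 else 0 := by
    intro s u
    simp [δ, Finsupp.single_apply]
  rw [adDual, LinearMap.comp_apply, LinearMap.comp_apply, adCoact_δ, ofFun_δ]
  simp only [map_sum, TensorProduct.map_tmul, LinearMap.mul'_apply, h1, ofFun_δ]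
  -- This is the only a with a⁻¹ ◁ (s ▷ u) = g.
  rw [Finset.sum_eq_single (P.ract g (P.lact s u)⁻¹)⁻¹]
  · have h2 : P.ract (P.ract g (P.lact s u)⁻¹) (P.lact s u) = g := by
      rw [← P.ract_mul, inv_mul_cancel, P.ract_one]
    simp only [inv_inv, h2, true_and, conjMap]
    split_ifs <;> simp
  · intro a _ ha
    rw [if_neg, mul_zero]
    rintro ⟨h, -⟩
    apply ha
    rw [← h, ← P.ract_mul, mul_inv_cancel, P.ract_one, inv_inv]
  · simp

/-- Stable spaces of functions on `M × G`, which stand for functionals on the bicrossproduct. -/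
structure FunStable [DecidableEq G] (P : MatchedPair G M) (W : Submodule k (M × G → k)) :
    Prop where
  mulRight : ∀ f ∈ W, ∀ a v,
    (fun p => if P.ract p.1 p.2 = a then f (p.1, p.2 * v) else 0) ∈ W
  ad : ∀ f ∈ W, ∀ g v,
    (fun p => if (P.lact p.1 p.2)⁻¹ * p.2 = v then f (conjMap P g p) else 0) ∈ W

theorem _root_.HopfAlgebra.IsStable.funStable [DecidableEq G]
    {W : Submodule k (Module.Dual k (Bicrossproduct k P))} (hW : IsStable W) :
    FunStable P (W.comap (ofFun k P).toLinearMap) where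
  mulRight f hf a v := by
    have := hW.mulRight _ hf (δ k P a v)
    rwa [LinearEquiv.coe_coe, ofFun_mulRight] at this
  ad f hf g v := by
    have := hW.ad _ hf ((basis k P).coord (g, v))
    rwa [LinearEquiv.coe_coe, adDual_ofFun] at this

theorem FunStable.isStable [DecidableEq G] [Fintype G] {W : Submodule k (M × G → k)}
    (hW : FunStable P W) : IsStable (W.map (ofFun k P).toLinearMap) where
  mulRight := by
    rintro _ ⟨f, hf, rfl⟩ e
    have he := (basis k P).sum_repr e
    have h : (ofFun k P f) ∘ₗ LinearMap.mulRight k e = ∑ p, (basis k P).repr e p •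
        (ofFun k P f ∘ₗ LinearMap.mulRight k (basis k P p)) := by
      refine LinearMap.ext fun b => ?_
      rw [LinearMap.comp_apply, LinearMap.mulRight_apply, LinearMap.sum_apply]
      conv_lhs => rw [← he, Finset.mul_sum, map_sum]
      exact Finset.sum_congr rfl fun p _ => by
        rw [mul_smul_comm, map_smul, LinearMap.smul_apply, LinearMap.comp_apply,
          LinearMap.mulRight_apply]
    rw [LinearEquiv.coe_coe, h]
    refine Submodule.sum_mem _ fun p _ => Submodule.smul_mem _ _ ?_
    exact ⟨_, hW.mulRight f hf p.1 p.2, (ofFun_mulRight f p.1 p.2).symm⟩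
  ad := by
    rintro _ ⟨f, hf, rfl⟩ h
    have h1 : h = ∑ p, h (basis k P p) • (basis k P).coord p := by
      refine (basis k P).ext fun q => ?_
      simp
    have h2 : ∀ (S : Finset (M × G)), adDual (ofFun k P f)
        (∑ p ∈ S, h (basis k P p) • (basis k P).coord p) ∈ W.map (ofFun k P).toLinearMap := by
      intro S
      induction S using Finset.induction_on with
      | empty =>
        have := adDual_smul_right (0 : k) (ofFun k P f) 0
        rw [Finset.sum_empty, ← zero_smul k (0 : Module.Dual k (Bicrossproduct k P)), this,
          zero_smul]
        exact Submodule.zero_mem _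
      | insert a S ha ih =>
        rw [Finset.sum_insert ha, adDual_add_right, adDual_smul_right]
        refine Submodule.add_mem _ (Submodule.smul_mem _ _ ?_) ih
        exact ⟨_, hW.ad f hf a.1 a.2, (adDual_ofFun f a.1 a.2).symm⟩
    rw [h1]
    exact h2 _

end Bicrossproduct

/-! ### The bigrading and the twist on S₃ × ℤ₆. -/

namespace S3Z6
open HopfAlgebra Bicrossproduct

/-- The first grading `s ◁ u`. -/
def gradeM (p : S3 × Z6) : S3 := ract p.1 p.2

/-- The second grading `(s ▷ u)⁻¹ u`. -/
def gradeG (p : S3 × Z6) : Z6 := (lact p.1 p.2)⁻¹ * p.2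

/-- The map of right translation. -/
def shift (v : Z6) (p : S3 × Z6) : S3 × Z6 := (p.1, p.2 * v)

/-- The type of a group element: `0` for the unit, `1` for the other rotations, `2` for the
reflections. -/
def type : S3 → Fin 3
  | .r i => if i = 0 then 0 else 1
  | .sr _ => 2

/-- The twist, which commutes with all the symmetries. -/
def twist : S3 × Z6 → S3 × Z6
  | (.r i, u) => (.r i, .ofAdd (u.toAdd - 2 * (i.val : ZMod 6)))
  | (.sr i, u) => (.sr (-i), .ofAdd (u.toAdd + 3 + 2 * (i.val : ZMod 6)))

theorem twist_shift : ∀ v p, twist (shift v p) = shift v (twist p) := by decide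

set_option maxRecDepth 100000 in
theorem twist_conjMap : ∀ g p, twist (conjMap pair g p) = conjMap pair g (twist p) := by decide

theorem gradeM_twist : ∀ p, gradeM (twist p) = gradeM p := by decide

theorem gradeG_twist : ∀ p, gradeG (twist p) = gradeG p := by decide

theorem type_twist : ∀ p, type (twist p).1 = type p.1 := by decide

theorem type_gradeM : ∀ p, type (gradeM p) = type p.1 := by decide

set_option maxRecDepth 100000 in
theorem type_conjMap : ∀ g p, type (conjMap pair g p).1 = type p.1 := by decide

theorem conjMap_one : ∀ p, conjMap pair 1 p = p := by decide

theorem iterate_twist_type_one : ∀ p : S3 × Z6, type p.1 = 1 → twist^[3] p = p := by decide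
theorem iterate_twist_type_two : ∀ p : S3 × Z6, type p.1 = 2 → twist^[2] p = p := by decide

-- Since `twist` preserves both grades, a cell of nonzero type is a single twist orbit. Over the
-- unit this fails: there the twist is the identity and all six points share one cell.
set_option maxRecDepth 100000 in
theorem exists_iterate_twist : ∀ p q : S3 × Z6, type p.1 ≠ 0 → gradeM q = gradeM p →
    gradeG q = gradeG p → ∃ j : Fin 6, q = twist^[j.val] p := by decide

/-- On each graded piece, the twist is the composite of a translation and `conjMap`. -/
theorem exists_twist_eq : ∀ a v, ∃ g w, ∀ p, gradeM p = a → gradeG p = v →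
    twist p = shift w (conjMap pair g p) := by
  -- The shift and the conjugating element depend on p only through its two grades.
  have h : ∀ p, twist p = shift (match gradeM p with
      | .r i => if gradeG p = 1 then .ofAdd (-2 * (i.val : ZMod 6)) else .ofAdd
        (2 * (i.val : ZMod 6))
      | .sr i => .ofAdd (3 + 2 * (i.val : ZMod 6)))
      (conjMap pair (match gradeM p with | .r i => 1 | .sr i => .r i) p) := by decide
  intro a v
  exact ⟨_, _, fun p h1 h2 => by rw [h p, h1, h2]⟩

/-- A point of each type. -/
def basePoint : Fin 3 → S3 × Z6
  | 0 => (1, 1)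
  | 1 => (t, 1)
  | 2 => (s, 1)

-- Together with `exists_of_basePoint` this is transitivity of the symmetries on the cells of each
-- nonzero type.
set_option maxRecDepth 100000 in
theorem exists_to_basePoint : ∀ p : S3 × Z6, type p.1 ≠ 0 → ∃ g w,
    gradeM (shift w (conjMap pair g p)) = gradeM (basePoint (type p.1)) ∧
    gradeG (shift w (conjMap pair g p)) = gradeG (basePoint (type p.1)) := by decide

set_option maxRecDepth 100000 in
theorem exists_of_basePoint : ∀ p : S3 × Z6, type p.1 ≠ 0 → ∃ g w,
    gradeM (shift w (conjMap pair g (basePoint (type p.1)))) = gradeM p ∧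
    gradeG (shift w (conjMap pair g (basePoint (type p.1)))) = gradeG p := by decide

end S3Z6

/-- A nonzero vector on which an endomorphism is periodic leads to an eigenvector in every
invariant subspace that contains it. -/
theorem Module.End.exists_eigenvector_of_pow_eq {k V : Type*} [Field k] [AddCommGroup V]
    [Module k V] (T : Module.End k V) {W : Submodule k V} (hT : ∀ x ∈ W, T x ∈ W) {n : ℕ}
    (hn : 0 < n) {ω : k} (hω : IsPrimitiveRoot ω n) {x : V} (hx : x ∈ W) (hx0 : x ≠ 0)
    (hTx : (T ^ n) x = x) : ∃ r : k, r ^ n = 1 ∧ ∃ y ∈ W, y ≠ 0 ∧ T y = r • y := by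
  classical
  -- If a product of factors T − r kills x, then either the factor T − a already kills x, or Tx − ax
  -- is a nonzero vector killed by the remaining factors.
  have key : ∀ S : Finset k, ∀ x ∈ W, x ≠ 0 →
      Polynomial.aeval T (∏ r ∈ S, (Polynomial.X - Polynomial.C r)) x = 0 →
      ∃ r ∈ S, ∃ y ∈ W, y ≠ 0 ∧ T y = r • y := by
    intro S
    induction S using Finset.induction_on with
    | empty =>
      intro x _ hx0 h
      exact absurd (by simpa using h) hx0
    | insert a S ha ih =>
      intro x hx hx0 h
      by_cases h0 : T x - a • x = 0
      · exact ⟨a, Finset.mem_insert_self _ _, x, hx, hx0, sub_eq_zero.1 h0⟩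
      · obtain ⟨r, hr, y, hy⟩ := ih (T x - a • x)
          (W.sub_mem (hT x hx) (W.smul_mem _ hx)) h0 (by
            rw [Finset.prod_insert ha, mul_comm, map_mul, Module.End.mul_apply] at h
            simpa using h)
        exact ⟨r, Finset.mem_insert_of_mem hr, y, hy⟩
  -- The primitive root makes Xⁿ − 1 a product of linear factors over `k`.
  obtain ⟨r, hr, y, hy⟩ := key (Polynomial.nthRootsFinset n 1) x hx hx0 (by
    rw [← Polynomial.X_pow_sub_one_eq_prod hn hω]
    simp [hTx])
  exact ⟨r, (Polynomial.mem_nthRootsFinset hn 1).1 hr, y, hy⟩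

/-! ### Invariant subspaces over the rotations and the reflections. -/

namespace S3Z6
open HopfAlgebra Bicrossproduct

section Stable
variable {k : Type*} [Field k] {W : Submodule k (S3 × Z6 → k)}

/-- Translation by 1 cuts out the first grade, and the adjoint operation at the unit of S₃ cuts out
the second, since `conjMap` is then the identity. -/
theorem FunStable.cell (hW : FunStable pair W) {f : S3 × Z6 → k} (hf : f ∈ W) (a : S3) (v : Z6) :
    (fun p => if gradeM p = a ∧ gradeG p = v then f p else 0) ∈ W := by
  have h := hW.ad _ (hW.mulRight f hf a 1) 1 v
  have h2 : ∀ p, conjMap pair 1 p = p := conjMap_one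
  simp only [h2, mul_one] at h
  convert h using 2 with p
  simp only [gradeM, gradeG, pair]
  by_cases h3 : ract p.1 p.2 = a <;> by_cases h4 : (lact p.1 p.2)⁻¹ * p.2 = v <;> simp [h3, h4]

/-- Cutting to a cell preserves W, so membership in W is a local condition. -/
theorem FunStable.of_cells (hW : FunStable pair W) {f : S3 × Z6 → k}
    (h : ∀ a v, ∃ g ∈ W, ∀ p, gradeM p = a → gradeG p = v → f p = g p) : f ∈ W := by
  choose g hg hfg using h
  have : f = ∑ a, ∑ v, fun p => if gradeM p = a ∧ gradeG p = v then g a v p else 0 := by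
    funext p
    simp only [Finset.sum_apply]
    rw [Finset.sum_eq_single (gradeM p), Finset.sum_eq_single (gradeG p)]
    · simp [hfg _ _ p rfl rfl]
    · intro v _ hv
      rw [if_neg fun h => hv h.2.symm]
    · simp
    · intro a _ ha
      exact Finset.sum_eq_zero fun v _ => by rw [if_neg fun h => ha h.1.symm]
    · simp
  rw [this]
  exact W.sum_mem fun a _ => W.sum_mem fun v _ => FunStable.cell hW (hg a v) a v

/-- The mask in `mulRight` equals 1 on the cell under consideration, so locality removes it. -/
theorem FunStable.comp_shift (hW : FunStable pair W) {f : S3 × Z6 → k} (hf : f ∈ W) (v : Z6) :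
    f ∘ shift v ∈ W :=
  FunStable.of_cells hW fun a _ => ⟨_, hW.mulRight f hf a v, fun _ hp _ => (if_pos hp).symm⟩

theorem FunStable.comp_conjMap (hW : FunStable pair W) {f : S3 × Z6 → k} (hf : f ∈ W) (g : S3) :
    f ∘ conjMap pair g ∈ W :=
  FunStable.of_cells hW fun _ v => ⟨_, hW.ad f hf g v, fun _ _ hp => (if_pos hp).symm⟩

/-- On each cell the twist is a shift after a `conjMap`; which ones depends on the cell, and
locality allows that. -/
theorem FunStable.comp_twist (hW : FunStable pair W) {f : S3 × Z6 → k} (hf : f ∈ W) :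
    f ∘ twist ∈ W := by
  refine FunStable.of_cells hW fun a v => ?_
  obtain ⟨g, w, h⟩ := exists_twist_eq a v
  exact ⟨_, FunStable.comp_conjMap hW (FunStable.comp_shift hW hf w) g,
    fun p h1 h2 => congrArg f (h p h1 h2)⟩

theorem FunStable.mask_type (hW : FunStable pair W) {f : S3 × Z6 → k} (hf : f ∈ W) (i : Fin 3) :
    (fun p => if type p.1 = i then f p else 0) ∈ W := by
  refine FunStable.of_cells hW fun a v => ?_
  by_cases h : type a = i
  · exact ⟨f, hf, fun p hp _ => if_pos (by rw [← type_gradeM, hp, h])⟩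
  · exact ⟨0, W.zero_mem, fun p hp _ => if_neg (by rwa [← type_gradeM, hp])⟩

/-- The functions supported on the elements of one type that are multiplied by `q` under the
twist. -/
def block (i : Fin 3) (q : k) : Submodule k (S3 × Z6 → k) where
  carrier := {f | (∀ p, type p.1 ≠ i → f p = 0) ∧ ∀ p, f (twist p) = q * f p}
  add_mem' hf hg := ⟨fun p hp => by rw [Pi.add_apply, hf.1 p hp, hg.1 p hp, add_zero],
    fun p => by rw [Pi.add_apply, hf.2 p, hg.2 p, ← mul_add]; rfl⟩
  zero_mem' := ⟨fun _ _ => rfl, fun _ => (mul_zero q).symm⟩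
  smul_mem' c f hf := ⟨fun p hp => by rw [Pi.smul_apply, hf.1 p hp, smul_zero],
    fun p => by rw [Pi.smul_apply, hf.2 p, Pi.smul_apply, smul_eq_mul, smul_eq_mul]; ring⟩

theorem block_iterate {i : Fin 3} {q : k} {f : S3 × Z6 → k} (hf : f ∈ block i q) (j : ℕ)
    (p : S3 × Z6) : f (twist^[j] p) = q ^ j * f p := by
  induction j with
  | zero => simp
  | succ j ih => rw [Function.iterate_succ_apply', hf.2, ih, pow_succ']; ring

theorem block_comp {i : Fin 3} {q : k} {f : S3 × Z6 → k} (hf : f ∈ block i q) (v : Z6) (g : S3) :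
    f ∘ shift v ∘ conjMap pair g ∈ block i q := by
  refine ⟨fun p hp => hf.1 _ ?_, fun p => ?_⟩
  · change type (conjMap pair g p).1 ≠ i
    rwa [type_conjMap]
  · simp only [Function.comp_apply]
    rw [← twist_conjMap, ← twist_shift, hf.2]

theorem block_funStable (i : Fin 3) (q : k) : FunStable pair (block i q) where
  mulRight f hf a v := by
    refine ⟨fun p hp => ?_, fun p => ?_⟩
    · beta_reduce
      rw [hf.1 (p.1, p.2 * v) hp, ite_self]
    · have h1 : pair.ract (twist p).1 (twist p).2 = pair.ract p.1 p.2 := gradeM_twist p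
      have h2 : ((twist p).1, (twist p).2 * v) = twist (p.1, p.2 * v) := (twist_shift v p).symm
      beta_reduce
      rw [h1, h2, hf.2, mul_ite, mul_zero]
  ad f hf g v := by
    refine ⟨fun p hp => ?_, fun p => ?_⟩
    · beta_reduce
      rw [hf.1 (conjMap pair g p) (by rwa [type_conjMap]), ite_self]
    · have h1 : (pair.lact (twist p).1 (twist p).2)⁻¹ * (twist p).2 =
        (pair.lact p.1 p.2)⁻¹ * p.2 := gradeG_twist p
      beta_reduce
      rw [h1, ← twist_conjMap, hf.2, mul_ite, mul_zero]

/-- Minimality of the blocks. Symmetries carry a nonzero value of f to the base point and from there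
into any cell. A cell is one twist orbit, so two functions with the same twist eigenvalue are
proportional on it once one of them is nonzero there; hence every y in the block is, cell by cell, a
multiple of a translate of f. -/
theorem FunStable.block_le (hW : FunStable pair W) {i : Fin 3} (hi : i ≠ 0) {q : k} (hq : q ≠ 0)
    {f : S3 × Z6 → k} (hfW : f ∈ W) (hf : f ∈ block i q) (hf0 : f ≠ 0) : block i q ≤ W := by
  have h1 : ∃ f ∈ W, f ∈ block i q ∧ f (basePoint i) ≠ 0 := by
    obtain ⟨p, hp⟩ := Function.ne_iff.1 hf0
    have hpi : type p.1 = i := by_contra fun h => hp (hf.1 p h)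
    obtain ⟨g, w, h1, h2⟩ := exists_of_basePoint p (hpi ▸ hi)
    refine ⟨_, FunStable.comp_conjMap hW (FunStable.comp_shift hW hfW w) g,
      block_comp hf w g, ?_⟩
    obtain ⟨j, hj⟩ := exists_iterate_twist p _ (hpi ▸ hi) h1 h2
    rw [hpi] at hj
    change f (shift w (conjMap pair g (basePoint i))) ≠ 0
    rw [hj, block_iterate hf]
    exact mul_ne_zero (pow_ne_zero _ hq) hp
  obtain ⟨f, hfW, hf, hf0⟩ := h1
  intro y hy
  refine FunStable.of_cells hW fun a v => ?_
  by_cases h : ∃ p, gradeM p = a ∧ gradeG p = v ∧ y p ≠ 0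
  · obtain ⟨p, rfl, rfl, hp⟩ := h
    have hpi : type p.1 = i := by_contra fun h => hp (hy.1 p h)
    obtain ⟨g, w, h1, h2⟩ := exists_to_basePoint p (hpi ▸ hi)
    rw [hpi] at h1 h2
    have hb : type (basePoint i).1 = i := by
      rw [← type_gradeM, ← h1, type_gradeM]
      change type (conjMap pair g p).1 = i
      rw [type_conjMap, hpi]
    obtain ⟨j, hj⟩ := exists_iterate_twist (basePoint i) _ (by rwa [hb]) h1 h2
    have hF : f (shift w (conjMap pair g p)) ≠ 0 := by
      rw [hj, block_iterate hf]
      exact mul_ne_zero (pow_ne_zero _ hq) hf0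
    -- The factor matches the values at p; along the orbit both functions pick up the same powers of
    -- q.
    refine ⟨(y p / f (shift w (conjMap pair g p))) • (f ∘ shift w ∘ conjMap pair g),
      W.smul_mem _ (FunStable.comp_conjMap hW (FunStable.comp_shift hW hfW w) g), ?_⟩
    intro p' h1' h2'
    obtain ⟨l, rfl⟩ := exists_iterate_twist p p' (hpi ▸ hi) h1' h2'
    rw [Pi.smul_apply, block_iterate hy, block_iterate (block_comp hf w g), smul_eq_mul]
    change _ = _ * (_ * f (shift w (conjMap pair g p)))
    field_simp
  · push Not at h
    exact ⟨0, W.zero_mem, fun p h1 h2 => h p h1 h2⟩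

/-- If some element of a stable subspace does not vanish at some element of nonzero type, then the
subspace contains a block. -/
theorem FunStable.exists_block_le (hW : FunStable pair W) {i : Fin 3} (hi : i ≠ 0) {n : ℕ}
    (hn : 0 < n) (hi' : ∀ p : S3 × Z6, type p.1 = i → twist^[n] p = p) {ω : k}
    (hω : IsPrimitiveRoot ω n) {f : S3 × Z6 → k} (hf : f ∈ W) {p : S3 × Z6} (hp : type p.1 = i)
    (hfp : f p ≠ 0) : ∃ q : k, q ^ n = 1 ∧ block i q ≤ W := by
  let T : Module.End k (S3 × Z6 → k) := LinearMap.funLeft k k twist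
  let V : Submodule k (S3 × Z6 → k) :=
    { carrier := {f | ∀ p, type p.1 ≠ i → f p = 0}
      add_mem' := fun hf hg p hp => by rw [Pi.add_apply, hf p hp, hg p hp, add_zero]
      zero_mem' := fun _ _ => rfl
      smul_mem' := fun c f hf p hp => by rw [Pi.smul_apply, hf p hp, smul_zero] }
  have hT : ∀ j f p, (T ^ j) f p = f (twist^[j] p) := by
    intro j
    induction j with
    | zero => simp
    | succ j ih =>
      intro f p
      rw [pow_succ, Module.End.mul_apply, ih, Function.iterate_succ_apply']
      rfl
  -- An eigenvector is sought starting from the type-i part of f, which lies in W and is fixed by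
  -- the n-th power of the twist.
  obtain ⟨q, hq, y, hy, hy0, hTy⟩ := T.exists_eigenvector_of_pow_eq (W := W ⊓ V) (n := n)
    (ω := ω) (x := fun p => if type p.1 = i then f p else 0)
    (fun x hx => ⟨FunStable.comp_twist hW hx.1, fun p hp => hx.2 _ (by rwa [type_twist])⟩) hn hω
    ⟨FunStable.mask_type hW hf i, fun p hp => if_neg hp⟩
    (fun h => hfp (by simpa [hp] using congrFun h p)) (by
      funext p
      rw [hT]
      by_cases h : type p.1 = i
      · rw [hi' p h]
      · have : ∀ j, type (twist^[j] p).1 ≠ i := by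
          intro j
          induction j with
          | zero => exact h
          | succ j ih => rwa [Function.iterate_succ_apply', type_twist]
        simp only [if_neg h, if_neg (this n)])
  refine ⟨q, hq, FunStable.block_le hW hi ?_ hy.1 ⟨hy.2, fun p => congrFun hTy p⟩ hy0⟩
  rintro rfl
  rw [zero_pow hn.ne'] at hq
  exact zero_ne_one hq

end Stable

end S3Z6

/-! ### Invariant functions over the unit: characters of ℤ₆. -/

namespace S3Z6
open HopfAlgebra Bicrossproduct

theorem type_eq_zero_iff : ∀ m : S3, type m = 0 ↔ m = 1 := by decide

theorem gen_pow_val : ∀ v : Z6, u ^ v.toAdd.val = v := by decide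

theorem conjMap_fst_eq_one : ∀ g p, (conjMap pair g p).1 = 1 ↔ p.1 = 1 := by
  intro g p
  rw [← type_eq_zero_iff, type_conjMap, type_eq_zero_iff]

/-- Multiplication of the odd powers of `u` by `u ^ (2 m)`. -/
def oddShift (m : Fin 3) (v : Z6) : Z6 :=
  if v.toAdd.val % 2 = 0 then v else v * .ofAdd (2 * (m.val : ZMod 6))

/-- Rotations translate the odd powers of `u` and fix the even ones; reflections invert in addition.
-/
theorem conjMap_fst_one : ∀ g, ∃ m, (∀ v, conjMap pair g (1, v) = (1, oddShift m v)) ∨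
    ∀ v, conjMap pair g (1, v) = (1, (oddShift m v)⁻¹) := by decide

theorem conjMap_t : ∃ m, m ≠ 0 ∧ ∀ v, conjMap pair t (1, v) = (1, oddShift m v) := by decide

theorem conjMap_s : ∀ v, conjMap pair s (1, v) = (1, v⁻¹) := by decide

section Chi
variable {k : Type*} [Field k]

theorem pow_val_mul {r : k} (hr : r ^ 6 = 1) (v w : Z6) :
    r ^ (v * w).toAdd.val = r ^ v.toAdd.val * r ^ w.toAdd.val := by
  rw [toAdd_mul, ZMod.val_add, ← pow_eq_pow_mod _ hr, pow_add]

theorem pow_val_inv {r : k} (hr : r ^ 6 = 1) (v : Z6) :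
    r ^ (v⁻¹).toAdd.val = r⁻¹ ^ v.toAdd.val := by
  have h0 : r ≠ 0 := by
    rintro rfl
    norm_num at hr
  have h := pow_val_mul hr v⁻¹ v
  rw [inv_mul_cancel] at h
  rw [inv_pow]
  refine eq_inv_of_mul_eq_one_left (h.symm.trans ?_)
  simp

/-- The character of `ℤ₆` that maps the generator to `r`, as a function supported on the unit. -/
def chi (r : k) (p : S3 × Z6) : k := if p.1 = 1 then r ^ p.2.toAdd.val else 0

theorem chi_comp_shift {r : k} (hr : r ^ 6 = 1) (v : Z6) :
    chi r ∘ shift v = r ^ v.toAdd.val • chi r := by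
  funext p
  rw [Function.comp_apply, Pi.smul_apply, chi, chi, smul_eq_mul, mul_ite, mul_zero]
  refine if_congr Iff.rfl ?_ rfl
  rw [mul_comm]
  exact pow_val_mul hr _ _

/-- The functions r^v ± (−r)^v are, up to the factor 2, the parts of r^v on even and odd exponents,
and only the odd part is multiplied by r^(2m). -/
theorem pow_oddShift {r : k} (hr : r ^ 6 = 1) (m : Fin 3) (v : Z6) [CharZero k] :
    r ^ (oddShift m v).toAdd.val = (1 + r ^ (2 * m.val)) / 2 * r ^ v.toAdd.val +
      (1 - r ^ (2 * m.val)) / 2 * (-r) ^ v.toAdd.val := by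
  have hm : (2 * (m.val : ZMod 6)).val = 2 * m.val := by
    revert m
    decide
  rw [oddShift, neg_pow]
  split_ifs with h
  · rw [(Nat.even_iff.2 h).neg_one_pow]
    ring
  · rw [(Nat.odd_iff.2 (by omega)).neg_one_pow, pow_val_mul hr, toAdd_ofAdd, hm]
    ring

theorem chi_comp_conjMap [CharZero k] {r : k} (hr : r ^ 6 = 1) {g : S3} {m : Fin 3}
    (h : ∀ v, conjMap pair g (1, v) = (1, oddShift m v)) :
    chi r ∘ conjMap pair g =
      ((1 + r ^ (2 * m.val)) / 2) • chi r + ((1 - r ^ (2 * m.val)) / 2) • chi (-r) := by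
  funext ⟨a, v⟩
  simp only [Function.comp_apply, Pi.add_apply, Pi.smul_apply, chi, conjMap_fst_eq_one,
    smul_eq_mul]
  split_ifs with ha
  · subst ha
    rw [h, pow_oddShift hr]
  · simp

theorem chi_comp_conjMap_inv [CharZero k] {r : k} (hr : r ^ 6 = 1) {g : S3} {m : Fin 3}
    (h : ∀ v, conjMap pair g (1, v) = (1, (oddShift m v)⁻¹)) :
    chi r ∘ conjMap pair g =
      ((1 + r⁻¹ ^ (2 * m.val)) / 2) • chi r⁻¹ + ((1 - r⁻¹ ^ (2 * m.val)) / 2) • chi (-r⁻¹) := by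
  funext ⟨a, v⟩
  simp only [Function.comp_apply, Pi.add_apply, Pi.smul_apply, chi, conjMap_fst_eq_one,
    smul_eq_mul]
  split_ifs with ha
  · subst ha
    rw [h, pow_val_inv hr, pow_oddShift (by rw [inv_pow, hr, inv_one])]
  · simp

/-- As `u` generates ℤ₆, the eigenvalue equation propagates the value at the unit to the whole
fibre. -/
theorem eq_smul_chi {f : S3 × Z6 → k} (hf : ∀ p, p.1 ≠ 1 → f p = 0) {r : k}
    (h : f ∘ shift u = r • f) : f = f (1, 1) • chi r := by
  have h1 : ∀ n : ℕ, f (1, u ^ n) = r ^ n * f (1, 1) := by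
    intro n
    induction n with
    | zero => simp
    | succ n ih =>
      have := congrFun h (1, u ^ n)
      rw [Function.comp_apply, shift, ← pow_succ, Pi.smul_apply, smul_eq_mul, ih] at this
      rw [this, pow_succ']
      ring
  funext ⟨a, v⟩
  rw [Pi.smul_apply, chi]
  split_ifs with ha
  · change a = 1 at ha
    subst ha
    rw [smul_eq_mul, mul_comm, ← h1, gen_pow_val]
  · rw [smul_zero, hf _ ha]

theorem sum_chi {r : k} (hr : r ^ 6 = 1) (hr1 : r ≠ 1) : ∑ v : Z6, chi r (1, v) = 0 := by
  have h : r * ∑ v : Z6, chi r (1, v) = ∑ v : Z6, chi r (1, v) := by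
    rw [Finset.mul_sum]
    refine Fintype.sum_equiv (Equiv.mulRight u) _ _ fun v => ?_
    have := congrFun (chi_comp_shift hr u) (1, v)
    have hu : u.toAdd.val = 1 := rfl
    rw [hu, pow_one] at this
    exact this.symm
  have h2 : (r - 1) * ∑ v : Z6, chi r (1, v) = 0 := by rw [sub_mul, h, one_mul, sub_self]
  exact (mul_eq_zero.1 h2).resolve_left (sub_ne_zero.2 hr1)

theorem sum_chi_one : ∑ v : Z6, chi (1 : k) (1, v) = 6 := by
  simp [chi]

variable {W : Submodule k (S3 × Z6 → k)}

theorem FunStable.chi_inv_mem (hW : FunStable pair W) [CharZero k] {r : k} (hr : r ^ 6 = 1)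
    (h : chi r ∈ W) : chi r⁻¹ ∈ W := by
  have h1 := FunStable.comp_conjMap hW h s
  rw [chi_comp_conjMap_inv (m := 0) hr fun v => by
    rw [conjMap_s]
    revert v
    decide] at h1
  simpa using h1

/-- Under `t` the character r turns into a combination of r and −r, and the coefficient of −r is
nonzero because r² ≠ 1. -/
theorem FunStable.chi_neg_mem (hW : FunStable pair W) [CharZero k] {r : k} (hr : r ^ 6 = 1)
    (hr' : r ^ 2 ≠ 1) (h : chi r ∈ W) : chi (-r) ∈ W := by
  have h1 := FunStable.comp_conjMap hW h t
  obtain ⟨m, hm, hmt⟩ := conjMap_t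
  rw [chi_comp_conjMap hr hmt] at h1
  have h2 := (Submodule.add_mem_iff_right W (W.smul_mem _ h)).1 h1
  refine (W.smul_mem_iff (div_ne_zero (sub_ne_zero.2 fun h3 => ?_) two_ne_zero)).1 h2
  apply hr'
  fin_cases m
  · exact absurd rfl hm
  · exact h3.symm
  -- For m = 2 the coefficient vanishes only if r⁴ = 1, which with r⁶ = 1 gives r² = 1.
  · replace h3 : 1 = r ^ 4 := h3
    rw [← hr, show r ^ 6 = r ^ 4 * r ^ 2 by ring, ← h3, one_mul]

theorem FunStable.span {S : Set (S3 × Z6 → k)}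
    (h1 : ∀ f ∈ S, ∀ a v, (fun p : S3 × Z6 => if pair.ract p.1 p.2 = a then f (p.1, p.2 * v) else 0)
      ∈ Submodule.span k S)
    (h2 : ∀ f ∈ S, ∀ g v,
      (fun p : S3 × Z6 => if (pair.lact p.1 p.2)⁻¹ * p.2 = v then f (conjMap pair g p) else 0)
      ∈ Submodule.span k S) : FunStable pair (Submodule.span k S) where
  mulRight f hf a v := by
    let L : (S3 × Z6 → k) →ₗ[k] (S3 × Z6 → k) :=
      { toFun := fun f p => if pair.ract p.1 p.2 = a then f (p.1, p.2 * v) else 0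
        map_add' := fun f g => by
          funext p
          simp only [Pi.add_apply]
          split_ifs <;> simp
        map_smul' := fun c f => by
          funext p
          simp }
    exact (Submodule.span_le.2 fun f hf => h1 f hf a v :
      Submodule.span k S ≤ (Submodule.span k S).comap L) hf
  ad f hf g v := by
    let L : (S3 × Z6 → k) →ₗ[k] (S3 × Z6 → k) :=
      { toFun := fun f p => if (pair.lact p.1 p.2)⁻¹ * p.2 = v then f (conjMap pair g p) else 0
        map_add' := fun f g => by
          funext p
          simp only [Pi.add_apply]
          split_ifs <;> simp
        map_smul' := fun c f => by
          funext p
          simp }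
    exact (Submodule.span_le.2 fun f hf => h2 f hf g v :
      Submodule.span k S ≤ (Submodule.span k S).comap L) hf

/-- Over the unit both grades are trivial, so the masks keep everything or nothing, and only
`conjMap` matters. It mixes r or r⁻¹ with its negative, with coefficient zero on the negative when
r² = 1; hence the restricted form of `hneg`. -/
theorem funStable_span_chi [CharZero k] {R : Set k} (h6 : ∀ r ∈ R, r ^ 6 = 1)
    (hinv : ∀ r ∈ R, r⁻¹ ∈ R) (hneg : ∀ r ∈ R, r ^ 2 ≠ 1 → -r ∈ R) :
    FunStable pair (Submodule.span k (chi '' R)) := by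
  have hmem : ∀ r ∈ R, chi r ∈ Submodule.span k (chi '' R) := fun r hr =>
    Submodule.subset_span ⟨r, hr, rfl⟩
  have hcomb : ∀ r ∈ R, ∀ m : ℕ, ((1 + r ^ (2 * m)) / 2) • chi r +
      ((1 - r ^ (2 * m)) / 2) • chi (-r) ∈ Submodule.span k (chi '' R) := by
    intro r hr m
    refine Submodule.add_mem _ (Submodule.smul_mem _ _ (hmem r hr)) ?_
    by_cases h : r ^ 2 = 1
    · rw [pow_mul, h, one_pow, sub_self, zero_div, zero_smul]
      exact Submodule.zero_mem _
    · exact Submodule.smul_mem _ _ (hmem _ (hneg r hr h))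
  refine FunStable.span ?_ ?_
  · rintro _ ⟨r, hr, rfl⟩ a v
    by_cases ha : a = 1
    · convert Submodule.smul_mem _ (r ^ v.toAdd.val) (hmem r hr) using 1
      rw [← chi_comp_shift (h6 r hr)]
      funext p
      by_cases hp : p.1 = 1
      · rw [if_pos (by rw [hp, ha, pair.one_ract])]
        rfl
      · simp [chi, shift, hp]
    · convert Submodule.zero_mem _ with p
      by_cases hp : p.1 = 1
      · rw [if_neg (by rw [hp, pair.one_ract]; exact Ne.symm ha)]
        rfl
      · simp [chi, hp]
  · rintro _ ⟨r, hr, rfl⟩ g v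
    by_cases hv : v = 1
    · have : (fun p : S3 × Z6 => if (pair.lact p.1 p.2)⁻¹ * p.2 = v then
          chi r (conjMap pair g p) else 0) = chi r ∘ conjMap pair g := by
        funext p
        by_cases hp : p.1 = 1
        · rw [if_pos (by rw [hp, hv, pair.one_lact, inv_mul_cancel])]
          rfl
        · simp [chi, hp, conjMap_fst_eq_one]
      rw [this]
      obtain ⟨m, hm | hm⟩ := conjMap_fst_one g
      · rw [chi_comp_conjMap (h6 r hr) hm]
        exact hcomb r hr m
      · rw [chi_comp_conjMap_inv (h6 r hr) hm]
        exact hcomb _ (hinv r hr) m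
    · convert Submodule.zero_mem _ with p
      by_cases hp : p.1 = 1
      · rw [if_neg (by rw [hp, pair.one_lact, inv_mul_cancel]; exact Ne.symm hv)]
        rfl
      · simp [chi, hp, conjMap_fst_eq_one]

/-- If a stable subspace has an element that is supported at the unit and not constant there, then
it contains a nontrivial character. -/
theorem FunStable.exists_chi_mem (hW : FunStable pair W) [CharZero k] {ζ : k}
    (hζ : IsPrimitiveRoot ζ 6) {f : S3 × Z6 → k} (hf : f ∈ W) (hf1 : ∀ p, p.1 ≠ 1 → f p = 0)
    (hf2 : f ∉ Submodule.span k {chi (1 : k)}) : ∃ r : k, r ^ 6 = 1 ∧ r ≠ 1 ∧ chi r ∈ W := by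
  let T : Module.End k (S3 × Z6 → k) := LinearMap.funLeft k k (shift u)
  let V : Submodule k (S3 × Z6 → k) :=
    { carrier := {f | (∀ p, p.1 ≠ 1 → f p = 0) ∧ ∑ v : Z6, f (1, v) = 0}
      add_mem' := fun hf hg => ⟨fun p hp => by rw [Pi.add_apply, hf.1 p hp, hg.1 p hp, add_zero],
        by simp only [Pi.add_apply]; rw [Finset.sum_add_distrib, hf.2, hg.2, add_zero]⟩
      zero_mem' := ⟨fun _ _ => rfl, by simp⟩
      smul_mem' := fun c f hf => ⟨fun p hp => by rw [Pi.smul_apply, hf.1 p hp, smul_zero],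
        by simp only [Pi.smul_apply]; rw [← Finset.smul_sum, hf.2, smul_zero]⟩ }
  have hsum : ∀ f : S3 × Z6 → k, ∑ v : Z6, T f (1, v) = ∑ v : Z6, f (1, v) := fun f =>
    Fintype.sum_equiv (Equiv.mulRight u) _ _ fun v => rfl
  have hTj : ∀ j f p, (T ^ j) f p = f (p.1, p.2 * u ^ j) := by
    intro j
    induction j with
    | zero => simp
    | succ j ih =>
      intro f p
      rw [pow_succ, Module.End.mul_apply, ih, pow_succ, ← mul_assoc]
      rfl
  -- Passing to T f − f removes the constant component: this vector is nonzero as f is not constant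
  -- on the fibre, and its sum over the fibre is 0, which rules out the eigenvalue 1.
  obtain ⟨r, hr, y, hy, hy0, hTy⟩ := T.exists_eigenvector_of_pow_eq (W := W ⊓ V) (n := 6)
    (fun x hx => ⟨FunStable.comp_shift hW hx.1 u, fun p hp => hx.2.1 _ hp,
      (hsum x).trans hx.2.2⟩) (by norm_num) hζ (x := T f - f)
    ⟨W.sub_mem (FunStable.comp_shift hW hf u) hf, fun p hp => by
      rw [Pi.sub_apply, hf1 p hp, sub_zero]
      exact hf1 _ hp, by
      simp only [Pi.sub_apply]
      rw [Finset.sum_sub_distrib, hsum, sub_self]⟩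
    (fun h => hf2 (by
      have h1 : f ∘ shift u = (1 : k) • f := by
        rw [one_smul]
        exact sub_eq_zero.1 h
      rw [eq_smul_chi hf1 h1]
      exact Submodule.smul_mem _ _ (Submodule.mem_span_singleton_self _)))
    (by
      funext p
      rw [hTj]
      have : u ^ 6 = 1 := by decide
      rw [this, mul_one])
  have h1 := eq_smul_chi hy.2.1 hTy
  have h2 : y (1, 1) ≠ 0 := fun h => hy0 (by rw [h1, h, zero_smul])
  refine ⟨r, hr, ?_, ?_⟩
  · rintro rfl
    have h3 := hy.2.2
    rw [h1] at h3
    simp only [Pi.smul_apply] at h3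
    rw [← Finset.smul_sum, sum_chi_one, smul_eq_mul] at h3
    exact mul_ne_zero h2 (by norm_num) h3
  · have h3 := hy.1
    rw [h1] at h3
    exact (W.smul_mem_iff h2).1 h3

end Chi

end S3Z6

/-! ### The seven minimal invariant subspaces. -/

namespace S3Z6
open HopfAlgebra Bicrossproduct

/-- The seven minimal stable subspaces, as spaces of functions. -/
def funSubspace {k : Type*} [Field k] (ζ : k) : Fin 7 → Submodule k (S3 × Z6 → k) :=
  ![Submodule.span k (chi '' {-1}), Submodule.span k (chi '' {ζ, ζ ^ 2, ζ ^ 4, ζ ^ 5}),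
    block 1 1, block 1 (ζ ^ 4), block 1 (ζ ^ 2), block 2 1, block 2 (-1)]

variable {k : Type*} [Field k] {ζ : k}

theorem pow_three_of_isPrimitiveRoot [CharZero k] (hζ : IsPrimitiveRoot ζ 6) : ζ ^ 3 = -1 := by
  have h : (ζ ^ 3) ^ 2 = 1 := by rw [← pow_mul, hζ.pow_eq_one]
  exact (sq_eq_one_iff.1 h).resolve_left (hζ.pow_ne_one_of_pos_of_lt (by norm_num) (by norm_num))

theorem mem_roots_iff [CharZero k] (hζ : IsPrimitiveRoot ζ 6) {r : k} (hr : r ^ 6 = 1) :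
    r = 1 ∨ r = -1 ∨ r ∈ ({ζ, ζ ^ 2, ζ ^ 4, ζ ^ 5} : Set k) := by
  obtain ⟨i, hi, rfl⟩ := hζ.eq_pow_of_pow_eq_one hr
  interval_cases i
  · simp
  · simp
  · simp
  · exact Or.inr (Or.inl (pow_three_of_isPrimitiveRoot hζ))
  · simp
  · simp

theorem roots_subset (hζ : IsPrimitiveRoot ζ 6) {r : k}
    (hr : r ∈ ({ζ, ζ ^ 2, ζ ^ 4, ζ ^ 5} : Set k)) : r ^ 6 = 1 ∧ r ^ 2 ≠ 1 := by
  have h6 := hζ.pow_eq_one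
  have h : ∀ n, 0 < n → n < 6 → ζ ^ n ≠ 1 := fun n h1 h2 =>
    hζ.pow_ne_one_of_pos_of_lt h1.ne' h2
  rcases hr with rfl | rfl | rfl | rfl
  · exact ⟨h6, h 2 (by norm_num) (by norm_num)⟩
  · exact ⟨by linear_combination (ζ ^ 6 + 1) * h6, fun h1 =>
      h 4 (by norm_num) (by norm_num) (by rw [← h1]; ring)⟩
  · exact ⟨by linear_combination (ζ ^ 18 + ζ ^ 12 + ζ ^ 6 + 1) * h6, fun h1 =>
      h 2 (by norm_num) (by norm_num) (by linear_combination h1 - ζ ^ 2 * h6)⟩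
  · exact ⟨by linear_combination (ζ ^ 24 + ζ ^ 18 + ζ ^ 12 + ζ ^ 6 + 1) * h6, fun h1 =>
      h 4 (by norm_num) (by norm_num) (by linear_combination h1 - ζ ^ 4 * h6)⟩

theorem roots_inv (hζ : IsPrimitiveRoot ζ 6) {r : k}
    (hr : r ∈ ({ζ, ζ ^ 2, ζ ^ 4, ζ ^ 5} : Set k)) :
    r⁻¹ ∈ ({ζ, ζ ^ 2, ζ ^ 4, ζ ^ 5} : Set k) := by
  have h6 := hζ.pow_eq_one
  have h : ∀ x y : k, x * y = 1 → x⁻¹ = y := fun x y h => inv_eq_of_mul_eq_one_right h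
  simp only [Set.mem_insert_iff, Set.mem_singleton_iff] at hr ⊢
  rcases hr with rfl | rfl | rfl | rfl
  · exact .inr (.inr (.inr (h _ _ (by rw [← h6]; ring))))
  · exact .inr (.inr (.inl (h _ _ (by rw [← h6]; ring))))
  · exact .inr (.inl (h _ _ (by rw [← h6]; ring)))
  · exact .inl (h _ _ (by rw [← h6]; ring))

theorem roots_neg [CharZero k] (hζ : IsPrimitiveRoot ζ 6) {r : k}
    (hr : r ∈ ({ζ, ζ ^ 2, ζ ^ 4, ζ ^ 5} : Set k)) :
    -r ∈ ({ζ, ζ ^ 2, ζ ^ 4, ζ ^ 5} : Set k) := by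
  have h3 := pow_three_of_isPrimitiveRoot hζ
  simp only [Set.mem_insert_iff, Set.mem_singleton_iff] at hr ⊢
  rcases hr with rfl | rfl | rfl | rfl
  · exact .inr (.inr (.inl (by linear_combination -r * h3)))
  · exact .inr (.inr (.inr (by linear_combination -ζ ^ 2 * h3)))
  · exact .inl (by linear_combination -ζ * h3)
  · exact .inr (.inl (by linear_combination -ζ ^ 2 * h3))

/-- Since ζ³ = −1, the set is {±ζ, ±ζ²} and ζ⁻¹ = −ζ², so negation and inversion act on it with one
orbit. -/
theorem roots_eq [CharZero k] (hζ : IsPrimitiveRoot ζ 6) {r x : k}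
    (hr : r ∈ ({ζ, ζ ^ 2, ζ ^ 4, ζ ^ 5} : Set k)) (hx : x ∈ ({ζ, ζ ^ 2, ζ ^ 4, ζ ^ 5} : Set k)) :
    x = r ∨ x = -r ∨ x = r⁻¹ ∨ x = -r⁻¹ := by
  have h3 := pow_three_of_isPrimitiveRoot hζ
  have h6 := hζ.pow_eq_one
  have h : ∀ x y : k, x * y = 1 → x⁻¹ = y := fun x y h => inv_eq_of_mul_eq_one_right h
  have e4 : ζ ^ 4 = -ζ := by linear_combination ζ * h3
  have e5 : ζ ^ 5 = -ζ ^ 2 := by linear_combination ζ ^ 2 * h3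
  have i1 : ζ⁻¹ = -ζ ^ 2 := h _ _ (by linear_combination -h3)
  have i2 : (ζ ^ 2)⁻¹ = -ζ := h _ _ (by linear_combination -h3)
  simp only [Set.mem_insert_iff, Set.mem_singleton_iff, e4, e5] at hr hx
  rcases hr with rfl | rfl | rfl | rfl <;> rcases hx with rfl | rfl | rfl | rfl <;>
    simp [i1, i2, inv_neg]

theorem funSubspace_funStable [CharZero k] (hζ : IsPrimitiveRoot ζ 6) (n : Fin 7) :
    FunStable pair (funSubspace ζ n) := by
  fin_cases n
  · exact funStable_span_chi (by rintro r rfl; norm_num) (by rintro r rfl; norm_num)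
      (by rintro r rfl; norm_num)
  · exact funStable_span_chi (fun r hr => (roots_subset hζ hr).1) (fun r hr => roots_inv hζ hr)
      (fun r hr _ => roots_neg hζ hr)
  all_goals exact block_funStable _ _

/-- A stable subspace which is not spanned by the counit contains one of the seven subspaces. -/
theorem FunStable.exists_funSubspace_le [CharZero k] (hζ : IsPrimitiveRoot ζ 6)
    {W : Submodule k (S3 × Z6 → k)}
    (hW : FunStable pair W) (h : ¬ W ≤ Submodule.span k {chi (1 : k)}) :
    ∃ n, funSubspace ζ n ≤ W := by
  obtain ⟨f, hf, hf1⟩ := SetLike.not_le_iff_exists.1 h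
  by_cases h0 : ∀ p, p.1 ≠ 1 → f p = 0
  · obtain ⟨r, hr, hr1, hrW⟩ := FunStable.exists_chi_mem hW hζ hf h0 hf1
    rcases mem_roots_iff hζ hr with h | rfl | hr'
    · exact absurd h hr1
    · refine ⟨0, Submodule.span_le.2 ?_⟩
      rintro _ ⟨_, rfl, rfl⟩
      exact hrW
    · refine ⟨1, Submodule.span_le.2 ?_⟩
      rintro _ ⟨x, hx, rfl⟩
      have hi := FunStable.chi_inv_mem hW hr hrW
      rcases roots_eq hζ hr' hx with rfl | rfl | rfl | rfl
      · exact hrW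
      · exact FunStable.chi_neg_mem hW hr (roots_subset hζ hr').2 hrW
      · exact hi
      · have h2 := roots_subset hζ (roots_inv hζ hr')
        exact FunStable.chi_neg_mem hW h2.1 h2.2 hi
  · push Not at h0
    obtain ⟨p, hp, hfp⟩ := h0
    rw [Ne, ← type_eq_zero_iff] at hp
    have h3 : type p.1 = 1 ∨ type p.1 = 2 := by
      generalize type p.1 = i at hp
      revert i
      decide
    rcases h3 with h3 | h3
    -- The cube roots of unity are the powers of ζ². Exponent 2 gives ζ⁴, which precedes ζ² in the
    -- list, hence the order of the indices below.
    · have hω : IsPrimitiveRoot (ζ ^ 2) 3 := hζ.pow (by norm_num) (by norm_num)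
      obtain ⟨q, hq, hqW⟩ := FunStable.exists_block_le hW (by decide) (by norm_num)
        iterate_twist_type_one hω hf h3 hfp
      obtain ⟨i, hi, rfl⟩ := hω.eq_pow_of_pow_eq_one hq
      interval_cases i
      · exact ⟨2, by simpa [funSubspace] using hqW⟩
      · exact ⟨4, by simpa [funSubspace] using hqW⟩
      · exact ⟨3, by rw [← pow_mul] at hqW; simpa [funSubspace] using hqW⟩
    · obtain ⟨q, hq, hqW⟩ := FunStable.exists_block_le hW (by decide) (by norm_num)
        iterate_twist_type_two (IsPrimitiveRoot.neg_one 0 (by norm_num)) hf h3 hfp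
      rcases sq_eq_one_iff.1 hq with rfl | rfl
      · exact ⟨5, hqW⟩
      · exact ⟨6, hqW⟩

end S3Z6

/-! ### Bases of characters and of twist orbits. -/

namespace S3Z6
open HopfAlgebra Bicrossproduct

section
variable {k : Type*} [Field k]

/-- These are eigenvectors of the shift by `u` with distinct eigenvalues. -/
theorem linearIndependent_chi {ι : Type*} {r : ι → k} (hr : Function.Injective r)
    (h6 : ∀ i, r i ^ 6 = 1) : LinearIndependent k fun i => chi (r i) := by
  refine Module.End.eigenvectors_linearIndependent' (LinearMap.funLeft k k (shift u)) r hr _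
    fun i => ⟨Module.End.mem_eigenspace_iff.2 ?_, fun h => ?_⟩
  · have := chi_comp_shift (h6 i) u
    rwa [show u.toAdd.val = 1 from rfl, pow_one] at this
  · have := congrFun h (1, 1)
    simp [chi] at this

theorem mem_of_chi_mem_span {R : Set k} (hR : ∀ r ∈ R, r ^ 6 = 1) {r : k} (hr : r ^ 6 = 1)
    (h : chi r ∈ Submodule.span k (chi '' R)) : r ∈ R := by
  by_contra hrR
  have hli := linearIndependent_chi (r := fun x : {r : k | r ^ 6 = 1} => x.1)
    Subtype.val_injective fun x => x.2
  refine hli.notMem_span_image (s := {x | x.1 ∈ R}) (x := ⟨r, hr⟩) hrR ?_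
  convert h using 2
  ext f
  constructor
  · rintro ⟨x, hx, rfl⟩
    exact ⟨x.1, hx, rfl⟩
  · rintro ⟨x, hx, rfl⟩
    exact ⟨⟨x, hR x hx⟩, hx, rfl⟩

theorem span_chi_apply {R : Set k} {f : S3 × Z6 → k} (hf : f ∈ Submodule.span k (chi '' R))
    {p : S3 × Z6} (hp : p.1 ≠ 1) : f p = 0 := by
  have : Submodule.span k (chi '' R) ≤ LinearMap.ker (LinearMap.proj (R := k) p) := by
    refine Submodule.span_le.2 ?_
    rintro _ ⟨r, _, rfl⟩
    exact if_neg hp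
  exact this hf

/-- The function supported on the orbit of `p` under the twist that takes the value `q ^ j` at the
`j`-th point. -/
def orb (q : k) (n : ℕ) (p : S3 × Z6) : S3 × Z6 → k :=
  ∑ j ∈ Finset.range n, q ^ j • Pi.single (twist^[j] p) 1

theorem twist_injective : Function.Injective twist := by decide

theorem orb_apply (q : k) (n : ℕ) (p p' : S3 × Z6) :
    orb q n p p' = ∑ j ∈ Finset.range n, if p' = twist^[j] p then q ^ j else 0 := by
  rw [orb, Finset.sum_apply]
  refine Finset.sum_congr rfl fun j _ => ?_
  rw [Pi.smul_apply, Pi.single_apply, smul_eq_mul, mul_ite, mul_one, mul_zero]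

theorem orb_mem {q : k} {n : ℕ} {i : Fin 3} {p : S3 × Z6} (hq : q ^ n = 1)
    (hp : twist^[n] p = p) (hi : type p.1 = i) : orb q n p ∈ block i q := by
  have htype : ∀ j, type (twist^[j] p).1 = i := by
    intro j
    induction j with
    | zero => exact hi
    | succ j ih => rwa [Function.iterate_succ_apply', type_twist]
  refine ⟨fun p' hp' => ?_, fun p' => ?_⟩
  · rw [orb_apply]
    refine Finset.sum_eq_zero fun j _ => if_neg ?_
    rintro rfl
    exact hp' (htype j)
  · rw [orb_apply, orb_apply, Finset.mul_sum]
    -- The sum over n + 1 terms is split at either end. The end terms agree because qⁿ = 1 and the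
    -- orbit closes up, which gives the cyclic reindexing.
    have h1 := Finset.sum_range_succ (fun j => if twist p' = twist^[j] p then q ^ j else 0) n
    rw [Finset.sum_range_succ', hp, hq] at h1
    simp only [Function.iterate_zero, id, pow_zero] at h1
    rw [← add_right_cancel h1]
    refine Finset.sum_congr rfl fun j _ => ?_
    rw [Function.iterate_succ_apply', mul_ite, mul_zero, ← pow_succ']
    exact if_congr twist_injective.eq_iff rfl rfl

/-- Evaluations at the representatives are dual to the orbit functions, and a member of the block
that vanishes at all representatives is zero. The hypothesis `hrep2` says that distinct
representatives have distinct orbits and that every orbit has full length n. -/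
theorem block_basis {ι : Type*} [Finite ι] {i : Fin 3} {n : ℕ} {q : k} (hq : q ^ n = 1)
    (hn : 0 < n) (hi : ∀ p : S3 × Z6, type p.1 = i → twist^[n] p = p) {rep : ι → S3 × Z6}
    (hrep : ∀ a, type (rep a).1 = i)
    (hrep2 : ∀ a b, ∀ j < n, rep b = twist^[j] (rep a) → a = b ∧ j = 0)
    (hrep3 : ∀ p : S3 × Z6, type p.1 = i → ∃ a, ∃ j, p = twist^[j] (rep a)) :
    LinearIndependent k (fun a => orb q n (rep a)) ∧
      Submodule.span k (Set.range fun a => orb q n (rep a)) = block i q := by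
  classical
  have := Fintype.ofFinite ι
  have hmem : ∀ a, orb q n (rep a) ∈ block i q := fun a =>
    orb_mem hq (hi _ (hrep a)) (hrep a)
  have hval : ∀ a b, orb q n (rep a) (rep b) = if a = b then 1 else 0 := by
    intro a b
    rw [orb_apply, Finset.sum_eq_single 0]
    · refine if_congr ⟨fun h => (hrep2 a b 0 hn h).1, ?_⟩ (pow_zero q) rfl
      rintro rfl
      rfl
    · exact fun j hj hj0 => if_neg fun h => hj0 (hrep2 a b j (Finset.mem_range.1 hj) h).2
    · simp [hn.ne']
  have hsum : ∀ (c : ι → k) b, (∑ a, c a • orb q n (rep a)) (rep b) = c b := by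
    intro c b
    simp [Finset.sum_apply, hval]
  refine ⟨Fintype.linearIndependent_iff.2 fun c hc b => ?_, le_antisymm ?_ ?_⟩
  · rw [← hsum c b, hc]
    rfl
  · refine Submodule.span_le.2 ?_
    rintro _ ⟨a, rfl⟩
    exact hmem a
  · intro f hf
    have h1 : f = ∑ a, f (rep a) • orb q n (rep a) := by
      have h2 : f - ∑ a, f (rep a) • orb q n (rep a) ∈ block i q :=
        Submodule.sub_mem _ hf (Submodule.sum_mem _ fun a _ => Submodule.smul_mem _ _ (hmem a))
      refine sub_eq_zero.1 (funext fun p => ?_)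
      by_cases hp : type p.1 = i
      · obtain ⟨a, j, rfl⟩ := hrep3 p hp
        rw [block_iterate h2, Pi.sub_apply, hsum, sub_self, mul_zero]
        rfl
      · exact h2.1 p hp
    rw [h1]
    exact Submodule.sum_mem _ fun a _ =>
      Submodule.smul_mem _ _ (Submodule.subset_span ⟨a, rfl⟩)

/-- Representatives of the orbits of the twist for the rotations. -/
def repT : Fin 4 → S3 × Z6 := ![(t ^ 2, 1), (t, 1), (t ^ 2, u), (t, u ^ 5)]

/-- Representatives of the orbits of the twist for the reflections. -/
def repS : Fin 9 → S3 × Z6 :=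
  ![(s, 1), (s, u ^ 2), (s, u), (s * t, 1), (s * t, u ^ 2), (s * t, u ^ 4), (s * t ^ 2, 1),
    (s * t, u ^ 3), (s * t, u ^ 5)]

theorem block_basis_one {q : k} (hq : q ^ 3 = 1) :
    LinearIndependent k (fun a => orb q 3 (repT a)) ∧
      Submodule.span k (Set.range fun a => orb q 3 (repT a)) = block 1 q := by
  have h3 : ∀ p : S3 × Z6, type p.1 = 1 → ∃ a, ∃ j : Fin 3, p = twist^[j] (repT a) := by decide
  exact block_basis hq (by norm_num) iterate_twist_type_one (by decide) (by decide)
    fun p hp => (h3 p hp).imp fun a ⟨j, hj⟩ => ⟨j, hj⟩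

theorem block_basis_two {q : k} (hq : q ^ 2 = 1) :
    LinearIndependent k (fun a => orb q 2 (repS a)) ∧
      Submodule.span k (Set.range fun a => orb q 2 (repS a)) = block 2 q := by
  have h3 : ∀ p : S3 × Z6, type p.1 = 2 → ∃ a, ∃ j : Fin 2, p = twist^[j] (repS a) := by decide
  exact block_basis hq (by norm_num) iterate_twist_type_two (by decide) (by decide)
    fun p hp => (h3 p hp).imp fun a ⟨j, hj⟩ => ⟨j, hj⟩

/-! ### The subspaces of the list -/

theorem ofFun_single (p : S3 × Z6) :
    ofFun k pair (Pi.single p 1) = elt (k := k) p.2 p.1 := by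
  refine Bicrossproduct.hom_ext fun m v => ?_
  rw [ofFun_δ, elt, δ]
  simp [Finsupp.single_apply, Pi.single_apply]

theorem ofFun_orb (q : k) (n : ℕ) (p : S3 × Z6) : ofFun k pair (orb q n p) =
    ∑ j ∈ Finset.range n, q ^ j • elt (k := k) (twist^[j] p).2 (twist^[j] p).1 := by
  rw [orb, map_sum]
  simp only [map_smul, ofFun_single]

theorem basisT_eq (q : k) : basisT q = fun i => ofFun k pair (orb q 3 (repT i)) := by
  funext i
  rw [ofFun_orb, Finset.sum_range_succ, Finset.sum_range_succ, Finset.sum_range_one, pow_zero,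
    one_smul, pow_one]
  -- Over t the twist multiplies by u⁻², so the second and fourth orbits are traversed opposite to
  -- the order in which `basisT` writes their last two terms.
  fin_cases i
  · rfl
  · exact add_right_comm _ _ _
  · rfl
  · exact add_right_comm _ _ _

theorem basisS_eq (q : k) : basisS q = fun i => ofFun k pair (orb q 2 (repS i)) := by
  funext i
  rw [ofFun_orb, Finset.sum_range_succ, Finset.sum_range_one, pow_zero, one_smul, pow_one]
  fin_cases i <;> rfl

theorem ofFun_chi (r : k) : ofFun k pair (chi r) =
    elt 1 1 + r • elt u 1 + r ^ 2 • elt (u ^ 2) 1 + r ^ 3 • elt (u ^ 3) 1 +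
      r ^ 4 • elt (u ^ 4) 1 + r ^ 5 • elt (u ^ 5) 1 := by
  have h : chi r = ∑ j : Fin 6, r ^ j.val • Pi.single (1, u ^ j.val) (1 : k) := by
    funext ⟨m, v⟩
    simp only [Finset.sum_apply, Pi.smul_apply, Pi.single_apply, chi, smul_eq_mul, mul_ite,
      mul_one, mul_zero, Prod.mk.injEq]
    by_cases hm : m = 1
    · have hv : ∀ (v : Z6) (j : Fin 6), v = u ^ j.val ↔ j = ⟨v.toAdd.val, ZMod.val_lt _⟩ := by
        decide
      simp [hm, hv]
    · simp [hm]
  rw [h, map_sum, Fin.sum_univ_six]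
  simp only [map_smul, ofFun_single]
  simp

end
end S3Z6

/-! ### The listed subspaces modulo the counit. -/

namespace S3Z6
open HopfAlgebra Bicrossproduct

section
variable {k : Type*} [Field k]

/-- The counit is the trivial character. It spans the direction that `proj` forgets, so comparisons
below are made modulo `chi 1`. -/
theorem counit_eq_ofFun : Coalgebra.counit (R := k) (A := Bicrossproduct k pair) =
    ofFun k pair (chi 1) := by
  refine Bicrossproduct.hom_ext fun m v => ?_
  rw [ofFun_δ, counit_δ, chi, one_pow]

variable {ζ : k}

theorem exists_basis_funSubspace [CharZero k] (hζ : IsPrimitiveRoot ζ 6) (n : Fin 7) :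
    ∃ b : Fin ((![1, 4, 4, 4, 4, 9, 9] : Fin 7 → ℕ) n) → S3 × Z6 → k, LinearIndependent k b ∧
      Submodule.span k (Set.range b) = funSubspace ζ n ∧
      subspace ζ n = (funSubspace ζ n).map (ofFun k pair).toLinearMap := by
  have h6 := hζ.pow_eq_one
  have h3 := pow_three_of_isPrimitiveRoot hζ
  have key : ∀ {d : ℕ} {b : Fin d → S3 × Z6 → k} {V : Submodule k (S3 × Z6 → k)}
      {e : Fin d → Module.Dual k (Bicrossproduct k pair)},
      (LinearIndependent k b ∧ Submodule.span k (Set.range b) = V) →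
      e = (fun i => ofFun k pair (b i)) →
      ∃ b : Fin d → S3 × Z6 → k, LinearIndependent k b ∧ Submodule.span k (Set.range b) = V ∧
        Submodule.span k (Set.range e) = V.map (ofFun k pair).toLinearMap := by
    rintro d b V e ⟨h1, h2⟩ rfl
    refine ⟨b, h1, h2, ?_⟩
    rw [← h2, Submodule.map_span, ← Set.range_comp]
    rfl
  fin_cases n
  · refine key (d := 1) (b := fun _ => chi (-1)) ⟨?_, ?_⟩ ?_
    · exact linearIndependent_chi (r := fun _ : Fin 1 => (-1 : k))
        (Function.injective_of_subsingleton _) fun _ => by norm_num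
    · rw [Set.range_const, ← Set.image_singleton]
      rfl
    · funext i
      rw [ofFun_chi]
      fin_cases i
      simp only [basisSign, Fin.zero_eta, Matrix.cons_val_fin_one]
      module
  · refine key (b := fun i => chi (![ζ, ζ ^ 2, ζ ^ 4, ζ ^ 5] i)) ⟨?_, ?_⟩ ?_
    · refine linearIndependent_chi (r := ![ζ, ζ ^ 2, ζ ^ 4, ζ ^ 5]) ?_ fun i => ?_
      · have h : ∀ i : Fin 4, ![ζ, ζ ^ 2, ζ ^ 4, ζ ^ 5] i = ζ ^ (![1, 2, 4, 5] : Fin 4 → ℕ) i := by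
          intro i
          fin_cases i <;> simp
        intro i j hij
        rw [h, h] at hij
        have hlt : ∀ i : Fin 4, (![1, 2, 4, 5] : Fin 4 → ℕ) i < 6 := by decide
        have hinj : Function.Injective (![1, 2, 4, 5] : Fin 4 → ℕ) := by decide
        exact hinj (hζ.pow_inj (hlt i) (hlt j) hij)
      · fin_cases i
        · exact (roots_subset hζ (by simp)).1
        · exact (roots_subset hζ (by simp)).1
        · exact (roots_subset hζ (by simp)).1
        · exact (roots_subset hζ (by simp)).1
    · have : Set.range (fun i => chi ((![ζ, ζ ^ 2, ζ ^ 4, ζ ^ 5] : Fin 4 → k) i)) =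
          chi '' {ζ, ζ ^ 2, ζ ^ 4, ζ ^ 5} := by
        rw [show (fun i => chi ((![ζ, ζ ^ 2, ζ ^ 4, ζ ^ 5] : Fin 4 → k) i)) =
          chi ∘ ![ζ, ζ ^ 2, ζ ^ 4, ζ ^ 5] from rfl, Set.range_comp]
        congr 1
        simp only [Matrix.range_cons, Matrix.range_empty, Set.union_empty, Set.singleton_union]
      rw [this]
      rfl
    -- With ζ³ = −1 every power that occurs reduces to one of ±1, ±ζ, ±ζ², the shape used in
    -- `basisChar`.
    · have e4 : ζ ^ 4 = -ζ := by linear_combination ζ * h3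
      have e5 : ζ ^ 5 = -ζ ^ 2 := by linear_combination ζ ^ 2 * h3
      have e8 : ζ ^ 8 = ζ ^ 2 := by linear_combination ζ ^ 2 * h6
      have e10 : ζ ^ 10 = -ζ := by linear_combination ζ ^ 4 * h6 + e4
      have e12 : ζ ^ 12 = 1 := by linear_combination (ζ ^ 6 + 1) * h6
      have e15 : ζ ^ 15 = -1 := by linear_combination ζ ^ 3 * e12 + h3
      have e16 : ζ ^ 16 = -ζ := by linear_combination ζ ^ 4 * e12 + e4
      have e20 : ζ ^ 20 = ζ ^ 2 := by linear_combination ζ ^ 8 * e12 + e8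
      have e25 : ζ ^ 25 = ζ := by linear_combination (ζ ^ 13 + ζ) * e12
      have cf : ∀ r a2 a3 a4 a5 : k, r ^ 2 = a2 → r ^ 3 = a3 → r ^ 4 = a4 → r ^ 5 = a5 →
          ofFun k pair (chi r) = elt 1 1 + r • elt u 1 + a2 • elt (u ^ 2) 1 + a3 • elt (u ^ 3) 1 +
            a4 • elt (u ^ 4) 1 + a5 • elt (u ^ 5) 1 := by
        rintro r _ _ _ _ rfl rfl rfl rfl
        exact ofFun_chi r
      have q (m n : ℕ) : (ζ ^ m) ^ n = ζ ^ (m * n) := (pow_mul ζ m n).symm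
      funext i
      fin_cases i
      · refine Eq.trans ?_ (cf ζ (ζ ^ 2) (-1) (-ζ) (-ζ ^ 2) rfl h3 e4 e5).symm
        simp only [basisChar, Fin.zero_eta, Matrix.cons_val_zero]
        module
      · refine Eq.trans ?_ (cf (ζ ^ 2) (-ζ) 1 (ζ ^ 2) (-ζ) ((q _ _).trans e4) ((q _ _).trans h6)
          ((q _ _).trans e8) ((q _ _).trans e10)).symm
        simp only [basisChar, Fin.mk_one, Matrix.cons_val_one, Matrix.cons_val_zero]
        module
      · refine Eq.trans ?_ (cf (ζ ^ 4) (ζ ^ 2) 1 (-ζ) (ζ ^ 2) ((q _ _).trans e8) ((q _ _).trans e12)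
          ((q _ _).trans e16) ((q _ _).trans e20)).symm
        simp only [basisChar, Fin.reduceFinMk, Matrix.cons_val, e4]
        module
      · refine Eq.trans ?_ (cf (ζ ^ 5) (-ζ) (-1) (ζ ^ 2) ζ ((q _ _).trans e10) ((q _ _).trans e15)
          ((q _ _).trans e20) ((q _ _).trans e25)).symm
        simp only [basisChar, Fin.reduceFinMk, Matrix.cons_val, e5]
        module
  · exact key (block_basis_one (one_pow 3)) (basisT_eq 1)
  · exact key (block_basis_one (by rw [← pow_mul, show 4 * 3 = 6 * 2 from rfl, pow_mul, h6,
    one_pow]))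
      (basisT_eq _)
  · exact key (block_basis_one (by rw [← pow_mul, h6])) (basisT_eq _)
  · exact key (block_basis_two (one_pow 2)) (basisS_eq 1)
  · exact key (block_basis_two (by norm_num)) (basisS_eq _)

theorem subspace_eq [CharZero k] (hζ : IsPrimitiveRoot ζ 6) (n : Fin 7) :
    subspace ζ n = (funSubspace ζ n).map (ofFun k pair).toLinearMap :=
  (exists_basis_funSubspace hζ n).choose_spec.2.2

theorem funSubspace_ne_bot [CharZero k] (hζ : IsPrimitiveRoot ζ 6) (n : Fin 7) : funSubspace ζ n ≠
    ⊥ := by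
  obtain ⟨b, hb, hb', -⟩ := exists_basis_funSubspace hζ n
  have h0 : ∀ n, 0 < (![1, 4, 4, 4, 4, 9, 9] : Fin 7 → ℕ) n := by decide
  rw [← hb']
  exact fun h => hb.ne_zero ⟨0, h0 n⟩ ((Submodule.eq_bot_iff _).1 h _
    (Submodule.subset_span ⟨_, rfl⟩))

/-- Nontrivial characters sum to zero and blocks vanish over the unit. The counit has sum 6, so none
of the subspaces meets its line. -/
theorem sum_funSubspace [CharZero k] (hζ : IsPrimitiveRoot ζ 6) {n : Fin 7} {f : S3 × Z6 → k}
    (hf : f ∈ funSubspace ζ n) : ∑ v : Z6, f (1, v) = 0 := by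
  have hspan : ∀ {R : Set k}, (∀ r ∈ R, r ^ 6 = 1 ∧ r ≠ 1) →
      f ∈ Submodule.span k (chi '' R) → ∑ v : Z6, f (1, v) = 0 := by
    intro R hR hf
    have : Submodule.span k (chi '' R) ≤
        LinearMap.ker (∑ v : Z6, LinearMap.proj (R := k) (φ := fun _ => k) ((1, v) : S3 × Z6)) := by
      refine Submodule.span_le.2 ?_
      rintro _ ⟨r, hr, rfl⟩
      rw [SetLike.mem_coe, LinearMap.mem_ker, LinearMap.sum_apply]
      exact sum_chi (hR r hr).1 (hR r hr).2
    have h := this hf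
    rwa [LinearMap.mem_ker, LinearMap.sum_apply] at h
  have hblock : ∀ {i : Fin 3} {q : k}, i ≠ 0 → f ∈ block i q → ∑ v : Z6, f (1, v) = 0 :=
    fun hi hf => Finset.sum_eq_zero fun v _ => hf.1 (1, v) (Ne.symm hi)
  fin_cases n
  · exact hspan (by rintro r rfl; norm_num) hf
  · refine hspan (fun r hr => ⟨(roots_subset hζ hr).1, ?_⟩) hf
    rintro rfl
    exact (roots_subset hζ hr).2 (one_pow 2)
  · exact hblock (i := 1) (by decide) hf
  · exact hblock (i := 1) (by decide) hf
  · exact hblock (i := 1) (by decide) hf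
  · exact hblock (i := 2) (by decide) hf
  · exact hblock (i := 2) (by decide) hf

theorem disjoint_funSubspace [CharZero k] (hζ : IsPrimitiveRoot ζ 6) (n : Fin 7) :
    Disjoint (funSubspace ζ n) (Submodule.span k {chi (1 : k)}) := by
  rw [Submodule.disjoint_def]
  intro f hf hf1
  obtain ⟨c, rfl⟩ := Submodule.mem_span_singleton.1 hf1
  have h := sum_funSubspace hζ hf
  simp only [Pi.smul_apply] at h
  rw [← Finset.smul_sum, sum_chi_one, smul_eq_mul] at h
  rw [(mul_eq_zero.1 h).resolve_right (by norm_num), zero_smul]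

/-- Off the unit the counit vanishes, so type and eigenvalue can be read from f at a point p with f
p ≠ 0 and at `twist p`. -/
theorem eq_of_mem_block {i i' : Fin 3} {q q' : k} {f : S3 × Z6 → k} (hi : i ≠ 0)
    (hf : f ∈ block i q) (hf0 : f ≠ 0)
    (hf' : f ∈ block i' q' ⊔ Submodule.span k {chi (1 : k)}) : i = i' ∧ q = q' := by
  obtain ⟨g, hg, h, hh, rfl⟩ := Submodule.mem_sup.1 hf'
  rw [← Set.image_singleton] at hh
  obtain ⟨p, hp⟩ := Function.ne_iff.1 hf0
  have hpi : type p.1 = i := by_contra fun h => hp (hf.1 p h)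
  have hp1 : p.1 ≠ 1 := by rwa [Ne, ← type_eq_zero_iff, hpi]
  have hp2 : (twist p).1 ≠ 1 := by rwa [Ne, ← type_eq_zero_iff, type_twist, hpi]
  rw [Pi.add_apply, span_chi_apply hh hp1, add_zero] at hp
  have hpi' : type p.1 = i' := by_contra fun h => hp (hg.1 p h)
  refine ⟨hpi.symm.trans hpi', ?_⟩
  have h2 := hf.2 p
  rw [Pi.add_apply, Pi.add_apply, span_chi_apply hh hp1, span_chi_apply hh hp2, add_zero,
    add_zero, hg.2] at h2
  exact (mul_right_cancel₀ hp h2).symm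

/-- Over the unit the block part vanishes, so the character would be constant there. -/
theorem chi_notMem_block {i : Fin 3} {q r : k} (hi : i ≠ 0) (hr : r ≠ 1) :
    chi r ∉ block i q ⊔ Submodule.span k {chi (1 : k)} := by
  intro h
  obtain ⟨g, hg, h, hh, hgh⟩ := Submodule.mem_sup.1 h
  obtain ⟨c, rfl⟩ := Submodule.mem_span_singleton.1 hh
  have h0 := congrFun hgh (1, 1)
  have h1 := congrFun hgh (1, u)
  have e : u.toAdd.val = 1 := rfl
  rw [Pi.add_apply, hg.1 (1, _) (Ne.symm hi)] at h0 h1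
  simp [chi, e] at h0 h1
  exact hr (h1.symm.trans h0)

theorem eq_of_funSubspace_le [CharZero k] (hζ : IsPrimitiveRoot ζ 6) {m n : Fin 7}
    (h : funSubspace ζ m ≤ funSubspace ζ n ⊔ Submodule.span k {chi (1 : k)}) : m = n := by
  have hpow : ∀ n, 0 < n → n < 6 → ζ ^ n ≠ 1 := fun n h1 h2 =>
    hζ.pow_ne_one_of_pos_of_lt h1.ne' h2
  have h2 := hpow 2 (by norm_num) (by norm_num)
  have h4 := hpow 4 (by norm_num) (by norm_num)
  have h24 : ζ ^ 4 ≠ ζ ^ 2 := fun h => absurd (hζ.pow_inj (by norm_num) (by norm_num) h)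
    (by norm_num)
  have hζ1 : ζ ≠ 1 := by simpa using hpow 1 (by norm_num) (by norm_num)
  have hm1 : (-1 : k) ≠ 1 := by norm_num
  have hRζ : ζ ∈ ({ζ, ζ ^ 2, ζ ^ 4, ζ ^ 5} : Set k) := by simp
  have hbb : ∀ {i i' : Fin 3} {q q' : k}, i ≠ 0 → block i q ≠ ⊥ →
      block i q ≤ block i' q' ⊔ Submodule.span k {chi (1 : k)} → i = i' ∧ q = q' := by
    intro i i' q q' hi hne hle
    obtain ⟨f, hf, hf0⟩ := Submodule.exists_mem_ne_zero_of_ne_bot hne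
    exact eq_of_mem_block hi hf hf0 (hle hf)
  have hbs : ∀ {i : Fin 3} {q : k} {R : Set k}, i ≠ 0 → block i q ≠ ⊥ →
      ¬ block i q ≤ Submodule.span k (chi '' R) ⊔ Submodule.span k {chi (1 : k)} := by
    intro i q R hi hne hle
    obtain ⟨f, hf, hf0⟩ := Submodule.exists_mem_ne_zero_of_ne_bot hne
    apply hf0
    funext p
    by_cases hp : p.1 = 1
    · exact hf.1 p (by rw [(type_eq_zero_iff _).2 hp]; exact hi.symm)
    · have := hle hf
      rw [← Set.image_singleton, ← Submodule.span_union, ← Set.image_union] at this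
      exact span_chi_apply this hp
  have hsb : ∀ {i : Fin 3} {q r : k} {R : Set k}, i ≠ 0 → r ∈ R → r ≠ 1 →
      ¬ Submodule.span k (chi '' R) ≤ block i q ⊔ Submodule.span k {chi (1 : k)} :=
    fun hi hr hr1 hle => chi_notMem_block hi hr1 (hle (Submodule.subset_span ⟨_, hr, rfl⟩))
  have hss : ∀ {r : k} {R S : Set k}, r ∈ R → r ^ 6 = 1 → r ≠ 1 → (∀ x ∈ S, x ^ 6 = 1) →
      Submodule.span k (chi '' R) ≤ Submodule.span k (chi '' S) ⊔ Submodule.span k {chi (1 : k)} →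
      r ∈ S := by
    intro r R S hr hr6 hr1 hS hle
    rw [← Set.image_singleton (a := (1 : k)), ← Submodule.span_union, ← Set.image_union] at hle
    refine (mem_of_chi_mem_span ?_ hr6 (hle (Submodule.subset_span ⟨_, hr, rfl⟩))).resolve_right hr1
    rintro x (hx | rfl)
    · exact hS x hx
    · exact one_pow 6
  -- Type and twist eigenvalue of each block. Type 0 marks the two character subspaces, whose
  -- entries in `qI` are dummies.
  let tI : Fin 7 → Fin 3 := ![0, 0, 1, 1, 1, 2, 2]
  let qI : Fin 7 → k := ![0, 0, 1, ζ ^ 4, ζ ^ 2, 1, -1]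
  have hB : ∀ n, n = 0 ∨ n = 1 ∨ (tI n ≠ 0 ∧ funSubspace ζ n = block (tI n) (qI n)) := by
    intro n
    fin_cases n
    · exact Or.inl rfl
    · exact Or.inr (Or.inl rfl)
    all_goals exact Or.inr (Or.inr ⟨by decide, rfl⟩)
  have hinj : ∀ m n, tI m ≠ 0 → tI m = tI n → qI m = qI n → m = n := by
    have hI : ∀ m n, tI m ≠ 0 → tI m = tI n → m = n ∨
        (m, n) ∈ ({(2, 3), (2, 4), (3, 2), (3, 4), (4, 2), (4, 3), (5, 6), (6, 5)} :
          Finset (Fin 7 × Fin 7)) := by decide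
    intro m n hm hmn hq
    refine (hI m n hm hmn).resolve_right fun h => ?_
    simp only [Finset.mem_insert, Finset.mem_singleton, Prod.mk.injEq] at h
    rcases h with ⟨rfl, rfl⟩ | ⟨rfl, rfl⟩ | ⟨rfl, rfl⟩ | ⟨rfl, rfl⟩ | ⟨rfl, rfl⟩ | ⟨rfl, rfl⟩ |
      ⟨rfl, rfl⟩ | ⟨rfl, rfl⟩
    exacts [h4 hq.symm, h2 hq.symm, h4 hq, h24 hq, h2 hq, h24 hq.symm, hm1 hq.symm, hm1 hq]
  have hne := funSubspace_ne_bot hζ m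
  rcases hB m with rfl | rfl | ⟨hm, hmB⟩ <;> rcases hB n with rfl | rfl | ⟨hn, hnB⟩
  · rfl
  · exact absurd (roots_subset hζ (hss (r := -1) (Set.mem_singleton _) (by norm_num) hm1
      (fun x hx => (roots_subset hζ hx).1) h)).2 (by norm_num)
  · rw [hnB] at h
    exact absurd h (hsb hn rfl hm1)
  · have := hss hRζ hζ.pow_eq_one hζ1 (by rintro x rfl; norm_num) h
    rw [Set.mem_singleton_iff] at this
    exact absurd (by rw [this]; norm_num) h2
  · rfl
  · rw [hnB] at h
    exact absurd h (hsb hn hRζ hζ1)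
  · rw [hmB] at h hne
    exact absurd h (hbs hm hne)
  · rw [hmB] at h hne
    exact absurd h (hbs hm hne)
  · rw [hmB] at h hne
    rw [hnB] at h
    obtain ⟨h1, h2⟩ := hbb hm hne h
    exact hinj m n hm h1 h2

end
end S3Z6

namespace HopfAlgebra
variable {k A : Type*} [Field k] [Ring A] [HopfAlgebra k A]

theorem dualAct_add (x y : Module.Dual k A) (a : A) :
    dualAct (x + y) a = dualAct x a + dualAct y a := by
  obtain ⟨r⟩ : Nonempty (Coalgebra.Repr k a (A × A)) := ⟨Coalgebra.Repr.arbitrary k a⟩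
  simp only [dualAct_eq_sum _ r, LinearMap.add_apply, add_smul, Finset.sum_add_distrib]

theorem dualAct_smul (c : k) (x : Module.Dual k A) (a : A) :
    dualAct (c • x) a = c • dualAct x a := by
  obtain ⟨r⟩ : Nonempty (Coalgebra.Repr k a (A × A)) := ⟨Coalgebra.Repr.arbitrary k a⟩
  simp only [dualAct_eq_sum _ r, LinearMap.smul_apply, smul_assoc, Finset.smul_sum]

theorem dualAct_augProj (x : Module.Dual k A) (a : A) :
    dualAct (augProj k A x) a = dualAct x a - x 1 • a := by
  rw [augProj_apply, dualAct_sub_smul, dualAct_counit]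

end HopfAlgebra

/-! ### The tangent spaces of the list and their cohomology. -/

namespace S3Z6
open HopfAlgebra Bicrossproduct

section
variable {k : Type*} [Field k]

instance : FiniteDimensional k (Bicrossproduct k pair) := Module.Basis.finiteDimensional_of_finite
    (basis k pair)

/-- A nonzero tangent space contains one of the seven subspaces of the list. -/
theorem exists_map_proj_le [CharZero k] {ζ : k} (hζ : IsPrimitiveRoot ζ 6)
    {L : Submodule k (Module.Dual k (Bicrossproduct k pair))} (hL : IsTangentSpace L)
    (hL0 : L ≠ ⊥) : ∃ n, (subspace ζ n).map proj ≤ L := by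
  obtain ⟨x, hx, hx0⟩ := Submodule.exists_mem_ne_zero_of_ne_bot hL0
  -- The preimage of `L` under `augProj` is the invariant subspace to look at. Were it contained in
  -- the counit line, x would be a multiple of ε with x(1) = 0.
  obtain ⟨n, hn⟩ := FunStable.exists_funSubspace_le hζ hL.isStable_comap.funStable (fun h => by
    obtain ⟨f, rfl⟩ := (ofFun k pair).surjective x
    have hx1 := hL.map_one _ hx
    have hf : f ∈ (L.comap (augProj k _)).comap (ofFun k pair).toLinearMap := by
      change augProj k _ (ofFun k pair f) ∈ L
      rwa [augProj_of_map_one hx1]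
    obtain ⟨c, rfl⟩ := Submodule.mem_span_singleton.1 (h hf)
    rw [map_smul, ← counit_eq_ofFun] at hx1 hx0
    rw [LinearMap.smul_apply, Bialgebra.counit_one, smul_eq_mul, mul_one] at hx1
    exact hx0 (by rw [hx1, zero_smul]))
  refine ⟨n, ?_⟩
  rw [subspace_eq hζ]
  rintro _ ⟨_, ⟨f, hf, rfl⟩, rfl⟩
  exact hn hf

theorem isTangentSpace_map_proj [CharZero k] {ζ : k} (hζ : IsPrimitiveRoot ζ 6) (n : Fin 7) :
    IsTangentSpace ((subspace ζ n).map (proj (k := k))) := by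
  rw [subspace_eq hζ]
  exact (funSubspace_funStable hζ n).isStable.isTangentSpace_map

theorem exists_eq_smul_counit {x y : Module.Dual k (Bicrossproduct k pair)}
    (h : proj x = proj y) : ∃ c : k, x = y + c • Coalgebra.counit (R := k) := by
  refine ⟨x 1 - y 1, ?_⟩
  have h1 : x - x 1 • Coalgebra.counit (R := k) (A := Bicrossproduct k pair) =
    y - y 1 • Coalgebra.counit (R := k) := h
  refine LinearMap.ext fun b => ?_
  have h2 := congrArg (fun f => f b) h1
  simp only [LinearMap.sub_apply, LinearMap.add_apply, LinearMap.smul_apply, smul_eq_mul] at h2 ⊢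
  linear_combination h2

theorem eq_of_map_proj_le [CharZero k] {ζ : k} (hζ : IsPrimitiveRoot ζ 6) {m n : Fin 7}
    (h : (subspace ζ m).map proj ≤ (subspace ζ n).map (proj (k := k))) : m = n := by
  refine eq_of_funSubspace_le hζ fun f hf => ?_
  rw [subspace_eq hζ, subspace_eq hζ] at h
  obtain ⟨_, ⟨g, hg, rfl⟩, hgf⟩ := h ⟨_, ⟨f, hf, rfl⟩, rfl⟩
  obtain ⟨c, hc⟩ := exists_eq_smul_counit hgf.symm
  refine Submodule.mem_sup.2 ⟨g, hg, c • chi 1, Submodule.smul_mem _ _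
    (Submodule.mem_span_singleton_self _), ?_⟩
  apply (ofFun k pair).injective
  rw [map_add, map_smul, ← counit_eq_ofFun]
  exact hc.symm

/-- The kernel of `proj` is the counit line, which `disjoint_funSubspace` keeps apart, so a basis
stays independent. -/
theorem finrank_map_proj [CharZero k] {ζ : k} (hζ : IsPrimitiveRoot ζ 6) (n : Fin 7) :
    Module.finrank k ((subspace ζ n).map (proj (k := k))) =
      (![1, 4, 4, 4, 4, 9, 9] : Fin 7 → ℕ) n := by
  obtain ⟨b, hb, hb', hs⟩ := exists_basis_funSubspace hζ n
  have h1 : LinearIndependent k ((proj ∘ₗ (ofFun k pair).toLinearMap) ∘ b) := by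
    refine hb.map ?_
    rw [hb', Submodule.disjoint_def]
    intro f hf hf0
    obtain ⟨c, hc⟩ := exists_eq_smul_counit (x := ofFun k pair f) (y := 0)
      (by rw [map_zero]; exact hf0)
    rw [zero_add, counit_eq_ofFun, ← map_smul] at hc
    refine Submodule.disjoint_def.1 (disjoint_funSubspace hζ n) f hf ?_
    rw [(ofFun k pair).injective hc]
    exact Submodule.smul_mem _ _ (Submodule.mem_span_singleton_self _)
  rw [hs, ← Submodule.map_comp, ← hb', Submodule.map_span, ← Set.range_comp,
    finrank_span_eq_card h1, Fintype.card_fin]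

/-! ### The zeroth cohomology -/

theorem δ_repr (p q : S3 × Z6) :
    (basis k pair).repr (δ k pair p.1 p.2) q = if p = q then 1 else 0 := by
  simp [δ, Finsupp.single_apply]

/-- Pairing selects the coproduct terms with right factor δ_b ⊗ v. The conditions for H⁰ thus become
linear equations in the coefficients of a. -/
theorem repr_dualAct_elt (v : Z6) (b : S3) (a : Bicrossproduct k pair) (c : S3) (w : Z6) :
    (basis k pair).repr (dualAct (elt v b) a) (c, w) =
      if lact b⁻¹ w = v then (basis k pair).repr a (c * b, v) else 0 := by
  let F : Bicrossproduct k pair →ₗ[k] k := (basis k pair).coord (c, w) ∘ₗ dualAct (elt v b)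
  let G : Bicrossproduct k pair →ₗ[k] k :=
    (if lact b⁻¹ w = v then (1 : k) else 0) • (basis k pair).coord (c * b, v)
  have hFG : F = G := by
    refine Bicrossproduct.hom_ext fun m x => ?_
    have h2 : ∀ m x, elt (k := k) v b (δ k pair m x) = if (m, x) = (b, v) then 1 else 0 :=
      fun m x => δ_repr (m, x) _
    have h3 : ∀ m x p, (basis k pair).coord p (δ k pair m x) = if (m, x) = p then 1 else 0 :=
      fun m x p => δ_repr (m, x) p
    simp only [F, G, LinearMap.comp_apply, LinearMap.smul_apply, dualAct_δ, map_sum, map_smul,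
      h2, h3, smul_eq_mul, Prod.mk.injEq]
    rw [Finset.sum_eq_single c]
    · have h4 : pair.lact (c⁻¹ * m) x = w ∧ c⁻¹ * m = b ∧ x = v ↔
          lact b⁻¹ w = v ∧ m = c * b ∧ x = v := by
        rw [inv_mul_eq_iff_eq_mul]
        constructor
        · rintro ⟨rfl, rfl, rfl⟩
          refine ⟨?_, rfl, rfl⟩
          rw [inv_mul_cancel_left]
          exact pair.lact_inv_lact _ _
        · rintro ⟨rfl, rfl, rfl⟩
          refine ⟨?_, rfl, rfl⟩
          rw [inv_mul_cancel_left]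
          have := pair.lact_inv_lact b⁻¹ w
          rwa [inv_inv] at this
      by_cases h5 : c⁻¹ * m = b ∧ x = v
      · by_cases h6 : pair.lact (c⁻¹ * m) x = w
        · have := h4.1 ⟨h6, h5⟩
          rw [if_pos h5, if_pos ⟨rfl, h6⟩, if_pos this.1, if_pos this.2]
        · have : ¬ (lact b⁻¹ w = v) := fun h => h6 (h4.2 ⟨h, by
            rw [← h5.1, mul_inv_cancel_left], h5.2⟩).1
          simp [h6, this]
      · have : ¬ (m = c * b ∧ x = v) := fun h => h5 ⟨by rw [h.1, inv_mul_cancel_left], h.2⟩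
        rw [if_neg h5, if_neg this, zero_mul, mul_zero]
    · intro e _ he
      simp [he]
    · simp
  have := congrArg (fun f => f a) hFG
  simp only [F, G, LinearMap.comp_apply, LinearMap.smul_apply, Module.Basis.coord_apply,
    smul_eq_mul, ite_mul, one_mul, zero_mul] at this
  exact this

theorem elt_one (v : Z6) (b : S3) :
    elt (k := k) v b (1 : Bicrossproduct k pair) = if v = 1 then 1 else 0 := by
  rw [one_def, map_sum, Finset.sum_eq_single b]
  · refine (δ_repr (b, 1) (b, v)).trans ?_
    simp [eq_comm]
  · intro c _ hc
    exact (δ_repr (c, 1) (b, v)).trans (by simp [hc])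
  · simp

theorem one_repr (p : S3 × Z6) :
    (basis k pair).repr (1 : Bicrossproduct k pair) p = if p.2 = 1 then 1 else 0 :=
  elt_one p.2 p.1

theorem dualAct_proj (x : Module.Dual k (Bicrossproduct k pair)) (a : Bicrossproduct k pair) :
    dualAct (proj x) a = dualAct x a - x 1 • a := dualAct_augProj x a

/-- The sum of the `δ_m ⊗ 1` over the rotations `m`. -/
noncomputable def rotationSum : Bicrossproduct k pair := ∑ i : ZMod 3, δ k pair (.r i) 1

theorem rotationSum_repr (p : S3 × Z6) : (basis k pair).repr (rotationSum (k := k)) p =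
    if type p.1 ≠ 2 ∧ p.2 = 1 then 1 else 0 := by
  have h : ∀ p : S3 × Z6, (∑ i : ZMod 3, if (DihedralGroup.r i, (1 : Z6)) = p then 1 else 0) =
      if type p.1 ≠ 2 ∧ p.2 = 1 then 1 else 0 := by decide
  rw [rotationSum, map_sum, Finsupp.finsetSum_apply]
  simp only [δ_repr (.r _, 1)]
  exact_mod_cast congrArg (Nat.cast (R := k)) (h p)

/-- The rotations form a subgroup, so translation by a rotation preserves their indicator and x acts
on the sum by the scalar x(1). Calculi without reflections therefore have a non-scalar in H⁰. -/
theorem dualAct_rotationSum {f : S3 × Z6 → k} (hf : ∀ p, type p.1 = 2 → f p = 0) :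
    dualAct (proj (ofFun k pair f)) rotationSum = 0 := by
  have h0 : ∀ (v : Z6) (b : S3), type b ≠ 2 →
      dualAct (elt (k := k) v b) rotationSum = elt (k := k) v b 1 • rotationSum := by
    intro v b hb
    refine (basis k pair).ext_elem fun ⟨c, w⟩ => ?_
    rw [repr_dualAct_elt, elt_one, map_smul, Finsupp.smul_apply, rotationSum_repr,
      rotationSum_repr, smul_eq_mul]
    have h1 : ∀ (v w : Z6) (b c : S3), type b ≠ 2 →
        ((lact b⁻¹ w = v ∧ type (c * b) ≠ 2 ∧ v = 1) ↔ (v = 1 ∧ type c ≠ 2 ∧ w = 1)) := by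
      decide
    have h2 := h1 v w b c hb
    by_cases h3 : v = 1 ∧ type c ≠ 2 ∧ w = 1
    · have h4 := h2.2 h3
      rw [if_pos h4.1, if_pos h4.2, if_pos h3.1, if_pos h3.2, mul_one]
    · have h4 := mt h2.1 h3
      rw [← ite_and, if_neg h4, ite_zero_mul_ite_zero, if_neg h3]
  have h1 : f = ∑ p, f p • Pi.single p (1 : k) := by
    funext q
    simp [Finset.sum_apply, Pi.single_apply]
  have h2 : ∀ p, f p • dualAct (ofFun k pair (Pi.single p 1)) (rotationSum (k := k)) =
      f p • (ofFun k pair (Pi.single p 1) (1 : Bicrossproduct k pair) • rotationSum) := by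
    intro p
    by_cases hp : type p.1 = 2
    · rw [hf p hp, zero_smul, zero_smul]
    · rw [ofFun_single, h0 _ _ hp]
  let D : Module.Dual k (Bicrossproduct k pair) →ₗ[k] Bicrossproduct k pair :=
    { toFun := fun x => dualAct x rotationSum - x 1 • rotationSum
      map_add' := fun x y => by
        rw [dualAct_add, LinearMap.add_apply, add_smul]
        abel
      map_smul' := fun c x => by
        rw [dualAct_smul, LinearMap.smul_apply, smul_assoc, ← smul_sub, RingHom.id_apply] }
  rw [dualAct_proj]
  change D (ofFun k pair f) = 0
  rw [h1, map_sum, map_sum]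
  refine Finset.sum_eq_zero fun p _ => ?_
  rw [map_smul, map_smul]
  change f p • (dualAct (ofFun k pair (Pi.single p 1)) (rotationSum (k := k)) -
    ofFun k pair (Pi.single p 1) (1 : Bicrossproduct k pair) • rotationSum) = 0
  rw [smul_sub, h2, sub_self]

theorem rotationSum_notMem : rotationSum ∉ Submodule.span k {(1 : Bicrossproduct k pair)} := by
  intro h
  obtain ⟨c, hc⟩ := Submodule.mem_span_singleton.1 h
  have h1 := congrArg (fun a => (basis k pair).repr a (1, 1)) hc
  have h2 := congrArg (fun a => (basis k pair).repr a (s, 1)) hc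
  simp only [map_smul, Finsupp.smul_apply, one_repr, rotationSum_repr] at h1 h2
  have e1 : type 1 = 0 := by decide
  have e2 : type s = 2 := by decide
  simp [e1, e2] at h1 h2
  simp [h1] at h2

/-- The two vectors beginning with `s` and `s * t` suffice. Each takes the value 1 at the unit of A,
through its first term only, and so makes the coefficients over the unit of ℤ₆ invariant under right
multiplication by `s`, respectively `s * t`. These generate S₃, and the other coefficients vanish.
-/
theorem mem_span_one {q : k} {a : Bicrossproduct k pair}
    (h : ∀ i, dualAct (proj (basisS q i)) a = 0) :
    a ∈ Submodule.span k {(1 : Bicrossproduct k pair)} := by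
  have hadd : ∀ (v v' : Z6) (b b' : S3),
      dualAct (proj (elt v b + q • elt v' b')) a = 0 → v = 1 → v' ≠ 1 → ∀ c w,
      (basis k pair).repr a (c, w) = (if lact b⁻¹ w = v then (basis k pair).repr a (c * b, v) else
        0)
        + q * (if lact b'⁻¹ w = v' then (basis k pair).repr a (c * b', v') else 0) := by
    intro v v' b b' h hv hv' c w
    rw [← repr_dualAct_elt, ← repr_dualAct_elt]
    rw [dualAct_proj, LinearMap.add_apply, LinearMap.smul_apply, elt_one, elt_one, if_pos hv,
      if_neg hv', smul_zero, add_zero, one_smul, sub_eq_zero] at h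
    conv_lhs => rw [← h, dualAct_add, dualAct_smul, map_add, map_smul, Finsupp.add_apply,
      Finsupp.smul_apply, smul_eq_mul]
  have h0 := hadd _ _ _ _ (h 0) rfl (by decide)
  have h3 := hadd _ _ _ _ (h 3) rfl (by decide)
  have e1 : ∀ c, (basis k pair).repr a (c, 1) = (basis k pair).repr a (c * s, 1) := by
    intro c
    have := h0 c 1
    rwa [if_pos (by decide), if_neg (by decide), mul_zero, add_zero] at this
  have e2 : ∀ c, (basis k pair).repr a (c, 1) = (basis k pair).repr a (c * (s * t), 1) := by
    intro c
    have := h3 c 1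
    rwa [if_pos (by decide), if_neg (by decide), mul_zero, add_zero] at this
  -- The equation from `s` leaves only w = 1 and w = u³; the one from `s * t` excludes u³.
  have e3 : ∀ c w, w ≠ 1 → (basis k pair).repr a (c, w) = 0 := by
    intro c w hw
    by_cases hw3 : w = u ^ 3
    · subst hw3
      have := h3 c (u ^ 3)
      rwa [if_neg (by decide), if_neg (by decide), mul_zero, add_zero] at this
    · have h4 : ∀ w, w ≠ 1 → w ≠ u ^ 3 → lact s⁻¹ w ≠ 1 ∧ lact s⁻¹ w ≠ u ^ 3 := by decide
      have := h0 c w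
      rwa [if_neg (h4 w hw hw3).1, if_neg (h4 w hw hw3).2, mul_zero, add_zero] at this
  have e4 : ∀ c, (basis k pair).repr a (c, 1) = (basis k pair).repr a (1, 1) := by
    -- Every element of S₃ as a word in the generators `s` and `s * t`.
    have h5 : ∀ c : S3, c = 1 ∨ c = s ∨ c = s * t ∨ c = s * s * t ∨ c = s * t * s ∨
      c = s * s * t * s := by decide
    have f1 := e1 1
    have f2 := e2 1
    have f3 := e2 s
    have f4 := e1 (s * t)
    have f5 := e1 (s * (s * t))
    simp only [one_mul, ← mul_assoc] at f1 f2 f3 f4 f5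
    intro c
    rcases h5 c with rfl | rfl | rfl | rfl | rfl | rfl
    · rfl
    · exact f1.symm
    · exact f2.symm
    · exact f3.symm.trans f1.symm
    · exact f4.symm.trans f2.symm
    · exact f5.symm.trans (f3.symm.trans f1.symm)
  refine Submodule.mem_span_singleton.2 ⟨(basis k pair).repr a (1, 1), ?_⟩
  refine (basis k pair).ext_elem fun ⟨c, w⟩ => ?_
  rw [map_smul, Finsupp.smul_apply, one_repr, smul_eq_mul]
  by_cases hw : w = 1
  · subst hw
    rw [if_pos rfl, mul_one, e4 c]
  · rw [if_neg hw, mul_zero, e3 c w hw]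

end
end S3Z6

/-! ### The classification. -/

namespace S3Z6
open HopfAlgebra Bicrossproduct

section
variable {k : Type u} [Field k] [CharZero k] {ζ : k}

theorem exists_isListedCalculus (hζ : IsPrimitiveRoot ζ 6) (n : Fin 7) :
    ∃ C : BicovariantCalculus.{u, u, u} k (Bicrossproduct k pair), IsListedCalculus ζ n C :=
  ⟨(isTangentSpace_map_proj hζ n).bicovariantCalculus,
    (isTangentSpace_map_proj hζ n).quantumTangentSpace_eq⟩

variable {n : Fin 7} {C : BicovariantCalculus.{u, u, u} k (Bicrossproduct k pair)}

theorem IsListedCalculus.dim_eq (hζ : IsPrimitiveRoot ζ 6) (hC : IsListedCalculus ζ n C) :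
    C.dim = (![1, 4, 4, 4, 4, 9, 9] : Fin 7 → ℕ) n := by
  rw [C.dim_eq, hC, finrank_map_proj hζ]

theorem IsListedCalculus.nontrivial (hζ : IsPrimitiveRoot ζ 6) (hC : IsListedCalculus ζ n C) :
    Nontrivial C.Form := by
  rw [C.nontrivial_iff, hC]
  intro h
  have h1 := finrank_map_proj hζ n
  have h2 : ∀ n, (![1, 4, 4, 4, 4, 9, 9] : Fin 7 → ℕ) n ≠ 0 := by decide
  rw [h, finrank_bot] at h1
  exact h2 n h1.symm

/-- A nonzero quotient has its tangent space inside the n-th one, and it contains some m-th one;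
then m = n and all three coincide. -/
theorem IsListedCalculus.irreducible (hζ : IsPrimitiveRoot ζ 6) (hC : IsListedCalculus ζ n C) :
    C.Irreducible := by
  refine ⟨hC.nontrivial hζ, fun C' f hC' => ?_⟩
  rw [BicovariantCalculus.bijective_iff]
  have h1 := BicovariantCalculus.le_of_hom f
  obtain ⟨m, hm⟩ := exists_map_proj_le hζ C'.isTangentSpace (C'.nontrivial_iff.1 hC')
  rw [hC] at h1 ⊢
  obtain rfl := eq_of_map_proj_le hζ (hm.trans h1)
  exact le_antisymm hm h1

/-- The tangent space contains a listed one, whose calculus is thus a nonzero quotient of C; by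
irreducibility it is isomorphic to C. -/
theorem existsUnique_isListedCalculus (hζ : IsPrimitiveRoot ζ 6) (hC : C.Irreducible) :
    ∃! n : Fin 7, IsListedCalculus ζ n C := by
  obtain ⟨n, hn⟩ := exists_map_proj_le hζ C.isTangentSpace (C.nontrivial_iff.1 hC.1)
  obtain ⟨C', hC'⟩ := exists_isListedCalculus hζ n
  obtain ⟨f⟩ := BicovariantCalculus.exists_hom_of_le (C := C) (C' := C')
    (by rwa [show C'.quantumTangentSpace = _ from hC'])
  have h1 := (BicovariantCalculus.bijective_iff f).1 (hC.2 C' f (hC'.nontrivial hζ))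
  have h2 : IsListedCalculus ζ n C := h1.trans hC'
  refine ⟨n, h2, fun m hm => eq_of_map_proj_le hζ (le_of_eq ?_)⟩
  exact hm.symm.trans h2

/-- Only the last two subspaces involve reflections. Without them `rotationSum` has zero
differential; with them `mem_span_one` applies. -/
theorem IsListedCalculus.H0_eq_iff (hζ : IsPrimitiveRoot ζ 6) (hC : IsListedCalculus ζ n C) :
    C.H0 = Submodule.span k {(1 : Bicrossproduct k pair)} ↔ n = 5 ∨ n = 6 := by
  constructor
  · intro h
    by_contra hn
    have h1 : ∀ f ∈ funSubspace ζ n, ∀ p, type p.1 = 2 → f p = 0 := by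
      have h2 : ∀ {R : Set k} {f : S3 × Z6 → k}, f ∈ Submodule.span k (chi '' R) →
          ∀ p, type p.1 = 2 → f p = 0 := by
        intro R f hf p hp
        refine span_chi_apply hf fun h => ?_
        rw [(type_eq_zero_iff _).2 h] at hp
        exact absurd hp (by decide)
      have h3 : ∀ {q : k} {f : S3 × Z6 → k}, f ∈ block 1 q → ∀ p, type p.1 = 2 → f p = 0 :=
        fun hf p hp => hf.1 p (by rw [hp]; decide)
      intro f hf
      fin_cases n
      · exact h2 hf
      · exact h2 hf
      · exact h3 hf
      · exact h3 hf
      · exact h3 hf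
      · exact absurd (Or.inl rfl) hn
      · exact absurd (Or.inr rfl) hn
    apply rotationSum_notMem (k := k)
    rw [← h, C.mem_H0_iff, hC, subspace_eq hζ]
    rintro _ ⟨_, ⟨f, hf, rfl⟩, rfl⟩
    exact dualAct_rotationSum (h1 f hf)
  · intro hn
    have h1 : ∃ q : k, subspace ζ n = Submodule.span k (Set.range (basisS q)) := by
      rcases hn with rfl | rfl
      · exact ⟨1, rfl⟩
      · exact ⟨-1, rfl⟩
    obtain ⟨q, hq⟩ := h1
    refine le_antisymm (fun a ha => mem_span_one (q := q) fun i => ?_) ?_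
    · refine (C.mem_H0_iff a).1 ha _ ?_
      rw [show C.quantumTangentSpace = _ from hC, hq]
      exact ⟨_, Submodule.subset_span ⟨i, rfl⟩, rfl⟩
    · rw [Submodule.span_le, Set.singleton_subset_iff]
      exact C.d_one

end
end S3Z6

/-! ### Bialgebra maps out of a bicrossproduct. -/

namespace Bicrossproduct

/-- Bialgebra maps out of a bicrossproduct. -/
theorem exists_bialgHom {k : Type*} [Field k] {G M : Type*} [Group G] [Group M] [Fintype M]
    [DecidableEq M] {P : MatchedPair G M} {B : Type*} [Ring B] [Bialgebra k B] (φ : M → B)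
    (ψ : G →* B) (hφ : ∀ a b, φ a * φ b = if a = b then φ a else 0) (hφ1 : ∑ a, φ a = 1)
    (hφψ : ∀ a u, φ a * ψ u = ψ u * φ (P.ract a u))
    (hΔφ : ∀ a, Coalgebra.comul (R := k) (φ a) = ∑ b, φ b ⊗ₜ[k] φ (b⁻¹ * a))
    (hΔψ : ∀ u, Coalgebra.comul (R := k) (ψ u) = ∑ c, ψ (P.lact c u) ⊗ₜ[k] (φ c * ψ u))
    (hεφ : ∀ a, Coalgebra.counit (R := k) (φ a) = if a = 1 then 1 else 0)
    (hεψ : ∀ u, Coalgebra.counit (R := k) (ψ u) = 1) :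
    ∃ f : Bicrossproduct k P →ₐc[k] B, ∀ a u, f (δ k P a u) = φ a * ψ u := by
  let f₀ : Bicrossproduct k P →ₗ[k] B := lin fun a u => φ a * ψ u
  have hf₀ : ∀ a u, f₀ (δ k P a u) = φ a * ψ u := lin_δ _
  have hmul : ∀ x y, f₀ (x * y) = f₀ x * f₀ y := by
    have : mulHom.compr₂ f₀ = (LinearMap.mul k B).compl₁₂ f₀ f₀ := by
      refine hom_ext fun a u => hom_ext fun b v => ?_
      simp only [LinearMap.compr₂_apply, LinearMap.compl₁₂_apply, ← mul_def, δ_mul_δ, hf₀,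
        LinearMap.mul_apply']
      have h : φ a * ψ u * (φ b * ψ v) = ψ u * (φ (P.ract a u) * φ b) * ψ v := by
        rw [hφψ]
        simp only [mul_assoc]
      rw [h, hφ]
      split_ifs with h
      · rw [hf₀, map_mul, ← hφψ, mul_assoc]
      · simp
    exact fun x y => congrArg (fun f => f x y) this
  have hone : f₀ 1 = 1 := by
    rw [one_def, map_sum, ← hφ1]
    exact Finset.sum_congr rfl fun a _ => by rw [hf₀, map_one, mul_one]
  let f₁ : Bicrossproduct k P →ₐ[k] B := AlgHom.ofLinearMap f₀ hone hmul
  refine ⟨BialgHom.ofAlgHom f₁ ?_ ?_, hf₀⟩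
  · refine AlgHom.toLinearMap_injective (hom_ext fun a u => ?_)
    change Coalgebra.counit (R := k) (f₀ (δ k P a u)) = Coalgebra.counit (R := k) (δ k P a u)
    rw [hf₀, Bialgebra.counit_mul, hεφ, hεψ, counit_δ, mul_one]
  · refine AlgHom.toLinearMap_injective (hom_ext fun a u => ?_)
    change TensorProduct.map f₀ f₀ (Coalgebra.comul (R := k) (δ k P a u)) =
      Coalgebra.comul (R := k) (f₀ (δ k P a u))
    rw [hf₀, Bialgebra.comul_mul, hΔφ, hΔψ, comul_δ, map_sum, Finset.sum_mul_sum]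
    refine Finset.sum_congr rfl fun b _ => ?_
    rw [TensorProduct.map_tmul, hf₀, hf₀, Finset.sum_eq_single (b⁻¹ * a)]
    · rw [Algebra.TensorProduct.tmul_mul_tmul, ← mul_assoc (φ (b⁻¹ * a)), hφ, if_pos rfl]
    · intro c _ hc
      rw [Algebra.TensorProduct.tmul_mul_tmul, ← mul_assoc (φ (b⁻¹ * a)), hφ, if_neg hc.symm,
        zero_mul, TensorProduct.tmul_zero]
    · simp

end Bicrossproduct

/-! ### The isomorphism with D*(S₃). -/

namespace S3Z6
open Bicrossproduct

/-- The sign of an element of `S₃`. -/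
def sg : S3 → ZMod 2
  | .r _ => 0
  | .sr _ => 1

/-- The exponent `i` of `t ^ i` or `s * t ^ i`. -/
def ex : S3 → ZMod 3
  | .r i => i
  | .sr i => i

/-- The action of a sign on the group of rotations. -/
def sgn (τ : ZMod 2) : ZMod 3 := if τ = 0 then 1 else -1

theorem sgex_bijective : Function.Bijective fun m : S3 => (sg m, ex m) := by decide

theorem sum_sgex {V : Type*} [AddCommMonoid V] (f : ZMod 2 → ZMod 3 → V) :
    ∑ m : S3, f (sg m) (ex m) = ∑ σ, ∑ i, f σ i := by
  rw [← Fintype.sum_prod_type' f]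
  exact Fintype.sum_bijective _ sgex_bijective _ _ fun _ => rfl

theorem sg_mul : ∀ a b : S3, sg (a * b) = sg a + sg b := by decide

theorem ex_mul : ∀ a b : S3, ex (a * b) = ex b + sgn (sg b) * ex a := by decide

theorem conj_r : ∀ (c : S3) (l : ZMod 3),
    c * .r l * c⁻¹ = DihedralGroup.r (sgn (sg c) * l) := by decide

theorem conj_reflection : ∀ b c : S3, c * (.r (ex (b * c)) * s) * c⁻¹ = .r (ex b) * s := by decide

section
variable {k : Type*} [Field k]

/-- The element `∑ g, f(g) δ_g ⊗ h(g)`. -/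
noncomputable def diag (f : S3 → k) (h : S3 → S3) : Bicrossproduct k (MatchedPair.conj S3) :=
  ∑ g, f g • δ k (MatchedPair.conj S3) g (h g)

theorem diag_mul_diag (f f' : S3 → k) (h h' : S3 → S3) :
    diag f h * diag f' h' = diag (f * f') (h * h') := by
  rw [diag, diag, Finset.sum_mul_sum, diag]
  refine Finset.sum_congr rfl fun g _ => ?_
  rw [Finset.sum_eq_single g]
  · rw [smul_mul_smul_comm, δ_mul_δ]
    exact congrArg _ (if_pos rfl)
  · intro b _ hb
    rw [smul_mul_smul_comm, δ_mul_δ]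
    exact (congrArg _ (if_neg hb.symm)).trans (smul_zero _)
  · simp

theorem diag_one : diag (1 : S3 → k) 1 = 1 := by
  simp [diag, one_def]

theorem diag_pow (f : S3 → k) (h : S3 → S3) (n : ℕ) : diag f h ^ n = diag (f ^ n) (h ^ n) := by
  induction n with
  | zero => rw [pow_zero, pow_zero, pow_zero, diag_one]
  | succ n ih => rw [pow_succ, ih, diag_mul_diag, pow_succ, pow_succ]

theorem counit_diag (f : S3 → k) (h : S3 → S3) :
    Coalgebra.counit (R := k) (diag f h) = f 1 := by
  simp [diag, counit_δ]

theorem comul_diag (f : S3 → k) (h : S3 → S3) : Coalgebra.comul (R := k) (diag f h) =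
    ∑ b, ∑ c, f (b * c) • (δ k (MatchedPair.conj S3) b (c * h (b * c) * c⁻¹) ⊗ₜ[k]
      δ k (MatchedPair.conj S3) c (h (b * c))) := by
  rw [diag, map_sum]
  simp only [map_smul, comul_δ, Finset.smul_sum]
  rw [Finset.sum_comm]
  refine Finset.sum_congr rfl fun b _ => ?_
  refine Fintype.sum_equiv (Equiv.mulLeft b⁻¹) _ _ fun g => ?_
  simp only [Equiv.coe_mulLeft, mul_inv_cancel_left]
  rfl

theorem diag_tmul_diag (f f' : S3 → k) (h h' : S3 → S3) : diag f h ⊗ₜ[k] diag f' h' =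
    ∑ b, ∑ c, (f b * f' c) • (δ k (MatchedPair.conj S3) b (h b) ⊗ₜ[k]
      δ k (MatchedPair.conj S3) c (h' c)) := by
  simp only [diag, TensorProduct.sum_tmul, TensorProduct.tmul_sum, TensorProduct.smul_tmul_smul]
  exact Finset.sum_comm

/-- The element `∑ g, δ_g ⊗ t ^ l` where the sum is over the elements of sign `σ`. -/
noncomputable def rot (σ : ZMod 2) (l : ZMod 3) : Bicrossproduct k (MatchedPair.conj S3) :=
  diag (fun g => if sg g = σ then 1 else 0) fun _ => .r l

theorem rot_mul_rot (σ σ' : ZMod 2) (l l' : ZMod 3) :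
    rot (k := k) σ l * rot σ' l' = if σ = σ' then rot σ (l + l') else 0 := by
  rw [rot, rot, diag_mul_diag]
  split_ifs with h
  · subst h
    rw [rot]
    congr 1
    funext g
    simp
  · rw [diag]
    refine Finset.sum_eq_zero fun g _ => ?_
    have : ¬ (sg g = σ ∧ sg g = σ') := fun h' => h (h'.1.symm.trans h'.2)
    rw [Pi.mul_apply, ite_zero_mul_ite_zero, if_neg this, zero_smul]

/-- Sign is a homomorphism, and conjugation acts on rotations only through the sign. -/
theorem comul_rot (σ : ZMod 2) (l : ZMod 3) : Coalgebra.comul (R := k) (rot (k := k) σ l) =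
    ∑ τ, rot (σ - τ) (sgn τ * l) ⊗ₜ[k] rot τ l := by
  rw [rot, comul_diag]
  simp only [rot, diag_tmul_diag]
  rw [Finset.sum_comm]
  simp only [conj_r]
  rw [Finset.sum_comm, Finset.sum_comm (s := Finset.univ (α := ZMod 2))]
  refine Finset.sum_congr rfl fun b _ => ?_
  rw [Finset.sum_comm]
  refine Finset.sum_congr rfl fun c _ => ?_
  rw [Finset.sum_eq_single (sg c)]
  · rw [if_pos rfl, mul_one, sg_mul]
    simp only [eq_sub_iff_add_eq]
  · intro τ _ hτ
    rw [if_neg hτ.symm, mul_zero, zero_smul]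
  · simp

/-- The images of the elements `δ_m ⊗ 1`, for a cubic character `z`. -/
noncomputable def idem (z : AddChar (ZMod 3) k) (m : S3) : Bicrossproduct k (MatchedPair.conj S3) :=
  ∑ l, (3⁻¹ * z (ex m * l)) • rot (sg m) l

/-- The image of the generator of the cyclic group. -/
noncomputable def gen (z : AddChar (ZMod 3) k) : Bicrossproduct k (MatchedPair.conj S3) :=
  diag (fun g => z (-ex g)) fun g => .r (ex g) * s

theorem rot_mul_gen (z : AddChar (ZMod 3) k) (σ : ZMod 2) (l : ZMod 3) :
    rot σ l * gen z = gen z * rot σ (-l) := by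
  rw [rot, rot, gen, diag_mul_diag, diag_mul_diag, mul_comm]
  congr 1
  have h : ∀ (g : S3) (l : ZMod 3), DihedralGroup.r l * (.r (ex g) * s) =
    .r (ex g) * s * .r (-l) := by decide
  exact funext fun g => h g l

/-- Reflections invert rotations, while `u` acts on S₃ by negating the exponent of t; the Fourier
transform matches the two. -/
theorem idem_mul_gen (z : AddChar (ZMod 3) k) (m : S3) :
    idem z m * gen z = gen z * idem z (ract m u) := by
  have h : ∀ m, sg (ract m u) = sg m ∧ ex (ract m u) = -ex m := by decide
  rw [idem, idem, Finset.sum_mul, Finset.mul_sum, (h m).1, (h m).2]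
  refine Fintype.sum_equiv (Equiv.neg _) _ _ fun l => ?_
  rw [smul_mul_assoc, mul_smul_comm, rot_mul_gen, Equiv.neg_apply, neg_mul_neg]

theorem gen_pow (z : AddChar (ZMod 3) k) (n : ℕ) : gen z ^ n =
    diag (fun g => z (-(n * ex g))) fun g => (.r (ex g) * s) ^ n := by
  rw [gen, diag_pow]
  congr 1
  funext g
  rw [Pi.pow_apply, ← AddChar.map_nsmul_eq_pow, nsmul_eq_mul, mul_neg]

theorem gen_pow_six (z : AddChar (ZMod 3) k) : gen z ^ 6 = 1 := by
  have h : ∀ g : S3, (DihedralGroup.r (ex g) * s) ^ 6 = 1 := by decide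
  have h' : ∀ i : ZMod 3, -(((6 : ℕ) : ZMod 3) * i) = 0 := by decide
  rw [gen_pow, ← diag_one]
  congr 1
  · funext g
    rw [h', AddChar.map_zero_eq_one]
    rfl
  · exact funext h

/-- The powers of `gen z`. -/
noncomputable def genHom (z : AddChar (ZMod 3) k) :
    Z6 →* Bicrossproduct k (MatchedPair.conj S3) where
  toFun v := gen z ^ v.toAdd.val
  map_one' := pow_zero _
  map_mul' v w := by
    rw [toAdd_mul, ZMod.val_add, ← pow_eq_pow_mod _ (gen_pow_six z), pow_add]

/-- The exponent of d ▷ u is odd, so the power of a reflection is the reflection itself and only the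
scalar changes, through the exponent modulo 3. -/
theorem genHom_lact_u (z : AddChar (ZMod 3) k) (d : S3) : genHom z (lact d u) =
    diag (fun g => z (-(sgn (sg d) * (1 + ex d) * ex g))) fun g => .r (ex g) * s := by
  have h1 : ∀ d, ((lact d u).toAdd.val : ZMod 3) = sgn (sg d) * (1 + ex d) := by decide
  have h2 : ∀ d g, (DihedralGroup.r (ex g) * s) ^ (lact d u).toAdd.val = .r (ex g) * s := by
    decide
  change gen z ^ (lact d u).toAdd.val = _
  rw [gen_pow, h1]
  congr 1
  exact funext fun g => h2 d g

theorem idem_mul_genHom (z : AddChar (ZMod 3) k) (m : S3) (v : Z6) :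
    idem z m * genHom z v = genHom z v * idem z (ract m v) := by
  have h : ∀ n : ℕ, idem z m * genHom z (u ^ n) = genHom z (u ^ n) * idem z (ract m (u ^ n)) := by
    intro n
    induction n with
    | zero =>
      rw [pow_zero, map_one, mul_one, one_mul]
      exact congrArg _ (pair.ract_one m).symm
    | succ n ih =>
      have h1 : ract m (u ^ n * u) = ract (ract m (u ^ n)) u := pair.ract_mul _ _ _
      have hu : genHom z u = gen z := pow_one _
      rw [pow_succ, map_mul, ← mul_assoc, ih, h1, hu, mul_assoc, mul_assoc, idem_mul_gen]
  rw [← gen_pow_val v]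
  exact h _

theorem counit_rot (σ : ZMod 2) (l : ZMod 3) :
    Coalgebra.counit (R := k) (rot (k := k) σ l) = if σ = 0 then 1 else 0 := by
  rw [rot, counit_diag]
  exact if_congr eq_comm rfl rfl

theorem counit_genHom (z : AddChar (ZMod 3) k) (v : Z6) :
    Coalgebra.counit (R := k) (genHom z v) = 1 := by
  change Coalgebra.counit (R := k) (gen z ^ v.toAdd.val) = 1
  have h : ex 1 = 0 := rfl
  rw [gen_pow, counit_diag, h, mul_zero, neg_zero, AddChar.map_zero_eq_one]

theorem sum_rot (l : ZMod 3) : ∑ σ, rot (k := k) σ l = diag 1 fun _ => .r l := by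
  simp only [rot, diag]
  rw [Finset.sum_comm]
  refine Finset.sum_congr rfl fun g _ => ?_
  rw [← Finset.sum_smul, Finset.sum_ite_eq Finset.univ (sg g), if_pos (Finset.mem_univ _)]
  rfl

theorem sum_rot_zero : ∑ σ, rot (k := k) σ 0 = 1 := by
  rw [sum_rot]
  exact diag_one

variable {z : AddChar (ZMod 3) k} (hz : z.IsPrimitive)
include hz

theorem sum_character (x : ZMod 3) : ∑ i, z (i * x) = if x = 0 then 3 else 0 := by
  have := AddChar.sum_mulShift x hz
  rw [this, ZMod.card]
  norm_num

variable [CharZero k]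

/-- With l = i + j the sum over i becomes Σ z(i(ex a − ex b)), which orthogonality of characters of
ℤ₃ evaluates to 3 or 0. -/
theorem idem_mul_idem (a b : S3) : idem z a * idem z b = if a = b then idem z a else 0 := by
  have h0 : ∀ a b : S3, sg a = sg b → ex a = ex b → a = b := by decide
  rw [idem, idem, Finset.sum_mul_sum]
  simp only [smul_mul_smul_comm, rot_mul_rot]
  by_cases h : sg a = sg b
  · simp only [if_pos h]
    have h1 : ∀ i, ∑ j, (3⁻¹ * z (ex a * i) * (3⁻¹ * z (ex b * j))) • rot (k := k) (sg a) (i + j) =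
        ∑ l, (3⁻¹ * 3⁻¹ * z (ex b * l) * z (i * (ex a - ex b))) • rot (k := k) (sg a) l := by
      intro i
      refine Fintype.sum_equiv (Equiv.addLeft i) _ _ fun j => ?_
      have h2 : z (ex a * i) * z (ex b * j) = z (ex b * (i + j)) * z (i * (ex a - ex b)) := by
        rw [← AddChar.map_add_eq_mul, ← AddChar.map_add_eq_mul]
        congr 1
        ring
      rw [Equiv.coe_addLeft, mul_mul_mul_comm, h2, mul_assoc (3⁻¹ * 3⁻¹ : k)]
    simp only [h1]
    rw [Finset.sum_comm]
    simp only [← Finset.sum_smul, ← Finset.mul_sum, sum_character hz, sub_eq_zero]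
    by_cases h3 : ex a = ex b
    · rw [if_pos (h0 a b h h3), if_pos h3]
      refine Finset.sum_congr rfl fun l _ => ?_
      rw [h3]
      congr 1
      field_simp
    · rw [if_neg h3, if_neg (fun h => h3 (by rw [h]))]
      simp
  · rw [if_neg fun h' => h (by rw [h'])]
    simp [h]

theorem sum_idem : ∑ a, idem z a = 1 := by
  have h1 := sum_sgex fun σ i => ∑ l, (3⁻¹ * z (i * l)) • rot (k := k) σ l
  refine h1.trans ?_
  have h2 : ∀ σ, ∑ i, ∑ l, (3⁻¹ * z (i * l)) • rot (k := k) σ l = rot σ 0 := by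
    intro σ
    rw [Finset.sum_comm]
    simp only [← Finset.sum_smul, ← Finset.mul_sum, sum_character hz]
    rw [Finset.sum_eq_single 0]
    · simp
    · intro l _ hl
      simp [hl]
    · simp
  simp only [h2]
  exact sum_rot_zero

theorem counit_idem (a : S3) : Coalgebra.counit (R := k) (idem z a) = if a = 1 then 1 else 0 := by
  have h0 : ∀ a : S3, a = 1 ↔ ex a = 0 ∧ sg a = 0 := by decide
  rw [idem, map_sum]
  simp only [map_smul, counit_rot, smul_eq_mul, ← Finset.sum_mul, ← Finset.mul_sum]
  simp only [mul_comm (ex a), sum_character hz, h0 a]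
  by_cases h1 : ex a = 0 <;> by_cases h2 : sg a = 0 <;> simp [h1, h2]

/-- Summing over the exponent of b, orthogonality leaves only the pairs of rotations with l = sgn τ
· l′, which are those in `comul_rot`. -/
theorem comul_idem (a : S3) : Coalgebra.comul (R := k) (idem z a) =
    ∑ b, idem z b ⊗ₜ[k] idem z (b⁻¹ * a) := by
  have h1 : ∀ a b : S3, sg (b⁻¹ * a) = sg a - sg b ∧
    ex (b⁻¹ * a) = ex a - sgn (sg a - sg b) * ex b := by decide
  have h2 := sum_sgex fun σ i => (∑ l, (3⁻¹ * z (i * l)) • rot (k := k) σ l) ⊗ₜ[k]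
    ∑ l, (3⁻¹ * z ((ex a - sgn (sg a - σ) * i) * l)) • rot (k := k) (sg a - σ) l
  simp only [idem, (h1 a _).1, (h1 a _).2]
  rw [h2, map_sum]
  simp only [map_smul, comul_rot, Finset.smul_sum]
  rw [Finset.sum_comm]
  refine Fintype.sum_equiv (Equiv.subLeft (sg a)) _ _ fun τ => ?_
  rw [Equiv.subLeft_apply, sub_sub_cancel]
  have h3 : ∀ i, (∑ l, (3⁻¹ * z (i * l)) • rot (k := k) (sg a - τ) l) ⊗ₜ[k]
      ∑ l, (3⁻¹ * z ((ex a - sgn τ * i) * l)) • rot (k := k) τ l =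
      ∑ l', ∑ l, (3⁻¹ * 3⁻¹ * z (ex a * l') * z (i * (l - sgn τ * l'))) •
        (rot (k := k) (sg a - τ) l ⊗ₜ[k] rot (k := k) τ l') := by
    intro i
    simp only [TensorProduct.tmul_sum, TensorProduct.sum_tmul, TensorProduct.smul_tmul_smul]
    refine Finset.sum_congr rfl fun l' _ => Finset.sum_congr rfl fun l _ => ?_
    have h4 : z (i * l) * z ((ex a - sgn τ * i) * l') =
        z (ex a * l') * z (i * (l - sgn τ * l')) := by
      rw [← AddChar.map_add_eq_mul, ← AddChar.map_add_eq_mul]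
      congr 1
      ring
    rw [mul_mul_mul_comm, h4, mul_assoc (3⁻¹ * 3⁻¹ : k)]
  simp only [h3]
  rw [Finset.sum_comm]
  refine Finset.sum_congr rfl fun l' _ => ?_
  rw [Finset.sum_comm]
  simp only [← Finset.sum_smul, ← Finset.mul_sum, sum_character hz, sub_eq_zero]
  rw [Finset.sum_eq_single (sgn τ * l')]
  · rw [if_pos rfl]
    congr 1
    field_simp
  · intro l _ hl
    rw [if_neg hl, mul_zero, zero_smul]
  · simp

/-- At fixed sign σ of c, orthogonality over its exponent selects the rotation with l = sgn σ · ex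
b. It turns the reflection attached to c into the one attached to bc in the second factor, while
`conj_reflection` identifies the first. -/
theorem comul_gen : Coalgebra.comul (R := k) (gen z) =
    ∑ c, genHom z (lact c u) ⊗ₜ[k] (idem z c * gen z) := by
  have h1 : ∀ c : S3, idem z c * gen z =
      ∑ l, (3⁻¹ * z (ex c * l)) • (rot (sg c) l * gen z) := by
    intro c
    rw [idem, Finset.sum_mul]
    exact Finset.sum_congr rfl fun l _ => smul_mul_assoc _ _ _
  simp only [genHom_lact_u, h1]
  have h2 := sum_sgex fun σ i => diag (fun g => z (-(sgn σ * (1 + i) * ex g)))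
    (fun g => DihedralGroup.r (ex g) * s) ⊗ₜ[k] ∑ l, (3⁻¹ * z (i * l)) • (rot σ l * gen z)
  refine Eq.trans ?_ h2.symm
  have h3 : ∀ σ i, diag (fun g => z (-(sgn σ * (1 + i) * ex g)))
      (fun g => DihedralGroup.r (ex g) * s) ⊗ₜ[k] ∑ l, (3⁻¹ * z (i * l)) • (rot σ l * gen z) =
      ∑ b, ∑ l, (3⁻¹ * z (-(sgn σ * ex b)) * z (i * (l - sgn σ * ex b))) •
        (δ k (MatchedPair.conj S3) b (.r (ex b) * s) ⊗ₜ[k] (rot σ l * gen z)) := by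
    intro σ i
    simp only [diag, TensorProduct.tmul_sum, TensorProduct.sum_tmul, TensorProduct.smul_tmul_smul]
    rw [Finset.sum_comm]
    refine Finset.sum_congr rfl fun b _ => Finset.sum_congr rfl fun l _ => ?_
    have h4 : z (-(sgn σ * (1 + i) * ex b)) * z (i * l) =
        z (-(sgn σ * ex b)) * z (i * (l - sgn σ * ex b)) := by
      rw [← AddChar.map_add_eq_mul, ← AddChar.map_add_eq_mul]
      congr 1
      ring
    rw [mul_left_comm, h4, mul_assoc]
  have h4 : ∀ σ, ∑ i, diag (fun g => z (-(sgn σ * (1 + i) * ex g)))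
      (fun g => DihedralGroup.r (ex g) * s) ⊗ₜ[k] ∑ l, (3⁻¹ * z (i * l)) • (rot σ l * gen z) =
      ∑ b, ∑ c, (if sg c = σ then z (-(sgn σ * ex b)) * z (-ex c) else 0) •
        (δ k (MatchedPair.conj S3) b (.r (ex b) * s) ⊗ₜ[k]
          δ k (MatchedPair.conj S3) c (.r (sgn σ * ex b) * (.r (ex c) * s))) := by
    intro σ
    simp only [h3]
    rw [Finset.sum_comm]
    refine Finset.sum_congr rfl fun b _ => ?_
    rw [Finset.sum_comm]
    simp only [← Finset.sum_smul, ← Finset.mul_sum, sum_character hz, sub_eq_zero]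
    rw [Finset.sum_eq_single (sgn σ * ex b)]
    · rw [if_pos rfl, rot, gen, diag_mul_diag, diag, TensorProduct.tmul_sum, Finset.smul_sum]
      refine Finset.sum_congr rfl fun c _ => ?_
      rw [TensorProduct.tmul_smul, smul_smul]
      congr 1
      rw [Pi.mul_apply, ite_mul, one_mul, zero_mul, mul_ite, mul_zero]
      refine if_congr Iff.rfl ?_ rfl
      field_simp
    · intro l _ hl
      rw [if_neg hl, mul_zero, zero_smul]
    · simp
  simp only [h4]
  rw [gen, comul_diag, Finset.sum_comm (s := Finset.univ (α := ZMod 2))]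
  refine Finset.sum_congr rfl fun b _ => ?_
  rw [Finset.sum_comm]
  refine Finset.sum_congr rfl fun c _ => ?_
  rw [Finset.sum_eq_single (sg c)]
  · have h5 : ∀ b c, DihedralGroup.r (sgn (sg c) * ex b) * (.r (ex c) * s) =
      .r (ex (b * c)) * s := by decide
    rw [if_pos rfl, conj_reflection, h5, ← AddChar.map_add_eq_mul, ex_mul, neg_add_rev]
  · intro σ _ hσ
    rw [if_neg hσ.symm, zero_smul]
  · simp

/-- Induction on the powers of `u` by the matching condition c ▷ uⁿ⁺¹ = (c ▷ u)((c ◁ u) ▷ uⁿ);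
orthogonality of the idempotents kills the cross terms. -/
theorem comul_genHom (v : Z6) : Coalgebra.comul (R := k) (genHom z v) =
    ∑ c, genHom z (lact c v) ⊗ₜ[k] (idem z c * genHom z v) := by
  have hu : genHom z u = gen z := pow_one _
  have h : ∀ n : ℕ, Coalgebra.comul (R := k) (genHom z (u ^ n)) =
      ∑ c, genHom z (lact c (u ^ n)) ⊗ₜ[k] (idem z c * genHom z (u ^ n)) := by
    intro n
    induction n with
    | zero =>
      have h1 : ∀ c, lact c 1 = 1 := pair.lact_one
      simp only [pow_zero, h1, map_one, mul_one]
      rw [← TensorProduct.tmul_sum, sum_idem hz, Bialgebra.comul_one,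
        Algebra.TensorProduct.one_def]
    | succ n ih =>
      have h1 : ∀ c, lact c (u * u ^ n) = lact c u * lact (ract c u) (u ^ n) := fun c =>
        pair.lact_mul _ _ _
      rw [pow_succ', map_mul, hu, Bialgebra.comul_mul, ih, comul_gen hz, Finset.sum_mul_sum]
      refine Finset.sum_congr rfl fun c _ => ?_
      rw [Finset.sum_eq_single (ract c u), h1, map_mul, Algebra.TensorProduct.tmul_mul_tmul]
      · rw [idem_mul_gen, mul_assoc, ← mul_assoc (idem z _) (idem z _), idem_mul_idem hz,
          if_pos rfl, ← mul_assoc, ← idem_mul_gen, mul_assoc]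
      · intro d _ hd
        rw [Algebra.TensorProduct.tmul_mul_tmul, idem_mul_gen, mul_assoc,
          ← mul_assoc (idem z _) (idem z _), idem_mul_idem hz, if_neg hd.symm, zero_mul,
          mul_zero, TensorProduct.tmul_zero]
      · simp
  rw [← gen_pow_val v]
  exact h _

/-- Fourier inversion recovers `rot` from the idempotents. Even powers of `gen z` are scalar-valued
on the diagonal, and inverting them gives the indicators of ex g = a. Products of the two isolate
δ_g ⊗ tˡ, and a further factor `gen z` produces the reflections. -/
theorem adjoin_eq_top {S : Subalgebra k (Bicrossproduct k (MatchedPair.conj S3))}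
    (h1 : ∀ m, idem z m ∈ S) (h2 : gen z ∈ S) : S = ⊤ := by
  have hrot : ∀ σ l, rot σ l ∈ S := by
    intro σ l
    have h3 := sum_sgex fun τ i => (if τ = σ then z (-(i * l)) else 0) •
      ∑ l', (3⁻¹ * z (i * l')) • rot (k := k) τ l'
    have h4 : ∀ i l', (z (-(i * l)) * (3⁻¹ * z (i * l'))) = 3⁻¹ * z (i * (l' - l)) := by
      intro i l'
      rw [mul_left_comm, ← AddChar.map_add_eq_mul]
      congr 2
      ring
    rw [Finset.sum_eq_single σ (fun τ _ hτ => by simp [hτ]) (by simp)] at h3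
    simp only [if_true, Finset.smul_sum, smul_smul, h4] at h3
    rw [Finset.sum_comm (s := Finset.univ (α := ZMod 3))] at h3
    simp only [← Finset.sum_smul, ← Finset.mul_sum, sum_character hz, sub_eq_zero] at h3
    rw [Finset.sum_eq_single l (fun l' _ hl => by simp [hl]) (by simp), if_pos rfl,
      inv_mul_cancel₀ three_ne_zero, one_smul] at h3
    rw [← h3]
    refine S.sum_mem fun m _ => ?_
    have h5 : ∑ l', ((if sg m = σ then z (-(ex m * l)) else 0) * (3⁻¹ * z (ex m * l'))) •
        rot (k := k) (sg m) l' = (if sg m = σ then z (-(ex m * l)) else 0) • idem z m := by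
      rw [idem, Finset.smul_sum]
      exact Finset.sum_congr rfl fun l' _ => (smul_smul _ _ _).symm
    rw [h5]
    exact S.smul_mem (h1 m) _
  have hex : ∀ a, diag (fun g => if ex g = a then (1 : k) else 0) 1 ∈ S := by
    intro a
    have h3 : diag (fun g => if ex g = a then (1 : k) else 0) 1 =
        ∑ j : ZMod 3, (3⁻¹ * z (2 * j * a)) • gen z ^ (2 * j.val) := by
      have h4 : ∀ (j : ZMod 3) (g : S3), (DihedralGroup.r (ex g) * s) ^ (2 * j.val) = 1 := by
        decide
      simp only [gen_pow, h4, diag, Finset.smul_sum]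
      rw [Finset.sum_comm]
      refine Finset.sum_congr rfl fun g _ => ?_
      simp only [smul_smul]
      have h5 : ∀ j : ZMod 3, 3⁻¹ * z (2 * j * a) * z (-(((2 * j.val : ℕ) : ZMod 3) * ex g)) =
          3⁻¹ * z (j * (2 * (a - ex g))) := by
        intro j
        rw [mul_assoc, ← AddChar.map_add_eq_mul]
        congr 2
        rw [Nat.cast_mul, ZMod.natCast_zmod_val]
        push_cast
        ring
      have h6 : ∀ a b : ZMod 3, 2 * (a - b) = 0 ↔ b = a := by decide
      simp only [h5]
      rw [← Finset.sum_smul, ← Finset.mul_sum, sum_character hz, Pi.one_apply]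
      congr 1
      simp only [h6]
      split_ifs <;> simp
    rw [h3]
    exact S.sum_mem fun j _ => S.smul_mem (S.pow_mem h2 _) _
  have hr : ∀ g l, δ k (MatchedPair.conj S3) g (.r l) ∈ S := by
    intro g l
    have h0 : ∀ g b : S3, ex b = ex g ∧ sg b = sg g ↔ b = g := by decide
    have h3 := S.mul_mem (hex (ex g)) (hrot (sg g) l)
    rw [rot, diag_mul_diag, diag, Finset.sum_eq_single g] at h3
    · simpa using h3
    · intro b _ hb
      rw [Pi.mul_apply, ite_zero_mul_ite_zero, if_neg ((h0 g b).not.2 hb), zero_smul]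
    · simp
  have hs : ∀ g l, δ k (MatchedPair.conj S3) g (.r l * (.r (ex g) * s)) ∈ S := by
    intro g l
    have h3 := S.mul_mem (hr g l) h2
    have h4 : δ k (MatchedPair.conj S3) g (.r l) * gen z =
        z (-ex g) • δ k (MatchedPair.conj S3) g (.r l * (.r (ex g) * s)) := by
      rw [gen, diag, Finset.mul_sum, Finset.sum_eq_single g]
      · rw [mul_smul_comm, δ_mul_δ]
        exact congrArg _ (if_pos rfl)
      · intro b _ hb
        rw [mul_smul_comm, δ_mul_δ]
        exact (congrArg _ (if_neg hb.symm)).trans (smul_zero _)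
      · simp
    rw [h4] at h3
    have h5 := S.smul_mem h3 (z (ex g))
    rwa [smul_smul, ← AddChar.map_add_eq_mul, add_neg_cancel, AddChar.map_zero_eq_one,
      one_smul] at h5
  have hall : ∀ g h, δ k (MatchedPair.conj S3) g h ∈ S := by
    have h3 : ∀ g h : S3, (∃ l, h = .r l) ∨ ∃ l, h = .r l * (.r (ex g) * s) := by decide
    intro g h
    rcases h3 g h with ⟨l, rfl⟩ | ⟨l, hl⟩
    · exact hr g l
    · rw [hl]
      exact hs g l
  refine eq_top_iff.2 fun x _ => ?_
  rw [← (basis k (MatchedPair.conj S3)).sum_repr x]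
  exact S.sum_mem fun p _ => S.smul_mem (hall p.1 p.2) _

/-- The isomorphism with the bicrossproduct for the conjugation action. -/
theorem nonempty_equiv : Nonempty (Bicrossproduct k pair ≃ₐc[k]
    Bicrossproduct k (MatchedPair.conj S3)) := by
  obtain ⟨f, hf⟩ := exists_bialgHom (P := pair) (idem z) (genHom z) (idem_mul_idem hz)
    (sum_idem hz) (idem_mul_genHom z) (comul_idem hz) (comul_genHom hz) (counit_idem hz)
    (counit_genHom z)
  refine ⟨BialgEquiv.ofBijective f ?_⟩
  let f' : Bicrossproduct k pair →ₐ[k] Bicrossproduct k (MatchedPair.conj S3) := f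
  have h1 : Function.Surjective f' := by
    have h2 : f'.range = ⊤ := by
      refine adjoin_eq_top hz (fun m => ⟨δ k pair m 1, ?_⟩) ⟨∑ m, δ k pair m u, ?_⟩
      · exact (hf m 1).trans (by rw [map_one, mul_one])
      · have h3 : f (∑ m, δ k pair m u) = gen z := by
          have hu : genHom z u = gen z := pow_one _
          rw [map_sum]
          simp only [hf, hu]
          rw [← Finset.sum_mul, sum_idem hz, one_mul]
        exact h3
    intro x
    have hx : x ∈ f'.range := by
      rw [h2]
      trivial
    exact hx
  have : FiniteDimensional k (Bicrossproduct k (MatchedPair.conj S3)) :=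
    Module.Basis.finiteDimensional_of_finite (basis k (MatchedPair.conj S3))
  refine ⟨?_, h1⟩
  -- Both algebras have dimension 36, so the surjection is bijective.
  refine (LinearMap.injective_iff_surjective_of_finrank_eq_finrank
    (f := f'.toLinearMap) ?_).2 h1
  rw [Module.finrank_eq_card_basis (basis k pair),
    Module.finrank_eq_card_basis (basis k (MatchedPair.conj S3))]
  rfl

end
end S3Z6

theorem mainTheorem10 {k : Type u} [Field k] [CharZero k] (ζ : k)
    (hζ : IsPrimitiveRoot ζ 6) :
    Nonempty (Bicrossproduct k S3Z6.pair ≃ₐc[k] Bicrossproduct k (MatchedPair.conj S3)) ∧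
    (∀ n : Fin 7, ∃ C : BicovariantCalculus.{u, u, u} k (Bicrossproduct k S3Z6.pair),
      S3Z6.IsListedCalculus ζ n C) ∧
    (∀ (n : Fin 7) (C C' : BicovariantCalculus.{u, u, u} k (Bicrossproduct k S3Z6.pair)),
      S3Z6.IsListedCalculus ζ n C → S3Z6.IsListedCalculus ζ n C' → C.Isomorphic C') ∧
    (∀ (n : Fin 7) (C : BicovariantCalculus.{u, u, u} k (Bicrossproduct k S3Z6.pair)),
      S3Z6.IsListedCalculus ζ n C →
        C.Irreducible ∧ C.dim = (![1, 4, 4, 4, 4, 9, 9] : Fin 7 → ℕ) n) ∧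
    (∀ C : BicovariantCalculus.{u, u, u} k (Bicrossproduct k S3Z6.pair),
      C.Irreducible → ∃! n : Fin 7, S3Z6.IsListedCalculus ζ n C) ∧
    (∀ (n : Fin 7) (C : BicovariantCalculus.{u, u, u} k (Bicrossproduct k S3Z6.pair)),
      S3Z6.IsListedCalculus ζ n C →
        (C.H0 = Submodule.span k {(1 : Bicrossproduct k S3Z6.pair)} ↔ n = 5 ∨ n = 6)) := by
  -- ζ² is a primitive cube root of unity and defines the character of ℤ₃ in the isomorphism.
  have hz := AddChar.zmodChar_primitive_of_primitive_root 3
    (hζ.pow (by norm_num) (show 6 = 2 * 3 by norm_num))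
  exact ⟨S3Z6.nonempty_equiv hz, S3Z6.exists_isListedCalculus hζ,
    fun n C C' hC hC' => BicovariantCalculus.isomorphic_of_eq (hC.trans hC'.symm),
    fun n C hC => ⟨hC.irreducible hζ, hC.dim_eq hζ⟩,
    fun C hC => S3Z6.existsUnique_isListedCalculus hζ hC,
    fun n C hC => hC.H0_eq_iff hζ⟩
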